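/- **Setting.** Let $(\mathbb S,\mathcal S)$ be a measurable space, $\Psi:\mathbb R\times\mathbb S\to\mathbb R$ measurable, $\varepsilon_1,\varepsilon_2,\dots$ i.i.d. random elements of $\mathbb S$, independent of the real random variable $X_0$, and $X_n=\Psi(X_{n-1},\varepsilon_n)$ for $n\ge 1$. Assume that the chain is stationary, i.e. $\Psi(X_0,\varepsilon_1)$ and $X_0$ have the same law, and the following two conditions. (a) There are $0<\alpha<\infty$ and $0\le p\le 1$ such that, as $x\to\infty$, $P(|X_0|>xy)/P(|X_0|>x)\to y^{-\alpha}$ for all $y>0$, and $P(X_0>x)/P(|X_0|>x)\to p$. Put $p(1)=p$, $p(-1)=1-p$. (b) There is a measurable $\mathbb V\subset\mathbb S$ with $P(\varepsilon_1\in\mathbb V)=1$ such that for each $\sigma\in\{-1,1\}$ with $p(\sigma)>0$ and each $v\in\mathbb V$ the limit $\phi(v,\sigma)=\lim_{x\to\sigma\infty}x^{-1}\Psi(x,v)$ exists in $\mathbb R$. If moreover $P[\phi(\varepsilon_1,\sigma)=0]>0$ for some such $\sigma$, then there is a measurable $\mathbb W\subset\mathbb V$ with $P(\varepsilon_1\in\mathbb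 W)=1$ and $\sup_{|y|\le x}|\Psi(y,v)|=O(x)$ as $x\to\infty$ for each $v\in\mathbb W$. **Tail chain.** Let $(u)_+^\alpha=\max(u,0)^\alpha$. Let $\mathcal M_{p,\alpha}$ be the set of laws of pairs $(I,M)$ in $\{-1,1\}\times\mathbb R$ with $P(I=1)=p$ and $\mathrm E[(\sigma M)_+^\alpha]\le P(I=\sigma)$ for $\sigma=\pm1$. Two laws $\mathcal L(I,M),\mathcal L(I^*,M^*)$ in $\mathcal M_{p,\alpha}$ are adjoint if $\mathrm E[(xI)_+^\alpha\wedge(yM)_+^\alpha]=\mathrm E[(xM^*)_+^\alpha\wedge(yI^*)_+^\alpha]$ for all real $x,y$. A process $\{M_t:t\in\mathbb Z\}$ is a back-and-forth tail chain with index $\alpha$ and forward transition law $\mu\in\mathcal M_{p,\alpha}$, in short a $\mathrm{BFTC}(\alpha,\mu)$, if (i) $\mathcal L(M_0,M_1)=\mu$; (ii) $\mathcal L(M_0,M_{-1})$ is adjoint to $\mu$ in $\mathcal M_{p,\alpha}$; (iii) for each $t\ge1$ the conditional law of $M_t$ given $(M_s)_{s\le t-1}$ is, on $M_{t-1}=x$,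 the law of $xM_1/M_0$ given $M_0=\operatorname{sign}x$ if $x\ne0$ and the unit mass $\delta_0$ if $x=0$; (iv) for each $t\ge1$ the conditional law of $M_{-t}$ given $(M_s)_{s\ge -t+1}$ is, on $M_{-t+1}=x$, the law of $xM_{-1}/M_0$ given $M_0=\operatorname{sign}x$ if $x\ne0$ and $\delta_0$ if $x=0$. Let $\mu$ be the law of $(I,\,I\,\phi(\varepsilon_1,I))$, where $I$ is independent of $\varepsilon_1$ and $P(I=1)=p=1-P(I=-1)$. **Theorem.** A $\mathrm{BFTC}(\alpha,\mu)$ exists (in particular $\mu\in\mathcal M_{p,\alpha}$). Let $\{M_t:t\in\mathbb Z\}$ be any such process. For every integer $t\ge0$, let $\mathbb E_{t+1}=[-\infty,\infty]^{t+1}\setminus\{0\}$ and, for $i=0,\dots,t$, $$\mathbb F_{t,i}=\{x\in\mathbb E_{t+1}:x_0=\dots=x_{i-1}=0,\ x_i\ne0\},\qquad \mathbb G_{t,i}=\{x\in\mathbb E_{t+1}:x_i\ne0,\ x_{i+1}=\dots=x_t=0\}.$$ Then there is a Radon measure $\mu_t$ on $\mathbb E_{t+1}$ such that, as $x\to\infty$,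 $$\frac1{P(|X_0|>x)}\,P[(x^{-1}X_0,\dots,x^{-1}X_t)\in\cdot\,]\ \to\ \mu_t\quad\text{vaguely in }\mathbb E_{t+1}.$$ The measure $\mu_t$ is the unique measure such that, for all measurable $f\ge0$, $$\int_{\mathbb F_{t,0}}f\,d\mu_t=\int_0^\infty\mathrm E[f(zM_0,\dots,zM_t)]\,d(-z^{-\alpha}),$$ $$\int_{\mathbb F_{t,i}}f\,d\mu_t=\int_0^\infty\mathrm E[f(0,\dots,0,zM_0,\dots,zM_{t-i})\mathbf 1(M_{-1}=0)]\,d(-z^{-\alpha}),\quad i=1,\dots,t,$$ and it is also the unique measure such that, for all measurable $f\ge0$, $$\int_{\mathbb G_{t,t}}f\,d\mu_t=\int_0^\infty\mathrm E[f(zM_{-t},\dots,zM_0)]\,d(-z^{-\alpha}),$$ $$\int_{\mathbb G_{t,i}}f\,d\mu_t=\int_0^\infty\mathrm E[f(zM_{-i},\dots,zM_0,0,\dots,0)\mathbf 1(M_1=0)]\,d(-z^{-\alpha}),\quad i=0,\dots,t-1.$$ In particular, for every $t\ge0$ the law of $(X_0,\dots,X_t)$ is multivariate regularly varying: there are $a>0$,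 a function $V$ that is measurable, positive near infinity and regularly varying with index $-a$, and a non-zero Radon measure $m$ on $\mathbb E_{t+1}$ such that $V(x)^{-1}P[(x^{-1}X_0,\dots,x^{-1}X_t)\in\cdot\,]\to m$ vaguely in $\mathbb E_{t+1}$ as $x\to\infty$. -/

import Mathlib

open MeasureTheory ProbabilityTheory Filter Topology Set
open scoped ENNReal CompactlySupported

/-- The weights `p(1) = p` and `p(-1) = 1 - p`. -/
noncomputable def signWeight (p σ : ℝ) : ℝ := if σ = 1 then p else 1 - p

/-- The positive part power `(u)_+ ^ α`. -/
noncomputable def posPow (α u : ℝ) : ℝ≥0∞ := ENNReal.ofReal ((max u 0) ^ α)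

/-- `X 0, X 1, …` is a stationary Markov chain `X (n + 1) = Ψ (X n, ε_{n+1})`. The innovation
`ε_{n+1}`, which drives the step from `n` to `n + 1`, is denoted by `ε n`. -/
structure IsStationaryRecursion {Ω S : Type*} [MeasurableSpace Ω] [MeasurableSpace S]
    (P : Measure Ω) (Ψ : ℝ → S → ℝ) (ε : ℕ → Ω → S) (X : ℕ → Ω → ℝ) : Prop where
  measurable_map : Measurable (Function.uncurry Ψ)
  measurable_innov : ∀ n, Measurable (ε n)
  measurable_chain : ∀ n, Measurable (X n)
  innov_indep : iIndepFun ε P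
  innov_identDistrib : ∀ n, IdentDistrib (ε n) (ε 0) P P
  init_indep : IndepFun (X 0) (fun ω n => ε n ω) P
  recursion : ∀ n, ∀ᵐ ω ∂P, X (n + 1) ω = Ψ (X n ω) (ε n ω)
  stationary : P.map (fun ω => Ψ (X 0 ω) (ε 0 ω)) = P.map (X 0)

/-- The real random variable `ξ` has regularly varying tails with index `α` and upper tail
weight `p`. -/
structure HasRegVaryingTails {Ω : Type*} [MeasurableSpace Ω]
    (P : Measure Ω) (ξ : Ω → ℝ) (α p : ℝ) : Prop where
  index_pos : 0 < α
  weight_mem : p ∈ Icc (0 : ℝ) 1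
  tendsto_abs : ∀ y : ℝ, 0 < y →
    Tendsto (fun x : ℝ => P.real {ω | x * y < |ξ ω|} / P.real {ω | x < |ξ ω|}) atTop
      (𝓝 (y ^ (-α)))
  tendsto_pos :
    Tendsto (fun x : ℝ => P.real {ω | x < ξ ω} / P.real {ω | x < |ξ ω|}) atTop (𝓝 p)

/-- The condition on the asymptotics of `Ψ (x, ·)` for large `|x|`; `ν` is the law of the
innovations, and `φ v σ` is the limit of `Ψ (x, v) / x` as `x → σ ∞`. -/
def HasTailLimit {S : Type*} [MeasurableSpace S] (ν : Measure S) (Ψ : ℝ → S → ℝ) (p : ℝ)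
    (φ : S → ℝ → ℝ) : Prop :=
  ∃ V : Set S, MeasurableSet V ∧ ν V = 1 ∧
    (∀ σ ∈ ({-1, 1} : Set ℝ), 0 < signWeight p σ → ∀ v ∈ V,
      Tendsto (fun x : ℝ => Ψ (σ * x) v / (σ * x)) atTop (𝓝 (φ v σ))) ∧
    ((∃ σ ∈ ({-1, 1} : Set ℝ), 0 < signWeight p σ ∧ 0 < ν {v | φ v σ = 0}) →
      ∃ W : Set S, W ⊆ V ∧ MeasurableSet W ∧ ν W = 1 ∧
        ∀ v ∈ W, ∃ C x₀ : ℝ, ∀ x : ℝ, x₀ ≤ x → ∀ y : ℝ, |y| ≤ x → |Ψ y v| ≤ C * x)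

/-- The law of `(M₀, M₁)` with `M₁ = M₀ φ(ε, sign M₀)`, where `M₀` and `ε` are independent,
`P(M₀ = 1) = p = 1 - P(M₀ = -1)`, and `ε` has law `ν`. -/
noncomputable def forwardLaw {S : Type*} [MeasurableSpace S] (ν : Measure S) (p : ℝ)
    (φ : S → ℝ → ℝ) : Measure (ℝ × ℝ) :=
  ((ENNReal.ofReal p • Measure.dirac (1 : ℝ) +
      ENNReal.ofReal (1 - p) • Measure.dirac (-1 : ℝ)).prod ν).map
    (fun q => (q.1, q.1 * φ q.2 (Real.sign q.1)))

/-- The set `M_{p,α}` of laws of random pairs `(I, M)` with `P(I = 1) = p = 1 - P(I = -1)` and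
`E[(σ M)_+ ^ α] ≤ P(I = σ)` for `σ = ± 1`. -/
structure IsTailPairLaw (α p : ℝ) (μ : Measure (ℝ × ℝ)) : Prop where
  prob : IsProbabilityMeasure μ
  plus : μ {q | q.1 = 1} = ENNReal.ofReal p
  minus : μ {q | q.1 = -1} = ENNReal.ofReal (1 - p)
  moment : ∀ σ ∈ ({-1, 1} : Set ℝ), ∫⁻ q, posPow α (σ * q.2) ∂μ ≤ μ {q | q.1 = σ}

/-- The adjoint relation between two elements of `M_{p,α}`. -/
structure AreAdjointLaws (α p : ℝ) (μ μ' : Measure (ℝ × ℝ)) : Prop where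
  left_mem : IsTailPairLaw α p μ
  right_mem : IsTailPairLaw α p μ'
  min_eq : ∀ x y : ℝ,
    ∫⁻ q, min (posPow α (x * q.1)) (posPow α (y * q.2)) ∂μ =
      ∫⁻ q, min (posPow α (x * q.2)) (posPow α (y * q.1)) ∂μ'

/-- The transition law out of the state `x`: the law of `x M / I` given `I = sign x`, where
`(I, M)` has law `μ`, and the point mass at `0` if `x = 0`. -/
noncomputable def tailTransition (μ : Measure (ℝ × ℝ)) (x : ℝ) : Measure ℝ :=
  if x = 0 then Measure.dirac 0
  else (ProbabilityTheory.cond μ {q | q.1 = Real.sign x}).map (fun q => x * (q.2 / q.1))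

/-- `(M t)_{t ∈ ℤ}` is a back-and-forth tail chain with index `α` and forward transition law
`μ ∈ M_{p,α}`. -/
structure IsBackForthTailChain {Ω : Type*} [MeasurableSpace Ω] (P : Measure Ω)
    (α p : ℝ) (μ : Measure (ℝ × ℝ)) (M : ℤ → Ω → ℝ) : Prop where
  measurable : ∀ t, Measurable (M t)
  forward_law : P.map (fun ω => (M 0 ω, M 1 ω)) = μ
  adjoint_law : AreAdjointLaws α p μ (P.map (fun ω => (M 0 ω, M (-1) ω)))
  forward_transition : ∀ t : ℤ, 1 ≤ t → ∀ B : Set ℝ, MeasurableSet B →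
    P[(M t ⁻¹' B).indicator (fun _ => (1 : ℝ)) |
        ⨆ s : {s : ℤ // s ≤ t - 1}, MeasurableSpace.comap (M s) inferInstance]
      =ᵐ[P] fun ω => (tailTransition μ (M (t - 1) ω)).real B
  backward_transition : ∀ t : ℤ, 1 ≤ t → ∀ B : Set ℝ, MeasurableSet B →
    P[(M (-t) ⁻¹' B).indicator (fun _ => (1 : ℝ)) |
        ⨆ s : {s : ℤ // -t + 1 ≤ s}, MeasurableSpace.comap (M s) inferInstance]
      =ᵐ[P] fun ω =>
        (tailTransition (P.map (fun ω => (M 0 ω, M (-1) ω))) (M (-t + 1) ω)).real B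

/-- The space `[-∞, ∞]^d \ {0}`, with the subspace topology of the product topology. -/
abbrev PuncturedCube (d : ℕ) : Type := {x : Fin d → EReal // x ≠ 0}

/-- The set function `B ↦ P[x⁻¹ ξ ∈ B]` on Borel subsets `B` of `[-∞, ∞]^d \ {0}`. -/
noncomputable def scaledLaw {Ω : Type*} [MeasurableSpace Ω] (P : Measure Ω) {d : ℕ}
    (ξ : Fin d → Ω → ℝ) (x : ℝ) : Measure (PuncturedCube d) :=
  (P.map (fun ω j => ((x⁻¹ * ξ j ω : ℝ) : EReal))).comap Subtype.val

/-- Vague convergence: convergence of the integrals of continuous functions with compact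
support. -/
def TendstoVaguely {ι E : Type*} [TopologicalSpace E] [MeasurableSpace E]
    (m : ι → Measure E) (l : Filter ι) (μ : Measure E) : Prop :=
  ∀ f : C_c(E, ℝ), Tendsto (fun i => ∫ y, f y ∂(m i)) l (𝓝 (∫ y, f y ∂μ))

/-- `V` is positive near infinity, measurable, and regularly varying of index `τ`. -/
structure IsRegVaryingFun (V : ℝ → ℝ) (τ : ℝ) : Prop where
  measurable : Measurable V
  pos : ∀ᶠ x in atTop, 0 < V x
  tendsto : ∀ y : ℝ, 0 < y → Tendsto (fun x => V (x * y) / V x) atTop (𝓝 (y ^ τ))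

/-- The law of the random vector `ξ` is multivariate regularly varying. A measure on
`[-∞, ∞]^d \ {0}` (locally compact, second countable, Hausdorff) is Radon if and only if it is
finite on compact sets. -/
def IsMultivariateRegVarying {Ω : Type*} [MeasurableSpace Ω] (P : Measure Ω) {d : ℕ}
    (ξ : Fin d → Ω → ℝ) : Prop :=
  ∃ (α : ℝ) (V : ℝ → ℝ) (μ : Measure (PuncturedCube d)),
    0 < α ∧ IsRegVaryingFun V (-α) ∧ IsFiniteMeasureOnCompacts μ ∧ μ ≠ 0 ∧
    TendstoVaguely (fun x : ℝ => ENNReal.ofReal (V x)⁻¹ • scaledLaw P ξ x) atTop μ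

/-- The measure `d(-z^{-α}) = α z^{-α-1} dz` on `(0, ∞)`. -/
noncomputable def powMeasure (α : ℝ) : Measure ℝ :=
  (volume.restrict (Ioi (0 : ℝ))).withDensity (fun z => ENNReal.ofReal (α * z ^ (-α - 1)))

/-- `F_{t,i} = {x : x_0 = … = x_{i-1} = 0, x_i ≠ 0}`. -/
def firstNonzeroAt (t : ℕ) (i : Fin (t + 1)) : Set (PuncturedCube (t + 1)) :=
  {x | (∀ j, j < i → x.1 j = 0) ∧ x.1 i ≠ 0}

/-- `G_{t,i} = {x : x_i ≠ 0, x_{i+1} = … = x_t = 0}`. -/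
def lastNonzeroAt (t : ℕ) (i : Fin (t + 1)) : Set (PuncturedCube (t + 1)) :=
  {x | x.1 i ≠ 0 ∧ ∀ j, i < j → x.1 j = 0}

/-- The vector `(0, …, 0, z m_0, …, z m_{t-i})`, with `i` leading zeros. -/
noncomputable def forwardVec (t : ℕ) (i : Fin (t + 1)) (m : ℤ → ℝ) (z : ℝ) :
    Fin (t + 1) → EReal :=
  fun j => if j < i then 0 else ((z * m ((j : ℤ) - (i : ℤ)) : ℝ) : EReal)

/-- The vector `(z m_{-i}, …, z m_0, 0, …, 0)`, with `t - i` trailing zeros. -/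
noncomputable def backwardVec (t : ℕ) (i : Fin (t + 1)) (m : ℤ → ℝ) (z : ℝ) :
    Fin (t + 1) → EReal :=
  fun j => if i < j then 0 else ((z * m ((j : ℤ) - (i : ℤ)) : ℝ) : EReal)

/-- The formulas for the integrals of `f` over the sets `F_{t,i}`, `i = 0, …, t`. -/
def HasForwardFormulas {Ω : Type*} [MeasurableSpace Ω] (P : Measure Ω) (α : ℝ)
    (M : ℤ → Ω → ℝ) (t : ℕ) (μ : Measure (PuncturedCube (t + 1))) : Prop :=
  ∀ f : (Fin (t + 1) → EReal) → ℝ≥0∞, Measurable f →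
    (∫⁻ x in firstNonzeroAt t 0, f x.1 ∂μ =
      ∫⁻ z, ∫⁻ ω, f (forwardVec t 0 (fun k => M k ω) z) ∂P ∂(powMeasure α)) ∧
    ∀ i : Fin (t + 1), 0 < i →
      ∫⁻ x in firstNonzeroAt t i, f x.1 ∂μ =
        ∫⁻ z, ∫⁻ ω in {ω | M (-1) ω = 0}, f (forwardVec t i (fun k => M k ω) z) ∂P
          ∂(powMeasure α)

/-- The formulas for the integrals of `f` over the sets `G_{t,i}`, `i = 0, …, t`. -/
def HasBackwardFormulas {Ω : Type*} [MeasurableSpace Ω] (P : Measure Ω) (α : ℝ)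
    (M : ℤ → Ω → ℝ) (t : ℕ) (μ : Measure (PuncturedCube (t + 1))) : Prop :=
  ∀ f : (Fin (t + 1) → EReal) → ℝ≥0∞, Measurable f →
    (∫⁻ x in lastNonzeroAt t (Fin.last t), f x.1 ∂μ =
      ∫⁻ z, ∫⁻ ω, f (backwardVec t (Fin.last t) (fun k => M k ω) z) ∂P ∂(powMeasure α)) ∧
    ∀ i : Fin (t + 1), i < Fin.last t →
      ∫⁻ x in lastNonzeroAt t i, f x.1 ∂μ =
        ∫⁻ z, ∫⁻ ω in {ω | M 1 ω = 0}, f (backwardVec t i (fun k => M k ω) z) ∂P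
          ∂(powMeasure α)

/-! Far from the origin the recursion is asymptotically multiplicative. If `X 0 = x * z` with `z ≠
0` of a sign that has positive weight, the rescaled path `x⁻¹ * X j` converges almost surely to the
recursion `y ↦ y * φ(ε, sign y)` started at `z`; linear growth of `Ψ` is needed only where this
recursion can reach `0`. Regular variation says that `x⁻¹ * X 0`, normalised by the tail, converges
to `l = tailMeasure α p`. Together these give convergence on functions that vanish when the initial
coordinate is small (`IsStationaryRecursion.tendsto_integral_vec`). Writing `X 0` as a quantile
function of a Lebesgue variable reduces this to dominated convergence (`tendsto_integral_tail`).

Stationarity deals with a small initial coordinate. Write `f(v) = [f(v) - f(0, v₁, …)] + f(0, v₁,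
…)`. The bracket is uniformly small for small `v₀`, so a cutoff reduces it to the previous case
(`tendsto_integral_sub`). The expectation of the last term is that of a function of one variable
fewer, evaluated at the stationary chain from time `0`, so induction applies
(`tendsto_integral_chain`).

The limit must satisfy the same recursion and have both descriptions. Let `κ`, `κ'` be the
homogeneous kernels of `μ` and its adjoint `μ'`. The adjoint relation compares masses of corners `{1
< a u, 1 < b x}`; such corners determine a measure off the axes, so `l(du) κ(u, dx)` and `l(dx)
κ'(x, du)` agree there. Adding to each side the mass that the other kernel sends to `0` gives an
identity on the whole plane, `AreDualKernels`. From this identity alone follow the invariance of the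
limit functional `tailInt` under dropping the first coordinate (`tailInt_stationary`) and its
symmetry under time reversal with `κ` and `κ'` exchanged (`tailInt_rev`), which is the equivalence
of the forward and backward formulas.

For existence, `μ ∈ M_{p,α}` follows by letting `x → ∞` in `P(|X 0| > δ x, τ X 1 > x) ≤ P(τ X 1 > x)
= P(τ X 0 > x)` and then `δ → 0`. The moment inequality also shows that the limit recursion never
enters a sign of weight zero, so the one-step convergence can be iterated. The adjoint is explicit:
reweight `μ` by `|M|^α`, send `(I, M)` to `(sign M, I / |M|)`, and put the missing mass at `(±1,
0)`. A tail chain is then driven in both directions from time `0` by independent noise. -/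

/-! ### Path functionals of a Markov kernel on the line -/

/-- The expectation of `f (x, ξ₁, …, ξₙ)`, where `ξ` is the Markov chain with transition kernel `κ`
started at `x`. -/
noncomputable def pathInt (κ : Kernel ℝ ℝ) :
    (n : ℕ) → ((Fin (n + 1) → ℝ) → ℝ≥0∞) → ℝ → ℝ≥0∞
  | 0, f, x => f (fun _ => x)
  | n + 1, f, x => ∫⁻ y, pathInt κ n (fun v => f (Fin.cons x v)) y ∂(κ x)

theorem measurable_finCons {n : ℕ} :
    Measurable (fun q : ℝ × (Fin n → ℝ) => (Fin.cons q.1 q.2 : Fin (n + 1) → ℝ)) := by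
  refine measurable_pi_iff.2 fun i => ?_
  refine Fin.cases ?_ (fun j => ?_) i
  · simpa using measurable_fst
  · simp only [Fin.cons_succ]
    exact (measurable_pi_apply j).comp measurable_snd

theorem measurable_finSnoc {n : ℕ} :
    Measurable (fun q : (Fin n → ℝ) × ℝ => (Fin.snoc q.1 q.2 : Fin (n + 1) → ℝ)) := by
  refine measurable_pi_iff.2 fun i => ?_
  refine Fin.lastCases ?_ (fun j => ?_) i
  · simpa using measurable_snd
  · simp only [Fin.snoc_castSucc]
    exact (measurable_pi_apply j).comp measurable_fst

section PathInt

variable {κ : Kernel ℝ ℝ}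

theorem pathInt_congr (n : ℕ) {f g : (Fin (n + 1) → ℝ) → ℝ≥0∞} {x : ℝ}
    (h : ∀ v, v 0 = x → f v = g v) : pathInt κ n f x = pathInt κ n g x := by
  cases n with
  | zero => exact h _ rfl
  | succ n =>
    have : (fun v => f (Fin.cons x v)) = fun v => g (Fin.cons x v) := by
      funext v; exact h _ (by simp)
    simp only [pathInt, this]

/-- Chapman–Kolmogorov: the recursion defining `pathInt` peels off the first step, and the same
integral can be built by peeling off the last one. Both forms are needed, since paths get extended
at either end. -/
theorem pathInt_snoc (n : ℕ) (f : (Fin (n + 2) → ℝ) → ℝ≥0∞) (x : ℝ) :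
    pathInt κ (n + 1) f x =
      pathInt κ n (fun v => ∫⁻ y, f (Fin.snoc v y) ∂(κ (v (Fin.last n)))) x := by
  induction n generalizing x with
  | zero =>
    simp only [pathInt]
    refine lintegral_congr fun y => ?_
    congr 1
    funext i; fin_cases i <;> rfl
  | succ n ih =>
    rw [pathInt, lintegral_congr fun y => ih _ y, pathInt]
    refine lintegral_congr fun y => ?_
    congr 1
    funext v
    have : (Fin.cons x v : Fin (n + 2) → ℝ) (Fin.last (n + 1)) = v (Fin.last n) := by
      rw [← Fin.succ_last, Fin.cons_succ]
    rw [this]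
    refine lintegral_congr fun z => ?_
    rw [Fin.cons_snoc_eq_snoc_cons]

variable [IsMarkovKernel κ]

theorem measurable_pathInt_uncurry {A : Type*} [MeasurableSpace A] (n : ℕ)
    {f : A → (Fin (n + 1) → ℝ) → ℝ≥0∞} (hf : Measurable (Function.uncurry f)) :
    Measurable (fun q : A × ℝ => pathInt κ n (f q.1) q.2) := by
  induction n generalizing A with
  | zero =>
    exact hf.comp (measurable_fst.prodMk (measurable_pi_iff.2 fun _ => measurable_snd))
  | succ n ih =>
    have h1 : Measurable (fun r : (A × ℝ) × ℝ =>
        pathInt κ n (fun v => f r.1.1 (Fin.cons r.1.2 v)) r.2) := by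
      refine ih (A := A × ℝ) (f := fun a v => f a.1 (Fin.cons a.2 v)) ?_
      refine hf.comp ((measurable_fst.comp measurable_fst).prodMk ?_)
      exact measurable_finCons.comp
        ((measurable_snd.comp measurable_fst).prodMk measurable_snd)
    have h2 := Measurable.lintegral_kernel_prod_right'
      (κ := κ.comap (Prod.snd : A × ℝ → ℝ) measurable_snd) h1
    simpa only [pathInt, Kernel.comap_apply] using h2

theorem measurable_pathInt (n : ℕ) {f : (Fin (n + 1) → ℝ) → ℝ≥0∞} (hf : Measurable f) :
    Measurable (pathInt κ n f) :=
  (measurable_pathInt_uncurry (A := Unit) (f := fun _ => f) n (hf.comp measurable_snd)).comp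
    (measurable_const.prodMk measurable_id : Measurable fun x : ℝ => ((), x))

theorem pathInt_const (n : ℕ) (c : ℝ≥0∞) (x : ℝ) : pathInt κ n (fun _ => c) x = c := by
  induction n generalizing x with
  | zero => rfl
  | succ n ih => simp [pathInt, ih]

theorem pathInt_zero (h0 : κ 0 = Measure.dirac 0) (n : ℕ) {f : (Fin (n + 1) → ℝ) → ℝ≥0∞}
    (hf : Measurable f) : pathInt κ n f 0 = f 0 := by
  induction n with
  | zero => rfl
  | succ n ih =>
    have hm : Measurable fun v => f (Fin.cons 0 v) :=
      hf.comp (measurable_finCons.comp (measurable_const.prodMk measurable_id))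
    rw [pathInt, h0, lintegral_dirac' _ (measurable_pathInt n hm), ih hm]
    congr 1
    funext i; refine Fin.cases ?_ (fun j => ?_) i <;> simp

theorem pathInt_lintegral {B : Type*} [MeasurableSpace B] (m : Measure B) [SFinite m] (n : ℕ)
    {f : B → (Fin (n + 1) → ℝ) → ℝ≥0∞} (hf : Measurable (Function.uncurry f)) (x : ℝ) :
    pathInt κ n (fun v => ∫⁻ u, f u v ∂m) x = ∫⁻ u, pathInt κ n (f u) x ∂m := by
  induction n generalizing x with
  | zero => rfl
  | succ n ih =>
    have hm : Measurable (Function.uncurry fun (u : B) (v : Fin (n + 1) → ℝ) =>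
        f u (Fin.cons x v)) :=
      hf.comp (measurable_fst.prodMk (measurable_finCons.comp
        (measurable_const.prodMk measurable_snd)))
    simp only [pathInt]
    rw [lintegral_congr fun y => ih hm y, lintegral_lintegral_swap]
    exact ((measurable_pathInt_uncurry n hm).comp measurable_swap).aemeasurable

/-- The functional `f ↦ ∑ᵢ ∫ E[f(0, …, 0, ξ₀, …, ξ_{n-i})]`, with `i` zeros, where `ξ₀` has law `l₀`
for `i = 0` and `l₁` for `i ≥ 1`. -/
noncomputable def tailInt (κ : Kernel ℝ ℝ) (l₁ : Measure ℝ) :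
    Measure ℝ → (n : ℕ) → ((Fin (n + 1) → ℝ) → ℝ≥0∞) → ℝ≥0∞
  | l₀, 0, f => ∫⁻ x, pathInt κ 0 f x ∂l₀
  | l₀, n + 1, f => ∫⁻ x, pathInt κ (n + 1) f x ∂l₀ +
      tailInt κ l₁ l₁ n (fun v => f (Fin.cons 0 v))

theorem measurable_lintegral_snoc (n : ℕ) {f : (Fin (n + 2) → ℝ) → ℝ≥0∞} (hf : Measurable f) :
    Measurable fun v : Fin (n + 1) → ℝ => ∫⁻ y, f (Fin.snoc v y) ∂(κ (v (Fin.last n))) :=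
  Measurable.lintegral_kernel_prod_right'
    (κ := κ.comap (fun v : Fin (n + 1) → ℝ => v (Fin.last n)) (measurable_pi_apply _))
    (f := fun q => f (Fin.snoc q.1 q.2)) (hf.comp measurable_finSnoc)

theorem measurable_lintegral_cons (n : ℕ) {f : (Fin (n + 2) → ℝ) → ℝ≥0∞} (hf : Measurable f) :
    Measurable fun v : Fin (n + 1) → ℝ => ∫⁻ y, f (Fin.cons y v) ∂(κ (v 0)) :=
  Measurable.lintegral_kernel_prod_right'
    (κ := κ.comap (fun v : Fin (n + 1) → ℝ => v 0) (measurable_pi_apply _))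
    (f := fun q => f (Fin.cons q.2 q.1)) (hf.comp (measurable_finCons.comp measurable_swap))

/-- A coordinate appended at the end is either one more transition of a path already started, or the
starting point itself, preceded by zeros only; the latter is the term in `l₁`. -/
theorem tailInt_snoc (l₀ l₁ : Measure ℝ) (n : ℕ) (f : (Fin (n + 2) → ℝ) → ℝ≥0∞) :
    tailInt κ l₁ l₀ (n + 1) f =
      tailInt κ l₁ l₀ n (fun v => ∫⁻ y, f (Fin.snoc v y) ∂(κ (v (Fin.last n)))) +
        ∫⁻ u, f (Fin.snoc 0 u) ∂l₁ := by
  induction n generalizing l₀ with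
  | zero =>
    simp only [tailInt]
    rw [lintegral_congr fun x => pathInt_snoc 0 f x]
    congr 1
    simp only [pathInt]
    refine lintegral_congr fun y => ?_
    congr 1
    funext i; fin_cases i <;> rfl
  | succ n ih =>
    rw [tailInt, ih, lintegral_congr fun x => pathInt_snoc (n + 1) f x, tailInt, add_assoc (G := ℝ≥0∞)]
    congr 2
    · congr 1
      funext v
      have : (Fin.cons 0 v : Fin (n + 2) → ℝ) (Fin.last (n + 1)) = v (Fin.last n) := by
        rw [← Fin.succ_last, Fin.cons_succ]
      rw [this]
      refine lintegral_congr fun z => ?_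
      rw [Fin.cons_snoc_eq_snoc_cons]
    · refine lintegral_congr fun u => ?_
      rw [Fin.cons_snoc_eq_snoc_cons]
      congr 2
      funext i; refine Fin.cases ?_ (fun j => ?_) i <;> simp

/-- The two kernels are dual with respect to `l`, up to the mass that they send to `0`. -/
def AreDualKernels (κ κ' : Kernel ℝ ℝ) (l l₁ l₁' : Measure ℝ) : Prop :=
  ∀ h : ℝ × ℝ → ℝ≥0∞, Measurable h →
    ∫⁻ x, ∫⁻ u, h (u, x) ∂(κ' x) ∂l + ∫⁻ u, h (u, 0) ∂l₁' =
      ∫⁻ u, ∫⁻ x, h (u, x) ∂(κ u) ∂l + ∫⁻ x, h (0, x) ∂l₁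

variable {κ' : Kernel ℝ ℝ} [IsMarkovKernel κ'] {l l₁ l₁' : Measure ℝ}

/-- Mirror image of `tailInt_snoc`: a coordinate put in front is a backward transition under `κ'`.
Duality is applied to the first two coordinates, the rest of the path being integrated out. -/
theorem tailInt_cons (h0 : κ 0 = Measure.dirac 0) (h0' : κ' 0 = Measure.dirac 0)
    (hd : AreDualKernels κ κ' l l₁ l₁') (n : ℕ) {f : (Fin (n + 2) → ℝ) → ℝ≥0∞}
    (hf : Measurable f) :
    tailInt κ l₁ l (n + 1) f =
      tailInt κ l₁ l n (fun v => ∫⁻ y, f (Fin.cons y v) ∂(κ' (v 0))) +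
        ∫⁻ u, f (Fin.cons u 0) ∂l₁' := by
  -- Test function for the duality: first coordinate `u`, then the `κ`-path started at the second
  -- coordinate `x`.
  set h : ℝ × ℝ → ℝ≥0∞ := fun q => pathInt κ n (fun v => f (Fin.cons q.1 v)) q.2 with hh
  have hfc : Measurable (Function.uncurry fun (u : ℝ) (v : Fin (n + 1) → ℝ) =>
      f (Fin.cons u v)) := hf.comp measurable_finCons
  have hmh : Measurable h := measurable_pathInt_uncurry n hfc
  have hfu : ∀ u : ℝ, Measurable fun v : Fin (n + 1) → ℝ => f (Fin.cons u v) := fun u =>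
    hfc.comp (measurable_const.prodMk measurable_id)
  have key := hd h hmh
  have e1 : ∫⁻ u, h (u, 0) ∂l₁' = ∫⁻ u, f (Fin.cons u 0) ∂l₁' :=
    lintegral_congr fun u => pathInt_zero h0 n (hfu u)
  have e2 : ∀ x, pathInt κ n (fun v => ∫⁻ y, f (Fin.cons y v) ∂(κ' (v 0))) x =
      ∫⁻ u, h (u, x) ∂(κ' x) := by
    intro x
    rw [hh]
    rw [← pathInt_lintegral (κ' x) n hfc x]
    exact pathInt_congr n fun v hv => by rw [hv]
  have e3 : ∫⁻ x, pathInt κ (n + 1) f x ∂l = ∫⁻ u, ∫⁻ x, h (u, x) ∂(κ u) ∂l := rfl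
  rw [e1, ← e3] at key
  cases n with
  | zero =>
    simp only [tailInt] at key ⊢
    rw [lintegral_congr e2]
    exact key.symm
  | succ m =>
    -- When the old first coordinate is `0`, the backward step stays at `0`, so these summands are
    -- the ones with two leading zeros.
    have e4 : tailInt κ l₁ l₁ m (fun v => ∫⁻ y, f (Fin.cons y (Fin.cons 0 v))
        ∂(κ' ((Fin.cons 0 v : Fin (m + 2) → ℝ) 0))) =
        tailInt κ l₁ l₁ m (fun v => f (Fin.cons 0 (Fin.cons 0 v))) := by
      congr 1
      funext v
      rw [Fin.cons_zero, h0', lintegral_dirac']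
      exact hfc.comp (measurable_id.prodMk measurable_const)
    rw [tailInt, tailInt, tailInt, e4, lintegral_congr e2, add_right_comm (G := ℝ≥0∞), key, add_assoc (G := ℝ≥0∞)]

/-- Stationarity of the limit: duality with a test function of the second coordinate only. The
condition `g 0 = 0` removes the possibly infinite mass sent to the zero path. -/
theorem tailInt_stationary (h0 : κ 0 = Measure.dirac 0)
    (hd : AreDualKernels κ κ' l l₁ l₁') (n : ℕ) {g : (Fin (n + 1) → ℝ) → ℝ≥0∞}
    (hg : Measurable g) (hg0 : g 0 = 0) :
    tailInt κ l₁ l n g =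
      ∫⁻ x, pathInt κ (n + 1) (fun v => g (Fin.tail v)) x ∂l + tailInt κ l₁ l₁ n g := by
  have hm := measurable_pathInt (κ := κ) n hg
  have key := hd (fun q => pathInt κ n g q.2) (hm.comp measurable_snd)
  simp only [lintegral_const, measure_univ, mul_one, pathInt_zero h0 n hg, hg0, zero_mul,
    add_zero] at key
  have e : ∫⁻ x, pathInt κ (n + 1) (fun v => g (Fin.tail v)) x ∂l =
      ∫⁻ u, ∫⁻ x, pathInt κ n g x ∂(κ u) ∂l := by
    simp only [pathInt, Fin.tail_cons]
  rw [e]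
  cases n with
  | zero => exact key
  | succ m =>
    rw [tailInt, tailInt, key, add_assoc]

/-- The forward and the backward description of the functional agree. -/
theorem tailInt_rev (h0 : κ 0 = Measure.dirac 0) (h0' : κ' 0 = Measure.dirac 0)
    (hd : AreDualKernels κ κ' l l₁ l₁') (n : ℕ) {f : (Fin (n + 1) → ℝ) → ℝ≥0∞}
    (hf : Measurable f) :
    tailInt κ l₁ l n f = tailInt κ' l₁' l n (fun v => f (v ∘ Fin.rev)) := by
  induction n with
  | zero => rfl
  | succ n ih =>
    -- Prepending for `κ` and appending for `κ'` are the same recursion once the vector is reversed.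
    rw [tailInt_cons h0 h0' hd n hf, tailInt_snoc, ih (measurable_lintegral_cons n hf)]
    congr 1
    · congr 1
      funext v
      have : (v ∘ Fin.rev) 0 = v (Fin.last n) := by simp
      rw [this]
      refine lintegral_congr fun y => ?_
      congr 1
      funext i
      refine Fin.cases ?_ (fun j => ?_) i
      · simp
      · simp [Fin.rev_succ]
    · refine lintegral_congr fun u => ?_
      congr 1
      funext i
      refine Fin.cases ?_ (fun j => ?_) i
      · simp
      · simp [Fin.rev_succ]

end PathInt

/-! ### Homogeneous kernels on the line -/

/-- The law of `x * ξ`, where `ξ` has law `N (sign x)`. -/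
noncomputable def signKernel (N : ℝ → Measure ℝ) [∀ σ, IsProbabilityMeasure (N σ)] :
    Kernel ℝ ℝ where
  toFun x := (N (Real.sign x)).map (fun e => x * e)
  measurable' := by
    refine Measure.measurable_of_measurable_coe _ fun B hB => ?_
    have hg : ∀ σ, Measurable fun x : ℝ => (N σ) ((fun e => x * e) ⁻¹' B) := fun σ =>
      measurable_measure_prodMk_left (ν := N σ)
        (s := {q : ℝ × ℝ | q.1 * q.2 ∈ B}) ((measurable_fst.mul measurable_snd) hB)
    have : (fun x : ℝ => ((N (Real.sign x)).map (fun e => x * e)) B) = fun x =>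
        if x < 0 then (N (-1)) ((fun e => x * e) ⁻¹' B)
        else if 0 < x then (N 1) ((fun e => x * e) ⁻¹' B)
        else (N 0) ((fun e => x * e) ⁻¹' B) := by
      funext x
      rw [Measure.map_apply (measurable_const_mul x) hB, Real.sign]
      split_ifs <;> rfl
    rw [this]
    exact Measurable.ite measurableSet_Iio (hg _) (Measurable.ite measurableSet_Ioi (hg _) (hg _))

section SignKernel

variable (N : ℝ → Measure ℝ) [∀ σ, IsProbabilityMeasure (N σ)]

theorem signKernel_apply (x : ℝ) :
    signKernel N x = (N (Real.sign x)).map (fun e => x * e) := rfl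

instance : IsMarkovKernel (signKernel N) :=
  ⟨fun x => by
    rw [signKernel_apply]
    exact Measure.isProbabilityMeasure_map (measurable_const_mul x).aemeasurable⟩

theorem lintegral_signKernel {f : ℝ → ℝ≥0∞} (hf : Measurable f) (x : ℝ) :
    ∫⁻ y, f y ∂(signKernel N x) = ∫⁻ e, f (x * e) ∂(N (Real.sign x)) := by
  rw [signKernel_apply, lintegral_map hf (measurable_const_mul x)]

theorem signKernel_zero : signKernel N 0 = Measure.dirac 0 := by
  rw [signKernel_apply]; simp

theorem Real.sign_mul_of_pos {z : ℝ} (hz : 0 < z) (x : ℝ) : Real.sign (z * x) = Real.sign x := by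
  rcases lt_trichotomy x 0 with h | h | h
  · rw [Real.sign_of_neg h, Real.sign_of_neg (mul_neg_of_pos_of_neg hz h)]
  · simp [h]
  · rw [Real.sign_of_pos h, Real.sign_of_pos (mul_pos hz h)]

theorem lintegral_signKernel_mul {f : ℝ → ℝ≥0∞} (hf : Measurable f) {z : ℝ} (hz : 0 < z) (x : ℝ) :
    ∫⁻ y, f y ∂(signKernel N (z * x)) = ∫⁻ y, f (z * y) ∂(signKernel N x) := by
  have hf' : Measurable fun y => f (z * y) := hf.comp (measurable_const_mul z)
  rw [lintegral_signKernel N hf, lintegral_signKernel N hf', Real.sign_mul_of_pos hz]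
  simp only [mul_assoc]

theorem pathInt_signKernel_mul {z : ℝ} (hz : 0 < z) (n : ℕ) {f : (Fin (n + 1) → ℝ) → ℝ≥0∞}
    (hf : Measurable f) (x : ℝ) :
    pathInt (signKernel N) n f (z * x) =
      pathInt (signKernel N) n (fun v => f (fun i => z * v i)) x := by
  induction n generalizing x with
  | zero => rfl
  | succ n ih =>
    have hm : Measurable (fun v : Fin (n + 1) → ℝ => f (Fin.cons (z * x) v)) :=
      hf.comp (measurable_finCons.comp (measurable_const.prodMk measurable_id))
    rw [pathInt, pathInt, lintegral_signKernel_mul N (measurable_pathInt n hm) hz]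
    refine lintegral_congr fun y => ?_
    rw [ih hm]
    congr 1
    funext v
    congr 1
    funext i
    refine Fin.cases ?_ (fun j => ?_) i <;> simp

end SignKernel

/-! ### The power measure and the tail measure -/

theorem powMeasure_Iic (α : ℝ) : powMeasure α (Iic 0) = 0 := by
  rw [powMeasure, withDensity_apply _ measurableSet_Iic, Measure.restrict_restrict measurableSet_Iic]
  simp [Iic_inter_Ioi]

theorem ae_powMeasure_pos (α : ℝ) : ∀ᵐ z ∂(powMeasure α), 0 < z := by
  rw [ae_iff]
  simpa [Iic_def] using powMeasure_Iic α

theorem powMeasure_Ioi {α a : ℝ} (hα : 0 < α) (ha : 0 < a) :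
    powMeasure α (Ioi a) = ENNReal.ofReal (a ^ (-α)) := by
  rw [powMeasure, withDensity_apply _ measurableSet_Ioi, Measure.restrict_restrict measurableSet_Ioi,
    inter_eq_left.2 (Ioi_subset_Ioi ha.le), ← ofReal_integral_eq_lintegral_ofReal]
  · rw [integral_const_mul, integral_Ioi_rpow_of_lt (by linarith) ha]
    congr 1
    rw [sub_add_cancel]
    field_simp
  · exact (integrableOn_Ioi_rpow_of_lt (by linarith) ha).const_mul α
  · refine (ae_restrict_mem measurableSet_Ioi).mono fun z hz => ?_
    have : 0 < z := ha.trans hz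
    positivity

instance (α : ℝ) : SFinite (powMeasure α) := by unfold powMeasure; infer_instance

/-- This explains the minima in the adjoint relation: `E[(xI)_+^α ∧ (yM)_+^α]` is the mass that the
law of `z * (I, M)`, with `z` distributed according to `powMeasure`, gives to a corner. -/
theorem powMeasure_corner {α : ℝ} (hα : 0 < α) (c d : ℝ) :
    powMeasure α {z | 1 < c * z ∧ 1 < d * z} = min (posPow α c) (posPow α d) := by
  have hpos : ∀ u : ℝ, u ≤ 0 → posPow α u = 0 := fun u hu => by
    rw [posPow, max_eq_right hu, Real.zero_rpow hα.ne', ENNReal.ofReal_zero]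
  have hneg : ∀ u : ℝ, u ≤ 0 → powMeasure α {z | 1 < u * z} = 0 := fun u hu => by
    refine measure_mono_null (fun z hz => ?_) (powMeasure_Iic α)
    by_contra hz'
    have : 0 < z := not_le.1 hz'
    have : u * z ≤ 0 := mul_nonpos_of_nonpos_of_nonneg hu this.le
    have hz1 : 1 < u * z := hz
    linarith
  rcases le_or_gt c 0 with hc | hc
  · rw [hpos c hc, zero_min]
    exact measure_mono_null (fun z hz => hz.1) (hneg c hc)
  rcases le_or_gt d 0 with hd | hd
  · rw [hpos d hd, min_zero]
    exact measure_mono_null (fun z hz => hz.2) (hneg d hd)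
  have hm : 0 < min c d := lt_min hc hd
  have : {z | 1 < c * z ∧ 1 < d * z} = Ioi (min c d)⁻¹ := by
    ext z
    simp only [mem_ofPred_eq, mem_Ioi]
    rw [inv_lt_iff_one_lt_mul₀ hm]
    constructor
    · intro h
      rcases min_choice c d with h' | h' <;> rw [h', mul_comm] <;> tauto
    · intro h
      have hz : 0 < z := by
        by_contra hz
        have : z * min c d ≤ 0 := mul_nonpos_of_nonpos_of_nonneg (not_lt.1 hz) hm.le
        linarith
      rw [mul_comm] at h
      exact ⟨h.trans_le (by gcongr; exact min_le_left _ _),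
        h.trans_le (by gcongr; exact min_le_right _ _)⟩
  rw [this, powMeasure_Ioi hα (inv_pos.2 hm), posPow, posPow, max_eq_left hc.le, max_eq_left hd.le,
    Real.inv_rpow hm.le, Real.rpow_neg hm.le, inv_inv]
  rcases le_total c d with h | h
  · rw [min_eq_left h, min_eq_left (ENNReal.ofReal_le_ofReal (by gcongr))]
  · rw [min_eq_right h, min_eq_right (ENNReal.ofReal_le_ofReal (by gcongr))]

/-- The measure `p d(-z^{-α})` on `(0, ∞)` plus the image of `(1 - p) d(-z^{-α})` on `(-∞, 0)`. -/
noncomputable def tailMeasure (α p : ℝ) : Measure ℝ :=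
  ENNReal.ofReal p • powMeasure α + ENNReal.ofReal (1 - p) • (powMeasure α).map Neg.neg

instance (α p : ℝ) : SFinite (tailMeasure α p) := by unfold tailMeasure; infer_instance

theorem lintegral_tailMeasure (α p : ℝ) {f : ℝ → ℝ≥0∞} (hf : Measurable f) :
    ∫⁻ x, f x ∂(tailMeasure α p) = ENNReal.ofReal p * ∫⁻ z, f z ∂(powMeasure α) +
      ENNReal.ofReal (1 - p) * ∫⁻ z, f (-z) ∂(powMeasure α) := by
  rw [tailMeasure, lintegral_add_measure, lintegral_smul_measure, lintegral_smul_measure,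
    lintegral_map hf measurable_neg]
  rfl

/-! ### The kernel associated with a tail pair law -/

theorem measurable_snd_div_fst : Measurable fun q : ℝ × ℝ => q.2 / q.1 :=
  measurable_snd.div measurable_fst

/-- The law of `M / I` given `I = σ` (or the unit mass at `0` if `I = σ` has probability `0`), where
`(I, M)` has law `μ`. -/
noncomputable def tailNoise (μ : Measure (ℝ × ℝ)) (σ : ℝ) : Measure ℝ :=
  open Classical in
  if μ {q | q.1 = σ} = 0 then Measure.dirac 0
  else (ProbabilityTheory.cond μ {q | q.1 = σ}).map (fun q => q.2 / q.1)

instance (μ : Measure (ℝ × ℝ)) [IsFiniteMeasure μ] (σ : ℝ) :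
    IsProbabilityMeasure (tailNoise μ σ) := by
  unfold tailNoise
  split_ifs with h
  · infer_instance
  · have := cond_isProbabilityMeasure (μ := μ) h
    exact Measure.isProbabilityMeasure_map measurable_snd_div_fst.aemeasurable

/-- The kernel `x ↦ tailTransition μ x`, made into a Markov kernel. -/
noncomputable def tailKernel (μ : Measure (ℝ × ℝ)) [IsFiniteMeasure μ] : Kernel ℝ ℝ :=
  signKernel (tailNoise μ)

instance (μ : Measure (ℝ × ℝ)) [IsFiniteMeasure μ] : IsMarkovKernel (tailKernel μ) := by
  unfold tailKernel; infer_instance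

theorem measurableSet_fst_eq (σ : ℝ) : MeasurableSet {q : ℝ × ℝ | q.1 = σ} :=
  measurable_fst (measurableSet_singleton σ)

theorem tailKernel_zero (μ : Measure (ℝ × ℝ)) [IsFiniteMeasure μ] :
    tailKernel μ 0 = Measure.dirac 0 := signKernel_zero _

/-- The two can differ only at states whose sign has no mass under `μ`: conditioning on a null event
yields the zero measure, while `tailKernel` uses the default noise `δ₀` to remain Markov. -/
theorem tailTransition_eq (μ : Measure (ℝ × ℝ)) [IsFiniteMeasure μ] {x : ℝ}
    (hx : x = 0 ∨ μ {q | q.1 = Real.sign x} ≠ 0) : tailTransition μ x = tailKernel μ x := by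
  by_cases h : x = 0
  · simp [tailTransition, h, tailKernel_zero]
  · have hx' := hx.resolve_left h
    rw [tailTransition, if_neg h, tailKernel, signKernel_apply, tailNoise, if_neg hx',
      Measure.map_map (measurable_const_mul x) measurable_snd_div_fst]
    rfl

theorem tailTransition_eq_zero (μ : Measure (ℝ × ℝ)) {x : ℝ}
    (hx : x ≠ 0) (h : μ {q | q.1 = Real.sign x} = 0) : tailTransition μ x = 0 := by
  rw [tailTransition, if_neg hx, cond_eq_zero_of_meas_eq_zero h, Measure.map_zero]

/-- Disintegration of `μ` along its first coordinate. The default in `tailNoise` is harmless because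
it occurs only with the factor `0`. -/
theorem setLIntegral_fst_eq (μ : Measure (ℝ × ℝ)) [IsFiniteMeasure μ] {σ : ℝ}
    (hσ : σ ≠ 0) {F : ℝ × ℝ → ℝ≥0∞} (hF : Measurable F) :
    ∫⁻ q in {q | q.1 = σ}, F q ∂μ =
      μ {q | q.1 = σ} * ∫⁻ e, F (σ, σ * e) ∂(tailNoise μ σ) := by
  by_cases h : μ {q | q.1 = σ} = 0
  · rw [h, zero_mul, Measure.restrict_eq_zero.2 h, lintegral_zero_measure]
  · have hF' : Measurable fun e : ℝ => F (σ, σ * e) :=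
      hF.comp (measurable_const.prodMk (measurable_const_mul σ))
    rw [tailNoise, if_neg h, lintegral_map hF' measurable_snd_div_fst,
      ProbabilityTheory.cond, lintegral_smul_measure, smul_eq_mul, ← mul_assoc,
      ENNReal.mul_inv_cancel h (measure_ne_top _ _), one_mul]
    refine setLIntegral_congr_fun (measurableSet_fst_eq σ) fun q hq => ?_
    have : q.1 = σ := hq
    simp only [this]
    rw [mul_div_cancel₀ _ hσ, ← this]

section TailPair

variable {α p : ℝ} {μ : Measure (ℝ × ℝ)}

theorem IsTailPairLaw.ae_fst (hp : p ∈ Icc (0 : ℝ) 1) (hμ : IsTailPairLaw α p μ) :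
    ∀ᵐ q ∂μ, q.1 = 1 ∨ q.1 = -1 := by
  have := hμ.prob
  have hd : Disjoint {q : ℝ × ℝ | q.1 = 1} {q | q.1 = -1} := by
    rw [Set.disjoint_left]; intro q h h'
    have h1 : q.1 = 1 := h
    have h2 : q.1 = -1 := h'
    linarith
  have h := measure_union (μ := μ) hd (measurableSet_fst_eq (-1))
  rw [hμ.plus, hμ.minus, ← ENNReal.ofReal_add hp.1 (by linarith [hp.2]),
    add_sub_cancel, ENNReal.ofReal_one] at h
  have h' := (prob_compl_eq_zero_iff
    ((measurableSet_fst_eq 1).union (measurableSet_fst_eq (-1)))).2 h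
  rw [ae_iff]
  exact h'

theorem IsTailPairLaw.lintegral_eq_add (hp : p ∈ Icc (0 : ℝ) 1) (hμ : IsTailPairLaw α p μ)
    (F : ℝ × ℝ → ℝ≥0∞) :
    ∫⁻ q, F q ∂μ = ∫⁻ q in {q | q.1 = 1}, F q ∂μ + ∫⁻ q in {q | q.1 = -1}, F q ∂μ := by
  have hd : Disjoint {q : ℝ × ℝ | q.1 = 1} {q | q.1 = -1} := by
    rw [Set.disjoint_left]; intro q h h'
    have h1 : q.1 = 1 := h
    have h2 : q.1 = -1 := h'
    linarith
  rw [← lintegral_union (measurableSet_fst_eq (-1)) hd]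
  conv_lhs => rw [← Measure.restrict_univ (μ := μ)]
  refine setLIntegral_congr ?_
  symm
  rw [ae_eq_univ, ← nonpos_iff_eq_zero]
  exact (ae_iff.1 (hμ.ae_fst hp)).le

theorem IsTailPairLaw.lintegral_eq [IsFiniteMeasure μ] (hp : p ∈ Icc (0 : ℝ) 1)
    (hμ : IsTailPairLaw α p μ) {F : ℝ × ℝ → ℝ≥0∞} (hF : Measurable F) :
    ∫⁻ q, F q ∂μ = ENNReal.ofReal p * ∫⁻ y, F (1, y) ∂(tailKernel μ 1) +
      ENNReal.ofReal (1 - p) * ∫⁻ y, F (-1, y) ∂(tailKernel μ (-1)) := by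
  have hF' : ∀ σ : ℝ, Measurable fun e : ℝ => F (σ, e) := fun σ =>
      hF.comp (measurable_const.prodMk measurable_id)
  rw [hμ.lintegral_eq_add hp, setLIntegral_fst_eq μ one_ne_zero hF,
    setLIntegral_fst_eq μ (by norm_num) hF, hμ.plus, hμ.minus, tailKernel,
    lintegral_signKernel _ (hF' 1), lintegral_signKernel _ (hF' (-1)), Real.sign_one,
    Real.sign_of_neg (by norm_num)]

/-- Polar coordinates: scaling `I` by `z` produces `tailMeasure`, and homogeneity of the kernel lets
the second coordinate be scaled along with the first. -/
theorem IsTailPairLaw.lintegral_scale [IsFiniteMeasure μ] (hp : p ∈ Icc (0 : ℝ) 1)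
    (hμ : IsTailPairLaw α p μ) {F : ℝ × ℝ → ℝ≥0∞} (hF : Measurable F) :
    ∫⁻ z, ∫⁻ q, F (z * q.1, z * q.2) ∂μ ∂(powMeasure α) =
      ∫⁻ x, ∫⁻ y, F (x, y) ∂(tailKernel μ x) ∂(tailMeasure α p) := by
  have hm : Measurable fun x => ∫⁻ y, F (x, y) ∂(tailKernel μ x) :=
    Measurable.lintegral_kernel_prod_right' hF
  have hm' : Measurable fun x => ∫⁻ y, F (-x, y) ∂(tailKernel μ (-x)) := hm.comp measurable_neg
  rw [lintegral_tailMeasure α p hm, ← lintegral_const_mul _ hm, ← lintegral_const_mul _ hm', ← lintegral_add_left (hm.const_mul _)]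
  refine lintegral_congr_ae ((ae_powMeasure_pos α).mono fun z hz => ?_)
  have hF2 : Measurable fun q : ℝ × ℝ => F (z * q.1, z * q.2) :=
    hF.comp ((measurable_fst.const_mul z).prodMk (measurable_snd.const_mul z))
  have hF' : ∀ σ : ℝ, Measurable fun e : ℝ => F (σ, e) := fun σ =>
      hF.comp (measurable_const.prodMk measurable_id)
  have e1 := lintegral_signKernel_mul (tailNoise μ) (hF' z) hz 1
  have e2 := lintegral_signKernel_mul (tailNoise μ) (hF' (-z)) hz (-1)
  rw [mul_one] at e1
  rw [mul_neg_one] at e2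
  simp only
  rw [hμ.lintegral_eq hp hF2]
  simp only [tailKernel, mul_one, mul_neg] at e1 e2 ⊢
  rw [e1, e2]

end TailPair

/-! ### Duality of the kernels of adjoint laws -/

theorem ext_of_Ioi_prod_Ioi {m₁ m₂ : Measure (ℝ × ℝ)} [IsFiniteMeasure m₁]
    (h : ∀ a b : ℝ, m₁ (Ioi a ×ˢ Ioi b) = m₂ (Ioi a ×ˢ Ioi b)) : m₁ = m₂ := by
  have hgen : MeasurableSpace.generateFrom (range (Ioi : ℝ → Set ℝ)) = Real.measurableSpace := by
    rw [← borel_eq_generateFrom_Ioi, BorelSpace.measurable_eq (α := ℝ)]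
  have hun : ⋃ n : ℕ, Ioi (-(n : ℝ)) = univ := by
    refine eq_univ_of_forall fun x => ?_
    obtain ⟨n, hn⟩ := exists_nat_gt (-x)
    exact mem_iUnion.2 ⟨n, by simp only [mem_Ioi]; linarith⟩
  have hsp : IsCountablySpanning (range (Ioi : ℝ → Set ℝ)) :=
    ⟨fun n : ℕ => Ioi (-(n : ℝ)), fun n => ⟨_, rfl⟩, hun⟩
  refine Measure.ext_of_generateFrom_of_iUnion
    (image2 (· ×ˢ ·) (range (Ioi : ℝ → Set ℝ)) (range (Ioi : ℝ → Set ℝ)))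
    (fun n : ℕ => Ioi (-(n : ℝ)) ×ˢ Ioi (-(n : ℝ))) (generateFrom_eq_prod hgen hgen hsp hsp).symm
    (isPiSystem_Ioi.prod isPiSystem_Ioi) ?_ (fun n => ⟨_, ⟨_, rfl⟩, _, ⟨_, rfl⟩, rfl⟩)
    (fun n => measure_ne_top _ _) ?_
  · refine eq_univ_of_forall fun x => ?_
    obtain ⟨n, hn⟩ := exists_nat_gt (max (-x.1) (-x.2))
    obtain ⟨h1, h2⟩ := max_lt_iff.1 hn
    exact mem_iUnion.2 ⟨n, by simp only [mem_Ioi]; linarith, by simp only [mem_Ioi]; linarith⟩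
  · rintro _ ⟨_, ⟨a, rfl⟩, _, ⟨b, rfl⟩, rfl⟩
    exact h a b

/-- Off the axes the plane is a countable union of corners of finite mass, one sequence per
quadrant. Inside a fixed corner, the smaller corners form a generating π-system after reflection to
the positive quadrant. -/
theorem restrict_eq_of_corners {m₁ m₂ : Measure (ℝ × ℝ)}
    (hfin : ∀ a b : ℝ, m₁ {q | 1 < a * q.1 ∧ 1 < b * q.2} ≠ ∞)
    (h : ∀ a b : ℝ, m₁ {q | 1 < a * q.1 ∧ 1 < b * q.2} = m₂ {q | 1 < a * q.1 ∧ 1 < b * q.2}) :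
    m₁.restrict {q | q.1 ≠ 0 ∧ q.2 ≠ 0} = m₂.restrict {q | q.1 ≠ 0 ∧ q.2 ≠ 0} := by
  have hU : {q : ℝ × ℝ | q.1 ≠ 0 ∧ q.2 ≠ 0} = ⋃ i : (ℤˣ × ℤˣ) × ℕ,
      {q : ℝ × ℝ | 1 < (i.1.1 : ℤ) * ((i.2 : ℝ) + 1) * q.1 ∧
        1 < (i.1.2 : ℤ) * ((i.2 : ℝ) + 1) * q.2} := by
    ext q
    simp only [mem_ofPred_eq, mem_iUnion]
    constructor
    · rintro ⟨h1, h2⟩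
      have hs : ∀ x : ℝ, x ≠ 0 → ∃ s : ℤˣ, ((s : ℤ) : ℝ) * x = |x| := fun x hx => by
        rcases lt_or_gt_of_ne hx with h | h
        · exact ⟨-1, by rw [abs_of_neg h]; simp⟩
        · exact ⟨1, by rw [abs_of_pos h]; simp⟩
      obtain ⟨s, hs1⟩ := hs _ h1
      obtain ⟨t, ht1⟩ := hs _ h2
      have hmin : 0 < min |q.1| |q.2| := lt_min (abs_pos.2 h1) (abs_pos.2 h2)
      obtain ⟨n, hn⟩ := exists_nat_gt (min |q.1| |q.2|)⁻¹
      rw [inv_lt_iff_one_lt_mul₀ hmin] at hn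
      refine ⟨((s, t), n), ?_, ?_⟩
      · calc (1 : ℝ) < n * min |q.1| |q.2| := hn
          _ ≤ (n + 1) * |q.1| := by gcongr; · linarith
                                    · exact min_le_left _ _
          _ = _ := by rw [← hs1]; ring
      · calc (1 : ℝ) < n * min |q.1| |q.2| := hn
          _ ≤ (n + 1) * |q.2| := by gcongr; · linarith
                                    · exact min_le_right _ _
          _ = _ := by rw [← ht1]; ring
    · rintro ⟨i, h1, h2⟩
      constructor
      · intro h0; rw [h0, mul_zero] at h1; linarith
      · intro h0; rw [h0, mul_zero] at h2; linarith
  rw [hU, Measure.restrict_iUnion_congr]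
  rintro ⟨⟨s, t⟩, n⟩
  simp only
  set Q := {q : ℝ × ℝ | 1 < (s : ℤ) * ((n : ℝ) + 1) * q.1 ∧ 1 < (t : ℤ) * ((n : ℝ) + 1) * q.2}
    with hQ
  have hn : (0 : ℝ) < (n : ℝ) + 1 := by positivity
  have hQm : MeasurableSet Q :=
    (measurableSet_lt measurable_const (measurable_fst.const_mul _)).inter
      (measurableSet_lt measurable_const (measurable_snd.const_mul _))
  -- The involution that reflects the quadrant with signs `(s, t)` onto the positive one.
  set θ : ℝ × ℝ → ℝ × ℝ := fun q => ((s : ℤ) * q.1, (t : ℤ) * q.2) with hθ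
  have hθm : Measurable θ := (measurable_fst.const_mul _).prodMk (measurable_snd.const_mul _)
  have hsq : ∀ s : ℤˣ, ((s : ℤ) : ℝ) * ((s : ℤ) : ℝ) = 1 := fun s => by
    rcases Int.units_eq_one_or s with rfl | rfl <;> simp
  have hθθ : θ ∘ θ = id := by
    funext q
    simp only [hθ, Function.comp, ← mul_assoc, hsq, one_mul, id]
  have hback : ∀ m : Measure (ℝ × ℝ), (m.map θ).map θ = m := fun m => by
    rw [Measure.map_map hθm hθm, hθθ, Measure.map_id]
  rw [← hback (m₁.restrict Q), ← hback (m₂.restrict Q)]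
  congr 1
  have hfinQ : IsFiniteMeasure (m₁.restrict Q) :=
    ⟨by rw [Measure.restrict_apply_univ]; exact lt_top_iff_ne_top.2 (hfin _ _)⟩
  refine ext_of_Ioi_prod_Ioi fun a b => ?_
  -- An upper-right quadrant intersected with a corner is again a corner; the maximum with `1 / (n +
  -- 1)` also covers `a` or `b` that are not positive.
  have hset : θ ⁻¹' (Ioi a ×ˢ Ioi b) ∩ Q =
      {q | 1 < (s : ℤ) * (max a ((n : ℝ) + 1)⁻¹)⁻¹ * q.1 ∧
        1 < (t : ℤ) * (max b ((n : ℝ) + 1)⁻¹)⁻¹ * q.2} := by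
    have hkey : ∀ c w : ℝ, (1 < (max c ((n : ℝ) + 1)⁻¹)⁻¹ * w ↔ c < w ∧ 1 < ((n : ℝ) + 1) * w) := by
      intro c w
      have h0 : 0 < max c ((n : ℝ) + 1)⁻¹ := lt_max_of_lt_right (inv_pos.2 hn)
      rw [inv_mul_eq_div, one_lt_div h0, max_lt_iff, inv_lt_iff_one_lt_mul₀ hn, mul_comm w]
    ext q
    simp only [mem_inter_iff, mem_preimage, mem_prod, mem_Ioi, hQ, hθ, mem_ofPred_eq]
    have e : ∀ c d w : ℝ, c * d * w = d * (c * w) := fun c d w => by ring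
    rw [e _ _ q.1, e _ _ q.2, e _ _ q.1, e _ _ q.2, hkey, hkey]
    tauto
  have hm := measurableSet_Ioi.prod (measurableSet_Ioi (a := b)) (s := Ioi a)
  rw [Measure.map_apply hθm hm, Measure.map_apply hθm hm, Measure.restrict_apply (hθm hm),
    Measure.restrict_apply (hθm hm), hset, h]

theorem ae_tailMeasure_ne_zero (α p : ℝ) : ∀ᵐ x ∂(tailMeasure α p), x ≠ 0 := by
  have h := lintegral_tailMeasure α p
    (f := indicator {0} 1) (measurable_one.indicator (measurableSet_singleton 0))
  have h0 : powMeasure α {0} = 0 := measure_mono_null (by simp) (powMeasure_Iic α)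
  have h1 : ∫⁻ z, indicator {0} (1 : ℝ → ℝ≥0∞) z ∂(powMeasure α) = 0 := by
    rw [lintegral_indicator_one (measurableSet_singleton 0), h0]
  have h2 : ∀ z : ℝ, indicator {0} (1 : ℝ → ℝ≥0∞) (-z) = indicator {0} (1 : ℝ → ℝ≥0∞) z := by
    intro z; simp [indicator]
  simp only [h2, h1, mul_zero, add_zero] at h
  rw [lintegral_indicator_one (measurableSet_singleton 0)] at h
  rw [ae_iff]
  simpa using h

/-- Separates the transitions that hit `0`. They form a measure on the axis, with density `κ x {0}`.
-/
theorem lintegral_lintegral_split {κ : Kernel ℝ ℝ} [IsMarkovKernel κ] {l : Measure ℝ}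
    (hl : ∀ᵐ x ∂l, x ≠ 0) {h : ℝ × ℝ → ℝ≥0∞} (hh : Measurable h) :
    ∫⁻ x, ∫⁻ y, h (x, y) ∂(κ x) ∂l =
      ∫⁻ x, ∫⁻ y, indicator {q : ℝ × ℝ | q.1 ≠ 0 ∧ q.2 ≠ 0} h (x, y) ∂(κ x) ∂l +
        ∫⁻ x, h (x, 0) ∂(l.withDensity fun x => κ x {0}) := by
  have hD : MeasurableSet {q : ℝ × ℝ | q.1 ≠ 0 ∧ q.2 ≠ 0} :=
    (measurable_fst (measurableSet_singleton 0).compl).inter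
      (measurable_snd (measurableSet_singleton 0).compl)
  have hh0 : Measurable fun x => h (x, 0) := hh.comp (measurable_id.prodMk measurable_const)
  rw [lintegral_withDensity_eq_lintegral_mul _ (κ.measurable_coe (measurableSet_singleton 0)) hh0,
    ← lintegral_add_left (Measurable.lintegral_kernel_prod_right' (hh.indicator hD))]
  refine lintegral_congr_ae (hl.mono fun x hx => ?_)
  simp only [Pi.mul_apply]
  have e : ∀ y, h (x, y) = indicator {q : ℝ × ℝ | q.1 ≠ 0 ∧ q.2 ≠ 0} h (x, y) +
      indicator {0} (fun _ => h (x, 0)) y := by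
    intro y
    by_cases hy : y = 0
    · simp [indicator, hy]
    · simp [indicator, hy, hx]
  rw [lintegral_congr e, lintegral_add_right _
    (measurable_const.indicator (measurableSet_singleton 0)),
    lintegral_indicator_const (measurableSet_singleton 0), mul_comm]

/-- The axis contributions on the two sides match by the choice of the densities. Off the axes both
sides are images of scaled pairs, whose corner masses are the two members of the adjoint relation.
-/
theorem AreAdjointLaws.areDualKernels {α p : ℝ} (hα : 0 < α) (hp : p ∈ Icc (0 : ℝ) 1)
    {μ μ' : Measure (ℝ × ℝ)} [IsFiniteMeasure μ] [IsFiniteMeasure μ']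
    (h : AreAdjointLaws α p μ μ') :
    AreDualKernels (tailKernel μ) (tailKernel μ') (tailMeasure α p)
      ((tailMeasure α p).withDensity fun x => tailKernel μ' x {0})
      ((tailMeasure α p).withDensity fun x => tailKernel μ x {0}) := by
  intro f hf
  set D : Set (ℝ × ℝ) := {q : ℝ × ℝ | q.1 ≠ 0 ∧ q.2 ≠ 0} with hDdef
  have hD : MeasurableSet D :=
    (measurable_fst (measurableSet_singleton 0).compl).inter
      (measurable_snd (measurableSet_singleton 0).compl)
  have hl := ae_tailMeasure_ne_zero α p
  rw [lintegral_lintegral_split (κ := tailKernel μ') (h := fun q => f (q.2, q.1)) hl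
      (hf.comp measurable_swap), lintegral_lintegral_split (κ := tailKernel μ) hl hf]
  have hswap : ∀ x u, indicator D (fun q : ℝ × ℝ => f (q.2, q.1)) (x, u) =
      indicator D f (u, x) := by
    intro x u; simp [indicator, hDdef, and_comm]
  simp only [← hDdef, hswap]
  have hT1 : Measurable fun r : ℝ × (ℝ × ℝ) => (r.1 * r.2.2, r.1 * r.2.1) := by fun_prop
  have hT2 : Measurable fun r : ℝ × (ℝ × ℝ) => (r.1 * r.2.1, r.1 * r.2.2) := by fun_prop
  set m₁ := ((powMeasure α).prod μ').map fun r : ℝ × (ℝ × ℝ) => (r.1 * r.2.2, r.1 * r.2.1)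
    with hm₁
  set m₂ := ((powMeasure α).prod μ).map fun r : ℝ × (ℝ × ℝ) => (r.1 * r.2.1, r.1 * r.2.2)
    with hm₂
  have hF1 : ∀ g : ℝ × ℝ → ℝ≥0∞, Measurable g → ∫⁻ q, g q ∂m₁ =
      ∫⁻ x, ∫⁻ u, g (u, x) ∂(tailKernel μ' x) ∂(tailMeasure α p) := fun g hg => by
    rw [hm₁, lintegral_map hg hT1, lintegral_prod (fun r : ℝ × (ℝ × ℝ) => g (r.1 * r.2.2, r.1 * r.2.1))
      (hg.comp hT1).aemeasurable,
      ← h.right_mem.lintegral_scale hp (F := fun q => g (q.2, q.1)) (hg.comp measurable_swap)]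
  have hF2 : ∀ g : ℝ × ℝ → ℝ≥0∞, Measurable g → ∫⁻ q, g q ∂m₂ =
      ∫⁻ u, ∫⁻ x, g (u, x) ∂(tailKernel μ u) ∂(tailMeasure α p) := fun g hg => by
    rw [hm₂, lintegral_map hg hT2, lintegral_prod (fun r : ℝ × (ℝ × ℝ) => g (r.1 * r.2.1, r.1 * r.2.2))
      (hg.comp hT2).aemeasurable,
      ← h.left_mem.lintegral_scale hp hg]
  have hcm : ∀ a b : ℝ, MeasurableSet {q : ℝ × ℝ | 1 < a * q.1 ∧ 1 < b * q.2} := fun a b =>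
    (measurableSet_lt measurable_const (measurable_fst.const_mul _)).inter
      (measurableSet_lt measurable_const (measurable_snd.const_mul _))
  have hc1 : ∀ a b : ℝ, m₁ {q | 1 < a * q.1 ∧ 1 < b * q.2} =
      ∫⁻ q, min (posPow α (a * q.2)) (posPow α (b * q.1)) ∂μ' := fun a b => by
    rw [hm₁, Measure.map_apply hT1 (hcm a b), Measure.prod_apply_symm (hT1 (hcm a b))]
    refine lintegral_congr fun q => ?_
    rw [← powMeasure_corner hα]
    congr 1
    ext z
    simp only [mem_preimage, mem_ofPred_eq]
    rw [mul_left_comm, mul_comm z, mul_left_comm b, mul_comm z]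
  have hc2 : ∀ a b : ℝ, m₂ {q | 1 < a * q.1 ∧ 1 < b * q.2} =
      ∫⁻ q, min (posPow α (a * q.1)) (posPow α (b * q.2)) ∂μ := fun a b => by
    rw [hm₂, Measure.map_apply hT2 (hcm a b), Measure.prod_apply_symm (hT2 (hcm a b))]
    refine lintegral_congr fun q => ?_
    rw [← powMeasure_corner hα]
    congr 1
    ext z
    simp only [mem_preimage, mem_ofPred_eq]
    rw [mul_left_comm, mul_comm z, mul_left_comm b, mul_comm z]
  have hfin : ∀ a b : ℝ, m₁ {q | 1 < a * q.1 ∧ 1 < b * q.2} ≠ ∞ := fun a b => by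
    rw [hc1]
    -- The minimum is bounded by its `I`-part, which takes only two values because `I = ±1`.
    refine ne_top_of_le_ne_top (b := ∫⁻ _, posPow α b + posPow α (-b) ∂μ') ?_ ?_
    · rw [lintegral_const]
      exact ENNReal.mul_ne_top (ENNReal.add_ne_top.2 ⟨ENNReal.ofReal_ne_top, ENNReal.ofReal_ne_top⟩)
        (measure_ne_top _ _)
    · refine lintegral_mono_ae ((h.right_mem.ae_fst hp).mono fun q hq => ?_)
      refine (min_le_right _ _).trans ?_
      rcases hq with hq | hq <;> rw [hq]
      · rw [mul_one]; exact le_self_add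
      · rw [mul_neg_one]; exact le_add_self
  have key := restrict_eq_of_corners (m₂ := m₂) hfin fun a b => by rw [hc1, hc2, h.min_eq a b]
  rw [← hF1 _ (hf.indicator hD), ← hF2 _ (hf.indicator hD), lintegral_indicator hD,
    lintegral_indicator hD, key]
  ring

/-! ### Laws of chains with given transition kernels -/

/-- The Markov property of the sequence `Y` with respect to the measure `P`. -/
def HasKernelTransitions {Ω : Type*} [MeasurableSpace Ω] (P : Measure Ω) (κ : Kernel ℝ ℝ)
    (Y : ℕ → Ω → ℝ) : Prop :=
  ∀ (n : ℕ) (f : (Fin (n + 2) → ℝ) → ℝ≥0∞), Measurable f →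
    ∫⁻ ω, f (Fin.snoc (fun i : Fin (n + 1) => Y i ω) (Y (n + 1) ω)) ∂P =
      ∫⁻ ω, ∫⁻ y, f (Fin.snoc (fun i : Fin (n + 1) => Y i ω) y) ∂(κ (Y n ω)) ∂P

theorem HasKernelTransitions.lintegral_eq {Ω : Type*} [MeasurableSpace Ω] {P : Measure Ω}
    {κ : Kernel ℝ ℝ} [IsMarkovKernel κ] {Y : ℕ → Ω → ℝ} (hY : HasKernelTransitions P κ Y) (n : ℕ)
    {f : (Fin (n + 1) → ℝ) → ℝ≥0∞} (hf : Measurable f) :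
    ∫⁻ ω, f (fun i => Y i ω) ∂P = ∫⁻ ω, pathInt κ n f (Y 0 ω) ∂P := by
  induction n with
  | zero =>
    refine lintegral_congr fun ω => ?_
    rw [pathInt]
    congr 1
    funext i
    fin_cases i; rfl
  | succ n ih =>
    have e : ∀ ω, (fun i : Fin (n + 2) => Y i ω) =
        Fin.snoc (fun i : Fin (n + 1) => Y i ω) (Y (n + 1) ω) := by
      intro ω
      funext i
      refine Fin.lastCases ?_ (fun j => ?_) i <;> simp
    simp only [e]
    rw [hY n f hf]
    have := ih (measurable_lintegral_snoc (κ := κ) n hf)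
    simp only [Fin.val_last] at this
    rw [this]
    exact lintegral_congr fun ω => (pathInt_snoc n f _).symm

/-- The conditional law of `Z` given the σ-algebra `m` is `κ W`: integrated form. -/
theorem lintegral_of_condExp {Ω E : Type*} {m mΩ : MeasurableSpace Ω} [MeasurableSpace E]
    (hm : m ≤ mΩ) {P : Measure Ω} [IsProbabilityMeasure P] {μ : Measure (ℝ × ℝ)}
    [IsProbabilityMeasure μ] {W Z : Ω → ℝ} (hW : Measurable[m] W) (hZ : Measurable Z)
    (hc : ∀ B : Set ℝ, MeasurableSet B →
      P[(Z ⁻¹' B).indicator (fun _ => (1 : ℝ)) | m] =ᵐ[P] fun ω => (tailTransition μ (W ω)).real B)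
    {Φ : Ω → E} (hΦ : Measurable[m] Φ) {h : E × ℝ → ℝ≥0∞} (hh : Measurable h) :
    ∫⁻ ω, h (Φ ω, Z ω) ∂P = ∫⁻ ω, ∫⁻ y, h (Φ ω, y) ∂(tailKernel μ (W ω)) ∂P := by
  have hWm : Measurable W := hW.mono hm le_rfl
  have hΦm : Measurable Φ := hΦ.mono hm le_rfl
  -- Taking `B = univ` in the hypothesis shows that almost surely the chain avoids the states at
  -- which `tailTransition` is the zero measure.
  have hone : ∀ᵐ ω ∂P, (tailTransition μ (W ω)).real univ = 1 := by
    have := hc univ MeasurableSet.univ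
    simp only [preimage_univ, indicator_univ] at this
    rw [condExp_const hm] at this
    exact this.mono fun ω hω => hω.symm
  have hker : ∀ᵐ ω ∂P, tailTransition μ (W ω) = tailKernel μ (W ω) := by
    filter_upwards [hone] with ω hω
    refine tailTransition_eq μ ?_
    by_contra hcon
    push Not at hcon
    rw [tailTransition_eq_zero μ hcon.1 hcon.2] at hω
    simp at hω
  set κ : Kernel Ω ℝ := (tailKernel μ).comap W hWm with hκ
  have key : P.map (fun ω => (Φ ω, Z ω)) = (P ⊗ₘ κ).map (fun q => (Φ q.1, q.2)) := by
    have hΦ2 : Measurable fun q : Ω × ℝ => (Φ q.1, q.2) :=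
      (hΦm.comp measurable_fst).prodMk measurable_snd
    have : IsProbabilityMeasure (P.map (fun ω => (Φ ω, Z ω))) :=
      Measure.isProbabilityMeasure_map (hΦm.prodMk hZ).aemeasurable
    have : IsProbabilityMeasure ((P ⊗ₘ κ).map (fun q => (Φ q.1, q.2))) :=
      Measure.isProbabilityMeasure_map hΦ2.aemeasurable
    refine Measure.ext_prod fun {A B} hA hB => ?_
    have hAB := hA.prod hB
    rw [Measure.map_apply (hΦm.prodMk hZ) hAB, Measure.map_apply hΦ2 hAB]
    have hA' : MeasurableSet[m] (Φ ⁻¹' A) := hΦ hA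
    have e1 : P ((fun ω => (Φ ω, Z ω)) ⁻¹' A ×ˢ B) =
        ENNReal.ofReal (∫ ω in Φ ⁻¹' A, (Z ⁻¹' B).indicator (fun _ => (1 : ℝ)) ω ∂P) := by
      rw [setIntegral_indicator (hZ hB), setIntegral_const, smul_eq_mul, mul_one,
        ofReal_measureReal]
      rfl
    have e2 : (fun q : Ω × ℝ => (Φ q.1, q.2)) ⁻¹' A ×ˢ B = (Φ ⁻¹' A) ×ˢ B := rfl
    rw [e1, e2, Measure.compProd_apply_prod (hΦm hA) hB, ← setIntegral_condExp hm
      ((integrable_const _).indicator (hZ hB)) hA', setIntegral_congr_ae (hm _ hA')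
      ((hc B hB).mono fun ω hω _ => hω), setIntegral_congr_ae (g := fun ω => (κ ω).real B)
      (hm _ hA') (hker.mono fun ω hω _ => by rw [hω]; rfl)]
    simp only [Measure.real]
    rw [integral_toReal]
    · rw [ENNReal.ofReal_toReal]
      refine ne_top_of_le_ne_top (b := ∫⁻ _ in Φ ⁻¹' A, 1 ∂P) ?_
        (lintegral_mono fun ω => prob_le_one)
      rw [setLIntegral_const, one_mul]
      exact measure_ne_top _ _
    · exact (κ.measurable_coe hB).aemeasurable
    · exact Eventually.of_forall fun ω => measure_lt_top _ _
  have hΦ2 : Measurable fun q : Ω × ℝ => (Φ q.1, q.2) :=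
      (hΦm.comp measurable_fst).prodMk measurable_snd
  rw [← lintegral_map (f := h) hh (hΦm.prodMk hZ), key, lintegral_map hh hΦ2,
    Measure.lintegral_compProd (f := fun q : Ω × ℝ => h (Φ q.1, q.2)) (hh.comp hΦ2)]
  rfl

section TailChainLaw

variable {Ω : Type*} [MeasurableSpace Ω] {P : Measure Ω} [IsProbabilityMeasure P] {α p : ℝ}

/-- Restriction to `{W ∈ A}` preserves the transitions because `W` belongs to the past at every
time. This yields the forward chain on `{M (-1) = 0}` and the backward chain on `{M 1 = 0}`. -/
theorem hasKernelTransitions_of_condExp {μ : Measure (ℝ × ℝ)} [IsProbabilityMeasure μ]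
    {Y : ℕ → Ω → ℝ} {W : Ω → ℝ} (m : ℕ → MeasurableSpace Ω) (hm : ∀ n, m n ≤ ‹MeasurableSpace Ω›)
    (hYm : ∀ n k, k ≤ n → Measurable[m n] (Y k)) (hW : ∀ n, Measurable[m n] W)
    (hY : ∀ n, Measurable (Y n))
    (hc : ∀ n, ∀ B : Set ℝ, MeasurableSet B →
      P[(Y (n + 1) ⁻¹' B).indicator (fun _ => (1 : ℝ)) | m n] =ᵐ[P]
        fun ω => (tailTransition μ (Y n ω)).real B) {A : Set ℝ} (hA : MeasurableSet A) :
    HasKernelTransitions (P.restrict {ω | W ω ∈ A}) (tailKernel μ) Y := by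
  intro n f hf
  have hWA : MeasurableSet {ω | W ω ∈ A} := ((hW n).mono (hm n) le_rfl) hA
  have hΦ : Measurable[m n] fun ω => (W ω, fun i : Fin (n + 1) => Y i ω) :=
    Measurable.prodMk (hW n) (@measurable_pi_iff _ _ _ (m n) _ _ |>.2 fun i => hYm n i (Nat.lt_succ_iff.1 i.2))
  have hh : Measurable fun q : (ℝ × (Fin (n + 1) → ℝ)) × ℝ =>
      A.indicator (1 : ℝ → ℝ≥0∞) q.1.1 * f (Fin.snoc q.1.2 q.2) :=
    ((measurable_one.indicator hA).comp (measurable_fst.comp measurable_fst)).mul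
      (hf.comp (measurable_finSnoc.comp ((measurable_snd.comp measurable_fst).prodMk
        measurable_snd)))
  have key := lintegral_of_condExp (hm n) (hYm n n le_rfl) (hY (n + 1)) (hc n) hΦ hh
  have e : ∀ F : Ω → ℝ≥0∞, ∫⁻ ω in {ω | W ω ∈ A}, F ω ∂P =
      ∫⁻ ω, A.indicator (1 : ℝ → ℝ≥0∞) (W ω) * F ω ∂P := by
    intro F
    rw [← lintegral_indicator hWA]
    refine lintegral_congr fun ω => ?_
    by_cases h : W ω ∈ A <;> simp [indicator, h]
  rw [e, e, key]
  refine lintegral_congr fun ω => ?_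
  have hm : Measurable fun y => f (Fin.snoc (fun i : Fin (n + 1) => Y i ω) y) :=
    (hf.comp measurable_finSnoc).comp (measurable_const.prodMk measurable_id)
  simp only
  rw [lintegral_const_mul _ hm]

/-- Given the state at time `0`, the event `W ∈ A` has probability `κ' (Y 0) A` and the path evolves
by `κ`. Integrating over the scale `z` turns the state at time `0` into `tailMeasure`; scale
invariance of `A` makes the event compatible with this. -/
theorem lintegral_scaled_path {μ μ' : Measure (ℝ × ℝ)} [IsFiniteMeasure μ] [IsFiniteMeasure μ']
    (hp : p ∈ Icc (0 : ℝ) 1) (hμ' : IsTailPairLaw α p μ') {Y : ℕ → Ω → ℝ} {W : Ω → ℝ}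
    (hY : ∀ k, Measurable (Y k)) (hW : Measurable W)
    (hlaw : P.map (fun ω => (Y 0 ω, W ω)) = μ') {A : Set ℝ} (hA : MeasurableSet A)
    (hAs : ∀ z : ℝ, 0 < z → ∀ y, z * y ∈ A ↔ y ∈ A)
    (hker : HasKernelTransitions (P.restrict {ω | W ω ∈ A}) (tailKernel μ) Y) (n : ℕ)
    {f : (Fin (n + 1) → ℝ) → ℝ≥0∞} (hf : Measurable f) :
    ∫⁻ z, ∫⁻ ω in {ω | W ω ∈ A}, f (fun j => z * Y j ω) ∂P ∂(powMeasure α) =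
      ∫⁻ x, pathInt (tailKernel μ) n f x
        ∂((tailMeasure α p).withDensity fun x => tailKernel μ' x A) := by
  have hpm : Measurable (pathInt (tailKernel μ) n f) := measurable_pathInt n hf
  have hG : Measurable fun q : ℝ × ℝ => A.indicator (1 : ℝ → ℝ≥0∞) q.2 *
      pathInt (tailKernel μ) n f q.1 :=
    ((measurable_one.indicator hA).comp measurable_snd).mul (hpm.comp measurable_fst)
  have h1 := hμ'.lintegral_scale hp hG
  have hWA : MeasurableSet {ω | W ω ∈ A} := hW hA
  rw [lintegral_withDensity_eq_lintegral_mul _ ((tailKernel μ').measurable_coe hA) hpm]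
  have h2 : ∀ x, ∫⁻ y, A.indicator (1 : ℝ → ℝ≥0∞) y * pathInt (tailKernel μ) n f x
      ∂(tailKernel μ' x) = ((fun x => tailKernel μ' x A) * pathInt (tailKernel μ) n f) x := by
    intro x
    rw [lintegral_mul_const _ (measurable_one.indicator hA), lintegral_indicator_one hA]
    rfl
  rw [lintegral_congr h2] at h1
  rw [← h1]
  refine lintegral_congr_ae ((ae_powMeasure_pos α).mono fun z hz => ?_)
  have hfz : Measurable fun v : Fin (n + 1) → ℝ => f (fun i => z * v i) :=
    hf.comp (measurable_pi_iff.2 fun i => (measurable_const_mul z).comp (measurable_pi_apply i))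
  have hGz : Measurable fun q : ℝ × ℝ => A.indicator (1 : ℝ → ℝ≥0∞) (z * q.2) *
      pathInt (tailKernel μ) n f (z * q.1) :=
    hG.comp ((measurable_fst.const_mul z).prodMk (measurable_snd.const_mul z))
  simp only
  rw [← hlaw, lintegral_map hGz ((hY 0).prodMk hW), hker.lintegral_eq n hfz,
    ← lintegral_indicator hWA]
  refine lintegral_congr fun ω => ?_
  rw [tailKernel, pathInt_signKernel_mul _ hz n hf]
  by_cases h : W ω ∈ A
  · simp [indicator, h, (hAs z hz (W ω)).2 h]
  · simp [indicator, h, (hAs z hz (W ω)).not.2 h]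

variable {μ : Measure (ℝ × ℝ)} {M : ℤ → Ω → ℝ}

theorem IsBackForthTailChain.forward_transitions [IsProbabilityMeasure μ]
    (hM : IsBackForthTailChain P α p μ M) {A : Set ℝ} (hA : MeasurableSet A) :
    HasKernelTransitions (P.restrict {ω | M (-1) ω ∈ A}) (tailKernel μ) (fun n => M n) := by
  have hcomap : ∀ n : ℕ, ∀ s : ℤ, s ≤ (n : ℤ) + 1 - 1 → Measurable[⨆ s : {s : ℤ // s ≤
      (n : ℤ) + 1 - 1}, MeasurableSpace.comap (M s) inferInstance] (M s) := fun n s hs =>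
    Measurable.mono (comap_measurable (M s))
      (le_iSup (fun s : {s : ℤ // s ≤ (n : ℤ) + 1 - 1} =>
        MeasurableSpace.comap (M s) inferInstance) ⟨s, hs⟩) le_rfl
  refine hasKernelTransitions_of_condExp (fun n : ℕ => ⨆ s : {s : ℤ // s ≤ (n : ℤ) + 1 - 1},
      MeasurableSpace.comap (M s) inferInstance) ?_ ?_ ?_ (fun n => hM.measurable n) ?_ hA
  · exact fun n => iSup_le fun s => (hM.measurable s).comap_le
  · exact fun n k hk => hcomap n k (by omega)
  · exact fun n => hcomap n (-1) (by omega)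
  · intro n B hB
    have := hM.forward_transition ((n : ℤ) + 1) (by omega) B hB
    simpa using this

theorem IsBackForthTailChain.backward_transitions
    (hM : IsBackForthTailChain P α p μ M) {A : Set ℝ} (hA : MeasurableSet A) :
    haveI := hM.adjoint_law.right_mem.prob
    HasKernelTransitions (P.restrict {ω | M 1 ω ∈ A})
      (tailKernel (P.map (fun ω => (M 0 ω, M (-1) ω)))) (fun n => M (-n)) := by
  have := hM.adjoint_law.right_mem.prob
  have hcomap : ∀ n : ℕ, ∀ s : ℤ, -((n : ℤ) + 1) + 1 ≤ s → Measurable[⨆ s : {s : ℤ //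
      -((n : ℤ) + 1) + 1 ≤ s}, MeasurableSpace.comap (M s) inferInstance] (M s) := fun n s hs =>
    Measurable.mono (comap_measurable (M s))
      (le_iSup (fun s : {s : ℤ // -((n : ℤ) + 1) + 1 ≤ s} =>
        MeasurableSpace.comap (M s) inferInstance) ⟨s, hs⟩) le_rfl
  refine hasKernelTransitions_of_condExp (fun n : ℕ => ⨆ s : {s : ℤ // -((n : ℤ) + 1) + 1 ≤ s},
      MeasurableSpace.comap (M s) inferInstance) ?_ ?_ ?_ (fun n => hM.measurable _) ?_ hA
  · exact fun n => iSup_le fun s => (hM.measurable s).comap_le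
  · exact fun n k hk => hcomap n (-k) (by omega)
  · exact fun n => hcomap n 1 (by omega)
  · intro n B hB
    have := hM.backward_transition ((n : ℤ) + 1) (by omega) B hB
    have e : -((n : ℤ) + 1) + 1 = -(n : ℤ) := by ring
    simp only [e] at this
    simpa using this

end TailChainLaw

/-! ### The measure on path space defined by the tail functional -/

/-- The law of `(x, ξ₁, …, ξₙ)`, as a kernel in `x`. -/
noncomputable def pathKernel (κ : Kernel ℝ ℝ) : (n : ℕ) → Kernel ℝ (Fin (n + 1) → ℝ)
  | 0 => Kernel.deterministic (fun x _ => x) (measurable_pi_iff.2 fun _ => measurable_id)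
  | n + 1 => (Kernel.id ×ₖ (pathKernel κ n ∘ₖ κ)).map (fun q => Fin.cons q.1 q.2)

section PathKernel

variable {κ : Kernel ℝ ℝ} [IsMarkovKernel κ]

instance isMarkovKernel_pathKernel (n : ℕ) : IsMarkovKernel (pathKernel κ n) := by
  induction n with
  | zero => unfold pathKernel; infer_instance
  | succ n ih => exact Kernel.IsMarkovKernel.map _ measurable_finCons

theorem lintegral_pathKernel (n : ℕ) {f : (Fin (n + 1) → ℝ) → ℝ≥0∞} (hf : Measurable f) (x : ℝ) :
    ∫⁻ v, f v ∂(pathKernel κ n x) = pathInt κ n f x := by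
  induction n generalizing x with
  | zero => rw [pathKernel, Kernel.deterministic_apply, lintegral_dirac' _ hf]; rfl
  | succ n ih =>
    have hm : Measurable fun v : Fin (n + 1) → ℝ => f (Fin.cons x v) :=
      (hf.comp measurable_finCons).comp (measurable_const.prodMk measurable_id)
    rw [pathKernel, Kernel.lintegral_map _ measurable_finCons _ hf,
      Kernel.lintegral_id_prod (f := fun q => f (Fin.cons q.1 q.2)) (hf.comp measurable_finCons),
      Kernel.lintegral_comp _ _ _ hm, pathInt]
    exact lintegral_congr fun y => ih hm y

/-- The measure whose integrals are given by `tailInt`. -/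
noncomputable def chainMeasure (κ : Kernel ℝ ℝ) (l₁ : Measure ℝ) :
    Measure ℝ → (n : ℕ) → Measure (Fin (n + 1) → ℝ)
  | l₀, 0 => l₀.bind (pathKernel κ 0)
  | l₀, n + 1 => l₀.bind (pathKernel κ (n + 1)) + (chainMeasure κ l₁ l₁ n).map (Fin.cons 0)

theorem measurable_finCons_zero {n : ℕ} :
    Measurable (fun v : Fin n → ℝ => (Fin.cons 0 v : Fin (n + 1) → ℝ)) :=
  measurable_finCons.comp (measurable_const.prodMk measurable_id)

theorem lintegral_bind_pathKernel (l : Measure ℝ) (n : ℕ) {f : (Fin (n + 1) → ℝ) → ℝ≥0∞}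
    (hf : Measurable f) :
    ∫⁻ v, f v ∂(l.bind (pathKernel κ n)) = ∫⁻ x, pathInt κ n f x ∂l := by
  rw [Measure.lintegral_bind (pathKernel κ n).aemeasurable hf.aemeasurable]
  exact lintegral_congr fun x => lintegral_pathKernel n hf x

theorem lintegral_chainMeasure (l₀ l₁ : Measure ℝ) (n : ℕ) {f : (Fin (n + 1) → ℝ) → ℝ≥0∞}
    (hf : Measurable f) :
    ∫⁻ v, f v ∂(chainMeasure κ l₁ l₀ n) = tailInt κ l₁ l₀ n f := by
  induction n generalizing l₀ with
  | zero => rw [chainMeasure, lintegral_bind_pathKernel l₀ 0 hf]; rfl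
  | succ n ih =>
    rw [chainMeasure, lintegral_add_measure, lintegral_bind_pathKernel l₀ _ hf,
      lintegral_map hf measurable_finCons_zero,
      ih (f := fun v => f (Fin.cons 0 v)) l₁ (hf.comp measurable_finCons_zero), tailInt]

theorem tailInt_zero_fun (l₀ l₁ : Measure ℝ) (n : ℕ) : tailInt κ l₁ l₀ n (fun _ => 0) = 0 := by
  induction n generalizing l₀ with
  | zero => simp [tailInt, pathInt]
  | succ n ih => simp [tailInt, pathInt_const, ih]

end PathKernel

/-- The vector `(0, …, 0, z m₀, …, z m_{t-i})`, with `i` leading zeros. -/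
noncomputable def paddedVec (t : ℕ) (i : Fin (t + 1)) (m : ℕ → ℝ) (z : ℝ) : Fin (t + 1) → ℝ :=
  fun j => if j < i then 0 else z * m (j - i : ℕ)

theorem paddedVec_zero (t : ℕ) (m : ℕ → ℝ) (z : ℝ) : paddedVec t 0 m z = fun j : Fin (t + 1) => z * m j := by
  funext j
  simp [paddedVec]

theorem paddedVec_succ (t : ℕ) (i : Fin (t + 1)) (m : ℕ → ℝ) (z : ℝ) :
    paddedVec (t + 1) i.succ m z = Fin.cons 0 (paddedVec t i m z) := by
  funext j
  refine Fin.cases ?_ (fun j => ?_) j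
  · simp [paddedVec]
  · simp [paddedVec]

/-- The vectors whose first non-zero coordinate is the `i`-th one. -/
def firstNonzeroSet {E : Type*} [Zero E] (t : ℕ) (i : Fin (t + 1)) : Set (Fin (t + 1) → E) :=
  {v | (∀ j, j < i → v j = 0) ∧ v i ≠ 0}

theorem measurableSet_firstNonzeroSet {E : Type*} [Zero E] [MeasurableSpace E]
    [MeasurableSingletonClass E] (t : ℕ) (i : Fin (t + 1)) :
    MeasurableSet (firstNonzeroSet (E := E) t i) := by
  have : firstNonzeroSet (E := E) t i =
      (⋂ j : Fin (t + 1), ⋂ _ : j < i, (fun v => v j) ⁻¹' {0}) ∩ (fun v => v i) ⁻¹' {0}ᶜ := by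
    ext v; simp [firstNonzeroSet]
  rw [this]
  exact (MeasurableSet.iInter fun j => MeasurableSet.iInter fun _ =>
    measurable_pi_apply j (measurableSet_singleton 0)).inter
      (measurable_pi_apply i (measurableSet_singleton 0).compl)

/-- Neither starting measure charges `0`, so the summand with `i` zeros is concentrated on vectors
whose first non-zero coordinate is the `i`-th. Restriction to that set selects a single summand. -/
theorem tailInt_firstNonzeroSet {Ω : Type*} [MeasurableSpace Ω] {κ : Kernel ℝ ℝ}
    [IsMarkovKernel κ] {l₀ l₁ : Measure ℝ} (hl₀ : ∀ᵐ x ∂l₀, x ≠ 0) (hl₁ : ∀ᵐ x ∂l₁, x ≠ 0)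
    {Y : ℕ → Ω → ℝ} {P₀ P₁ : Measure Ω} {pw : Measure ℝ}
    (h₀ : ∀ (n : ℕ) (f : (Fin (n + 1) → ℝ) → ℝ≥0∞), Measurable f →
      ∫⁻ z, ∫⁻ ω, f (fun j => z * Y j ω) ∂P₀ ∂pw = ∫⁻ x, pathInt κ n f x ∂l₀)
    (h₁ : ∀ (n : ℕ) (f : (Fin (n + 1) → ℝ) → ℝ≥0∞), Measurable f →
      ∫⁻ z, ∫⁻ ω, f (fun j => z * Y j ω) ∂P₁ ∂pw = ∫⁻ x, pathInt κ n f x ∂l₁)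
    (t : ℕ) (i : Fin (t + 1)) {f : (Fin (t + 1) → ℝ) → ℝ≥0∞} (hf : Measurable f) :
    tailInt κ l₁ l₀ t ((firstNonzeroSet t i).indicator f) =
      ∫⁻ z, ∫⁻ ω, f (paddedVec t i (fun k => Y k ω) z) ∂(if i = 0 then P₀ else P₁) ∂pw := by
  have hfirst : ∀ (n : ℕ) (f : (Fin (n + 1) → ℝ) → ℝ≥0∞) (l : Measure ℝ), (∀ᵐ x ∂l, x ≠ 0) →
      ∫⁻ x, pathInt κ n ((firstNonzeroSet n 0).indicator f) x ∂l = ∫⁻ x, pathInt κ n f x ∂l := by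
    intro n f l hl
    refine lintegral_congr_ae (hl.mono fun x hx => pathInt_congr n fun v hv => ?_)
    rw [indicator_of_mem]
    exact ⟨fun j hj => absurd hj (Fin.not_lt_zero j), by rwa [hv]⟩
  induction t generalizing l₀ P₀ with
  | zero =>
    obtain rfl : i = 0 := by ext; omega
    rw [tailInt, hfirst _ _ _ hl₀, ← h₀ 0 f hf]
    simp only [paddedVec_zero, if_true]
  | succ t ih =>
    rw [tailInt]
    refine Fin.cases ?_ (fun i => ?_) i
    · have : (fun v : Fin (t + 1) → ℝ =>
          (firstNonzeroSet (t + 1) 0).indicator f (Fin.cons 0 v)) = fun _ => 0 := by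
        funext v
        rw [indicator_of_notMem]
        exact fun h => h.2 (by simp)
      rw [this, tailInt_zero_fun, add_zero, hfirst _ _ _ hl₀, ← h₀ _ f hf]
      simp only [paddedVec_zero, if_true]
    · have e1 : ∫⁻ x, pathInt κ (t + 1) ((firstNonzeroSet (t + 1) i.succ).indicator f) x ∂l₀ =
          0 := by
        rw [← lintegral_zero (μ := l₀)]
        refine lintegral_congr_ae (hl₀.mono fun x hx => ?_)
        refine Eq.trans (pathInt_congr (g := fun _ => 0) (t + 1) fun v hv => ?_)
          (pathInt_const _ _ _)
        rw [indicator_of_notMem]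
        exact fun h => hx (by rw [← hv]; exact h.1 0 (Fin.succ_pos i))
      have e2 : (fun v : Fin (t + 1) → ℝ =>
          (firstNonzeroSet (t + 1) i.succ).indicator f (Fin.cons 0 v)) =
          (firstNonzeroSet t i).indicator fun v => f (Fin.cons 0 v) := by
        funext v
        have : (Fin.cons 0 v : Fin (t + 2) → ℝ) ∈ firstNonzeroSet (t + 1) i.succ ↔
            v ∈ firstNonzeroSet t i := by
          simp [firstNonzeroSet, Fin.forall_fin_succ]
        by_cases hv : v ∈ firstNonzeroSet t i
        · rw [indicator_of_mem hv, indicator_of_mem (this.2 hv)]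
        · rw [indicator_of_notMem hv, indicator_of_notMem (this.not.2 hv)]
      rw [e1, zero_add, e2, ih hl₁ h₁ i (f := fun v => f (Fin.cons 0 v)) (hf.comp measurable_finCons_zero), ite_self,
        if_neg (Fin.succ_ne_zero i)]
      simp only [paddedVec_succ]

/-! ### Transfer to the punctured cube -/

/-- The embedding of `ℝ^d` into `[-∞, ∞]^d`. -/
def toCube {d : ℕ} (v : Fin d → ℝ) : Fin d → EReal := fun j => (v j : EReal)

theorem measurable_toCube {d : ℕ} : Measurable (toCube (d := d)) :=
  measurable_pi_iff.2 fun j => measurable_coe_real_ereal.comp (measurable_pi_apply j)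

theorem measurableSet_cube_ne_zero (d : ℕ) : MeasurableSet {x : Fin d → EReal | x ≠ 0} :=
  (measurableSet_singleton _).compl

/-- The restriction to `[-∞, ∞]^d \ {0}` of a measure on `ℝ^d`. -/
noncomputable def cubeMeasure {d : ℕ} (m : Measure (Fin d → ℝ)) : Measure (PuncturedCube d) :=
  (m.map toCube).comap Subtype.val

theorem map_val_cubeMeasure {d : ℕ} (m : Measure (Fin d → ℝ)) :
    (cubeMeasure m).map Subtype.val = (m.map toCube).restrict {x | x ≠ 0} := by
  have h := (MeasurableEmbedding.subtype_coe (measurableSet_cube_ne_zero d)).map_comap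
    (m.map toCube)
  rwa [Subtype.range_coe_subtype] at h

theorem setLIntegral_cubeMeasure {d : ℕ} (m : Measure (Fin d → ℝ)) {F : Set (Fin d → EReal)}
    (hF : MeasurableSet F) (hF0 : (0 : Fin d → EReal) ∉ F) {f : (Fin d → EReal) → ℝ≥0∞}
    (hf : Measurable f) :
    ∫⁻ x in Subtype.val ⁻¹' F, f x.1 ∂(cubeMeasure m) =
      ∫⁻ v, (toCube ⁻¹' F).indicator (fun v => f (toCube v)) v ∂m := by
  have hsub : F ⊆ {x | x ≠ 0} := by
    rintro x hx rfl
    exact hF0 hx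
  rw [← setLIntegral_map hF hf measurable_subtype_coe, map_val_cubeMeasure,
    Measure.restrict_restrict hF, inter_eq_left.2 hsub,
    setLIntegral_map hF hf measurable_toCube, lintegral_indicator (measurable_toCube hF)]

theorem cubeMeasure_ext {t : ℕ} {ι : Type*} [Countable ι] {F : ι → Set (PuncturedCube (t + 1))}
    (hFu : ⋃ i, F i = univ) {m₁ m₂ : Measure (PuncturedCube (t + 1))}
    (h : ∀ i, ∀ f : (Fin (t + 1) → EReal) → ℝ≥0∞, Measurable f →
      ∫⁻ x in F i, f x.1 ∂m₁ = ∫⁻ x in F i, f x.1 ∂m₂) : m₁ = m₂ := by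
  rw [← Measure.restrict_univ (μ := m₁), ← Measure.restrict_univ (μ := m₂), ← hFu,
    Measure.restrict_iUnion_congr]
  intro i
  ext B hB
  obtain ⟨B', hB', rfl⟩ := hB
  have := h i (B'.indicator 1) (measurable_one.indicator hB')
  have e : ∀ x : PuncturedCube (t + 1), B'.indicator (1 : (Fin (t + 1) → EReal) → ℝ≥0∞) x.1 =
      (Subtype.val ⁻¹' B').indicator 1 x := fun x => rfl
  simp only [e] at this
  rwa [lintegral_indicator_one (measurable_subtype_coe hB'),
    lintegral_indicator_one (measurable_subtype_coe hB')] at this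

theorem iUnion_firstNonzeroAt (t : ℕ) : ⋃ i, firstNonzeroAt t i = univ := by
  refine eq_univ_of_forall fun x => mem_iUnion.2 ?_
  have hx : ∃ i, x.1 i ≠ 0 := by
    by_contra h
    push Not at h
    exact x.2 (funext h)
  classical
  obtain ⟨i, hi⟩ := exists_minimal_of_wellFoundedLT (fun i => x.1 i ≠ 0) hx
  exact ⟨i, fun j hj => by_contra fun h => hi.not_lt h hj, hi.prop⟩

theorem iUnion_lastNonzeroAt (t : ℕ) : ⋃ i, lastNonzeroAt t i = univ := by
  refine eq_univ_of_forall fun x => mem_iUnion.2 ?_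
  have hx : ∃ i, x.1 i ≠ 0 := by
    by_contra h
    push Not at h
    exact x.2 (funext h)
  classical
  obtain ⟨i, hi⟩ := exists_maximal_of_wellFoundedGT (fun i => x.1 i ≠ 0) hx
  exact ⟨i, hi.prop, fun j hj => by_contra fun h => hi.not_gt h hj⟩

/-- The sets `F_{t,i}` cover the punctured cube, and the formulas prescribe the measure on each of
them. -/
theorem HasForwardFormulas.unique {Ω : Type*} [MeasurableSpace Ω] {P : Measure Ω} {α : ℝ}
    {M : ℤ → Ω → ℝ} {t : ℕ} {m₁ m₂ : Measure (PuncturedCube (t + 1))}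
    (h₁ : HasForwardFormulas P α M t m₁) (h₂ : HasForwardFormulas P α M t m₂) : m₁ = m₂ := by
  refine cubeMeasure_ext (iUnion_firstNonzeroAt t) fun i f hf => ?_
  rcases Fin.eq_zero_or_eq_succ i with rfl | ⟨j, rfl⟩
  · rw [(h₁ f hf).1, (h₂ f hf).1]
  · rw [(h₁ f hf).2 _ (Fin.succ_pos j), (h₂ f hf).2 _ (Fin.succ_pos j)]

theorem HasBackwardFormulas.unique {Ω : Type*} [MeasurableSpace Ω] {P : Measure Ω} {α : ℝ}
    {M : ℤ → Ω → ℝ} {t : ℕ} {m₁ m₂ : Measure (PuncturedCube (t + 1))}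
    (h₁ : HasBackwardFormulas P α M t m₁) (h₂ : HasBackwardFormulas P α M t m₂) : m₁ = m₂ := by
  refine cubeMeasure_ext (iUnion_lastNonzeroAt t) fun i f hf => ?_
  rcases eq_or_ne i (Fin.last t) with rfl | h
  · rw [(h₁ f hf).1, (h₂ f hf).1]
  · rw [(h₁ f hf).2 _ (Fin.lt_last_iff_ne_last.2 h), (h₂ f hf).2 _ (Fin.lt_last_iff_ne_last.2 h)]

theorem toCube_paddedVec {t : ℕ} (i : Fin (t + 1)) (m : ℤ → ℝ) (z : ℝ) :
    toCube (paddedVec t i (fun k : ℕ => m k) z) = forwardVec t i m z := by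
  funext j
  simp only [toCube, paddedVec, forwardVec]
  split_ifs with h
  · rfl
  · rw [Nat.cast_sub (Fin.le_def.1 (not_lt.1 h))]

theorem toCube_paddedVec_rev {t : ℕ} (i : Fin (t + 1)) (m : ℤ → ℝ) (z : ℝ) :
    toCube (paddedVec t i.rev (fun k : ℕ => m (-k)) z ∘ Fin.rev) = backwardVec t i m z := by
  funext j
  simp only [toCube, paddedVec, backwardVec, Function.comp, Fin.rev_lt_rev]
  split_ifs with h
  · rfl
  · have e : (-((j.rev - i.rev : ℕ) : ℤ)) = (j : ℤ) - i := by
      have := Fin.le_def.1 (not_lt.1 h)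
      have := i.2
      have := j.2
      simp only [Fin.val_rev]
      omega
    rw [e]

theorem toCube_preimage_firstNonzeroSet (t : ℕ) (i : Fin (t + 1)) :
    toCube ⁻¹' (firstNonzeroSet (E := EReal) t i) = firstNonzeroSet (E := ℝ) t i := by
  ext v
  simp [firstNonzeroSet, toCube]

section Formulas

variable {Ω : Type*} [MeasurableSpace Ω] {P : Measure Ω} [IsProbabilityMeasure P] {α p : ℝ}
  {μ : Measure (ℝ × ℝ)} [IsProbabilityMeasure μ] {M : ℤ → Ω → ℝ}

/-- The limit measure on path space, defined by the transition kernels of the adjoint laws `μ` and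
`μ'`. -/
noncomputable def limitMeasure (α p : ℝ) (μ μ' : Measure (ℝ × ℝ)) [IsProbabilityMeasure μ]
    [IsProbabilityMeasure μ'] (t : ℕ) : Measure (Fin (t + 1) → ℝ) :=
  chainMeasure (tailKernel μ) ((tailMeasure α p).withDensity fun x => tailKernel μ' x {0})
    (tailMeasure α p) t

theorem ae_withDensity_ne_zero (α p : ℝ) {g : ℝ → ℝ≥0∞} :
    ∀ᵐ x ∂((tailMeasure α p).withDensity g), x ≠ 0 :=
  (withDensity_absolutelyContinuous _ _).ae_le (ae_tailMeasure_ne_zero α p)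

theorem lintegral_scaled_path_singleton {μ' : Measure (ℝ × ℝ)} [IsProbabilityMeasure μ']
    (hp : p ∈ Icc (0 : ℝ) 1) (hμ' : IsTailPairLaw α p μ') {Y : ℕ → Ω → ℝ} {W : Ω → ℝ}
    (hY : ∀ k, Measurable (Y k)) (hW : Measurable W)
    (hlaw : P.map (fun ω => (Y 0 ω, W ω)) = μ')
    (hker : ∀ A : Set ℝ, MeasurableSet A →
      HasKernelTransitions (P.restrict {ω | W ω ∈ A}) (tailKernel μ) Y) (n : ℕ)
    {f : (Fin (n + 1) → ℝ) → ℝ≥0∞} (hf : Measurable f) :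
    ∫⁻ z, ∫⁻ ω, f (fun j => z * Y j ω) ∂P ∂(powMeasure α) =
      ∫⁻ x, pathInt (tailKernel μ) n f x ∂(tailMeasure α p) ∧
    ∫⁻ z, ∫⁻ ω in {ω | W ω = 0}, f (fun j => z * Y j ω) ∂P ∂(powMeasure α) =
      ∫⁻ x, pathInt (tailKernel μ) n f x
        ∂((tailMeasure α p).withDensity fun x => tailKernel μ' x {0}) := by
  constructor
  · have := lintegral_scaled_path hp hμ' hY hW hlaw MeasurableSet.univ (by simp)
      (hker univ MeasurableSet.univ) n hf
    simpa using this
  · exact lintegral_scaled_path hp hμ' hY hW hlaw (measurableSet_singleton 0)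
      (fun z hz y => by simp [hz.ne']) (hker {0} (measurableSet_singleton 0)) n hf

theorem IsBackForthTailChain.hasForwardFormulas (hp : p ∈ Icc (0 : ℝ) 1)
    (hM : IsBackForthTailChain P α p μ M) (t : ℕ) :
    haveI := hM.adjoint_law.right_mem.prob
    HasForwardFormulas P α M t
      (cubeMeasure (limitMeasure α p μ (P.map (fun ω => (M 0 ω, M (-1) ω))) t)) := by
  have := hM.adjoint_law.right_mem.prob
  intro f hf
  have hfc : Measurable fun v : Fin (t + 1) → ℝ => f (toCube v) := hf.comp measurable_toCube
  have hl := fun (n : ℕ) (f : (Fin (n + 1) → ℝ) → ℝ≥0∞) (hf : Measurable f) =>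
    lintegral_scaled_path_singleton (W := M (-1)) hp hM.adjoint_law.right_mem
      (fun n : ℕ => hM.measurable n) (hM.measurable (-1)) rfl
      (fun A hA => hM.forward_transitions hA) n hf
  have key : ∀ i : Fin (t + 1), ∫⁻ x in firstNonzeroAt t i, f x.1
      ∂(cubeMeasure (limitMeasure α p μ (P.map (fun ω => (M 0 ω, M (-1) ω))) t)) =
      ∫⁻ z, ∫⁻ ω, f (forwardVec t i (fun k => M k ω) z)
        ∂(if i = 0 then P else P.restrict {ω | M (-1) ω = 0}) ∂(powMeasure α) := by
    intro i
    have e : firstNonzeroAt t i = Subtype.val ⁻¹' (firstNonzeroSet (E := EReal) t i) := rfl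
    rw [e, setLIntegral_cubeMeasure _ (measurableSet_firstNonzeroSet t i) (fun h => h.2 rfl) hf,
      toCube_preimage_firstNonzeroSet, limitMeasure, lintegral_chainMeasure _ _ _
      (hfc.indicator (measurableSet_firstNonzeroSet t i)),
      tailInt_firstNonzeroSet (Y := fun n : ℕ => M n) (P₀ := P)
        (P₁ := P.restrict {ω | M (-1) ω = 0}) (pw := powMeasure α)
        (ae_tailMeasure_ne_zero α p) (ae_withDensity_ne_zero α p)
        (fun n f hf => (hl n f hf).1) (fun n f hf => (hl n f hf).2) t i hfc]
    exact lintegral_congr fun z => lintegral_congr fun ω => by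
      rw [← toCube_paddedVec i (fun k => M k ω) z]
  refine ⟨?_, fun i hi => ?_⟩
  · rw [key 0]; simp
  · rw [key i, if_neg hi.ne']

/-- Reversal of coordinates maps `G_{t,i}` to `F_{t,t-i}` and, by `tailInt_rev`, replaces `κ` by
`κ'`. The forward computation then applies to `n ↦ M (-n)`, with `M 1` in the role of `M (-1)`. -/
theorem IsBackForthTailChain.hasBackwardFormulas (hα : 0 < α) (hp : p ∈ Icc (0 : ℝ) 1)
    (hM : IsBackForthTailChain P α p μ M) (t : ℕ) :
    haveI := hM.adjoint_law.right_mem.prob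
    HasBackwardFormulas P α M t
      (cubeMeasure (limitMeasure α p μ (P.map (fun ω => (M 0 ω, M (-1) ω))) t)) := by
  have := hM.adjoint_law.right_mem.prob
  intro f hf
  have hfc : Measurable fun v : Fin (t + 1) → ℝ => f (toCube v) := hf.comp measurable_toCube
  have hrev : Measurable fun v : Fin (t + 1) → ℝ => v ∘ Fin.rev :=
    measurable_pi_iff.2 fun i => measurable_pi_apply _
  have hl := fun (n : ℕ) (f : (Fin (n + 1) → ℝ) → ℝ≥0∞) (hf : Measurable f) =>
    lintegral_scaled_path_singleton (W := M 1) (Y := fun n : ℕ => M (-n)) hp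
      hM.adjoint_law.left_mem
      (fun n : ℕ => hM.measurable _) (hM.measurable 1) (by simpa using hM.forward_law)
      (fun A hA => hM.backward_transitions hA) n hf
  have hd := hM.adjoint_law.areDualKernels hα hp
  have key : ∀ i : Fin (t + 1), ∫⁻ x in lastNonzeroAt t i, f x.1
      ∂(cubeMeasure (limitMeasure α p μ (P.map (fun ω => (M 0 ω, M (-1) ω))) t)) =
      ∫⁻ z, ∫⁻ ω, f (backwardVec t i (fun k => M k ω) z)
        ∂(if i.rev = 0 then P else P.restrict {ω | M 1 ω = 0}) ∂(powMeasure α) := by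
    intro i
    set G : Set (Fin (t + 1) → EReal) := {x | x i ≠ 0 ∧ ∀ j, i < j → x j = 0} with hG
    have hGF : ∀ x : Fin (t + 1) → EReal, x ∘ Fin.rev ∈ G ↔ x ∈ firstNonzeroSet t i.rev := by
      intro x
      simp only [hG, firstNonzeroSet, mem_ofPred_eq, Function.comp]
      constructor
      · rintro ⟨h1, h2⟩
        exact ⟨fun j hj => by simpa using h2 j.rev (Fin.lt_rev_iff.1 hj), h1⟩
      · rintro ⟨h1, h2⟩
        exact ⟨h2, fun j hj => h1 _ (Fin.rev_lt_rev.2 hj)⟩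
    have hGm : MeasurableSet G := by
      have hr : Measurable fun x : Fin (t + 1) → EReal => x ∘ Fin.rev :=
        measurable_pi_iff.2 fun i => measurable_pi_apply _
      have : G = (fun x : Fin (t + 1) → EReal => x ∘ Fin.rev) ⁻¹' firstNonzeroSet t i.rev := by
        ext x
        rw [mem_preimage, ← hGF]
        have : (x ∘ Fin.rev) ∘ Fin.rev = x := by funext j; simp
        rw [this]
      rw [this]
      exact hr (measurableSet_firstNonzeroSet t _)
    have e : lastNonzeroAt t i = Subtype.val ⁻¹' G := rfl
    have e2 : (fun v : Fin (t + 1) → ℝ => (toCube ⁻¹' G).indicator (fun v => f (toCube v))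
        (v ∘ Fin.rev)) = (firstNonzeroSet t i.rev).indicator fun v => f (toCube (v ∘ Fin.rev)) := by
      funext v
      have : v ∘ Fin.rev ∈ toCube ⁻¹' G ↔ v ∈ firstNonzeroSet t i.rev := by
        rw [← toCube_preimage_firstNonzeroSet]
        exact hGF (toCube v)
      by_cases hv : v ∈ firstNonzeroSet t i.rev
      · rw [indicator_of_mem hv, indicator_of_mem (this.2 hv)]
      · rw [indicator_of_notMem hv, indicator_of_notMem (this.not.2 hv)]
    rw [e, setLIntegral_cubeMeasure _ hGm (fun h => h.1 rfl) hf, limitMeasure,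
      lintegral_chainMeasure _ _ _ (hfc.indicator (measurable_toCube hGm)),
      tailInt_rev (tailKernel_zero _) (tailKernel_zero _) hd t
        (hfc.indicator (measurable_toCube hGm)), e2,
      tailInt_firstNonzeroSet (Y := fun n : ℕ => M (-n)) (P₀ := P)
        (P₁ := P.restrict {ω | M 1 ω = 0}) (pw := powMeasure α)
        (f := fun v => f (toCube (v ∘ Fin.rev)))
        (ae_tailMeasure_ne_zero α p) (ae_withDensity_ne_zero α p)
        (fun n f hf => (hl n f hf).1) (fun n f hf => (hl n f hf).2) t i.rev (hfc.comp hrev)]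
    exact lintegral_congr fun z => lintegral_congr fun ω => by
      rw [← toCube_paddedVec_rev i (fun k => M k ω) z]
  refine ⟨?_, fun i hi => ?_⟩
  · rw [key]; simp
  · rw [key i, if_neg]
    intro h
    rw [Fin.rev_eq_iff, Fin.rev_zero] at h
    exact hi.ne h

end Formulas

/-! ### Quantile representation of regularly varying tails -/

theorem ext_of_Ioi_pos {m₁ m₂ : Measure ℝ} (h₁ : m₁ (Iic 0) = 0) (h₂ : m₂ (Iic 0) = 0)
    (hfin : ∀ s : ℝ, 0 < s → m₁ (Ioi s) ≠ ∞) (h : ∀ s : ℝ, 0 < s → m₁ (Ioi s) = m₂ (Ioi s)) :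
    m₁ = m₂ := by
  have hr : ∀ m : Measure ℝ, m (Iic 0) = 0 → m = m.restrict (Ioi 0) := fun m hm => by
    conv_lhs => rw [← Measure.restrict_univ (μ := m)]
    refine Measure.restrict_congr_set ?_
    symm
    rw [ae_eq_univ, compl_Ioi]
    exact hm
  rw [hr m₁ h₁, hr m₂ h₂]
  have hU : Ioi (0 : ℝ) = ⋃ n : ℕ, Ioi ((n : ℝ) + 1)⁻¹ := by
    ext x
    simp only [mem_Ioi, mem_iUnion]
    constructor
    · intro hx
      obtain ⟨n, hn⟩ := exists_nat_gt x⁻¹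
      exact ⟨n, inv_lt_of_inv_lt₀ hx (hn.trans (by linarith))⟩
    · rintro ⟨n, hn⟩
      exact lt_trans (by positivity) hn
  rw [hU, Measure.restrict_iUnion_congr]
  intro n
  have hn : (0 : ℝ) < ((n : ℝ) + 1)⁻¹ := by positivity
  have : IsFiniteMeasure (m₁.restrict (Ioi ((n : ℝ) + 1)⁻¹)) :=
    ⟨by rw [Measure.restrict_apply_univ]; exact lt_top_iff_ne_top.2 (hfin _ hn)⟩
  refine ext_of_generate_finite (range Ioi) ?_ isPiSystem_Ioi ?_ ?_
  · rw [← borel_eq_generateFrom_Ioi, BorelSpace.measurable_eq (α := ℝ)]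
  · rintro _ ⟨a, rfl⟩
    rw [Measure.restrict_apply measurableSet_Ioi, Measure.restrict_apply measurableSet_Ioi,
      Ioi_inter_Ioi]
    exact h _ (lt_of_lt_of_le hn le_sup_right)
  · rw [Measure.restrict_apply_univ, Measure.restrict_apply_univ]
    exact h _ hn

/-- The map `w ↦ (c / w)^{1/α}` is the inverse of the limiting tail `c s^{-α}`, hence the limit of
the rescaled quantile functions below. -/
theorem map_rpow_volume {α c : ℝ} (hα : 0 < α) (hc : 0 < c) :
    (volume.restrict (Ioi (0 : ℝ))).map (fun w => (c / w) ^ α⁻¹) =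
      ENNReal.ofReal c • powMeasure α := by
  have hm : Measurable fun w : ℝ => (c / w) ^ α⁻¹ := (measurable_const.div measurable_id).pow_const _
  have hS : ∀ s : ℝ, 0 < s → (volume.restrict (Ioi (0 : ℝ))).map (fun w => (c / w) ^ α⁻¹) (Ioi s) =
      ENNReal.ofReal (c * s ^ (-α)) := by
    intro s hs
    have hsα : 0 < s ^ α := Real.rpow_pos_of_pos hs α
    rw [Measure.map_apply hm measurableSet_Ioi,
      Measure.restrict_apply (hm measurableSet_Ioi)]
    have : (fun w : ℝ => (c / w) ^ α⁻¹) ⁻¹' Ioi s ∩ Ioi 0 = Ioo 0 (c * s ^ (-α)) := by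
      ext w
      simp only [mem_inter_iff, mem_preimage, mem_Ioi, mem_Ioo]
      rw [and_comm]
      refine and_congr_right fun hw => ?_
      rw [Real.lt_rpow_inv_iff_of_pos hs.le (by positivity) hα, Real.rpow_neg hs.le,
        ← div_eq_mul_inv, lt_div_iff₀ hw, lt_div_iff₀ hsα, mul_comm]
    rw [this, Real.volume_Ioo, sub_zero]
  refine ext_of_Ioi_pos ?_ ?_ ?_ ?_
  · rw [Measure.map_apply hm measurableSet_Iic, Measure.restrict_apply (hm measurableSet_Iic)]
    convert measure_empty (μ := (volume : Measure ℝ))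
    ext w
    simp only [mem_inter_iff, mem_preimage, mem_Iic, mem_Ioi, mem_empty_iff_false, iff_false,
      not_and, not_lt]
    intro h
    by_contra hw
    have : 0 < (c / w) ^ α⁻¹ := Real.rpow_pos_of_pos (div_pos hc (not_le.1 hw)) _
    linarith
  · rw [Measure.smul_apply, powMeasure_Iic, smul_zero]
  · intro s hs
    rw [hS s hs]
    exact ENNReal.ofReal_ne_top
  · intro s hs
    rw [hS s hs, Measure.smul_apply, powMeasure_Ioi hα hs, smul_eq_mul, ENNReal.ofReal_mul hc.le]

/-- The upper tail quantile function of `Z`: `s < Q u` iff `u < P(Z > s)`, for `u > 0` and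
`s ≥ 0`. -/
noncomputable def tailQuantile {Ω : Type*} [MeasurableSpace Ω] (P : Measure Ω) (Z : Ω → ℝ)
    (u : ℝ) : ℝ :=
  open Classical in
  if 0 < u then sSup {s : ℝ | 0 ≤ s ∧ u < P.real {ω | s < Z ω}} else 0

section Quantile

variable {Ω : Type*} [MeasurableSpace Ω] {P : Measure Ω} {Z : Ω → ℝ}

theorem tailQuantile_nonneg (u : ℝ) : 0 ≤ tailQuantile P Z u := by
  unfold tailQuantile
  split_ifs
  · exact Real.sSup_nonneg fun s hs => hs.1
  · exact le_rfl

variable [IsProbabilityMeasure P]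

theorem real_tail_eq (hZ : Measurable Z) (s : ℝ) :
    P.real {ω | s < Z ω} = 1 - cdf (P.map Z) s := by
  have := Measure.isProbabilityMeasure_map (μ := P) hZ.aemeasurable
  have e : {ω | s < Z ω} = Z ⁻¹' (Iic s)ᶜ := by ext ω; simp
  rw [cdf_eq_real, ← probReal_compl_eq_one_sub measurableSet_Iic, e,
    map_measureReal_apply hZ measurableSet_Iic.compl]

theorem lt_tailQuantile_iff (hZ : Measurable Z) {u s : ℝ} (hu : 0 < u) (hs : 0 ≤ s) :
    s < tailQuantile P Z u ↔ u < P.real {ω | s < Z ω} := by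
  have := Measure.isProbabilityMeasure_map (μ := P) hZ.aemeasurable
  have hanti : ∀ a b : ℝ, a ≤ b → P.real {ω | b < Z ω} ≤ P.real {ω | a < Z ω} := fun a b hab =>
    measureReal_mono fun ω hω => lt_of_le_of_lt hab hω
  have hbdd : BddAbove {s : ℝ | 0 ≤ s ∧ u < P.real {ω | s < Z ω}} := by
    have ht : Tendsto (fun s => P.real {ω | s < Z ω}) atTop (𝓝 (1 - 1)) := by
      simp only [real_tail_eq hZ]
      exact tendsto_const_nhds.sub (tendsto_cdf_atTop _)
    rw [sub_self] at ht
    obtain ⟨b, hb⟩ := ((tendsto_order.1 ht).2 u hu).exists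
    refine ⟨b, fun s hs => ?_⟩
    by_contra h
    exact lt_asymm hs.2 (lt_of_le_of_lt (hanti _ _ (not_le.1 h).le) hb)
  rw [tailQuantile, if_pos hu]
  constructor
  · intro h
    have hne : {s : ℝ | 0 ≤ s ∧ u < P.real {ω | s < Z ω}}.Nonempty := by
      by_contra hne
      rw [not_nonempty_iff_eq_empty.1 hne, Real.sSup_empty] at h
      linarith
    obtain ⟨s', hs', hlt⟩ := exists_lt_of_lt_csSup hne h
    exact lt_of_lt_of_le hs'.2 (hanti _ _ hlt.le)
  · intro h
    -- Right continuity of the tail gives a point beyond `s` still in the set, so the supremum is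
    -- strictly larger than `s`.
    have hrc : ContinuousWithinAt (fun s => P.real {ω | s < Z ω}) (Ioi s) s := by
      simp only [real_tail_eq hZ]
      exact continuousWithinAt_const.sub
        (((cdf (P.map Z)).right_continuous s).mono Ioi_subset_Ici_self)
    have hev := (tendsto_order.1 hrc.tendsto).1 u h
    obtain ⟨s', hs', hss'⟩ := (hev.and self_mem_nhdsWithin).exists
    exact lt_of_lt_of_le hss' (le_csSup hbdd ⟨hs.trans (le_of_lt hss'), hs'⟩)

theorem tailQuantile_preimage_Ioi (hZ : Measurable Z) {s : ℝ} (hs : 0 ≤ s) :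
    tailQuantile P Z ⁻¹' Ioi s = Ioo 0 (P.real {ω | s < Z ω}) := by
  ext u
  simp only [mem_preimage, mem_Ioi, mem_Ioo]
  by_cases hu : 0 < u
  · rw [lt_tailQuantile_iff hZ hu hs]; tauto
  · have : tailQuantile P Z u = 0 := by rw [tailQuantile, if_neg hu]
    rw [this]
    constructor
    · intro h; linarith
    · intro h; exact absurd h.1 hu

theorem measurable_tailQuantile (hZ : Measurable Z) : Measurable (tailQuantile P Z) := by
  refine measurable_of_Ioi fun s => ?_
  rcases le_or_gt 0 s with hs | hs
  · rw [tailQuantile_preimage_Ioi hZ hs]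
    exact measurableSet_Ioo
  · convert MeasurableSet.univ
    exact eq_univ_of_forall fun u => lt_of_lt_of_le hs (tailQuantile_nonneg u)

/-- The laws agree only on `(0, ∞)`: the quantile function sends a set of infinite Lebesgue measure
to `0`. Integrands therefore have to vanish on `(-∞, 0]`. -/
theorem map_tailQuantile (hZ : Measurable Z) :
    (volume.map (tailQuantile P Z)).restrict (Ioi 0) = (P.map Z).restrict (Ioi 0) := by
  have hQ := measurable_tailQuantile (P := P) hZ
  have h0 : ∀ m : Measure ℝ, m.restrict (Ioi (0 : ℝ)) (Iic 0) = 0 := fun m => by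
    rw [Measure.restrict_apply measurableSet_Iic, Iic_inter_Ioi]; simp
  have h1 : ∀ m : Measure ℝ, ∀ s : ℝ, 0 < s → m.restrict (Ioi (0 : ℝ)) (Ioi s) = m (Ioi s) :=
    fun m s hs => by
      rw [Measure.restrict_apply measurableSet_Ioi, inter_eq_left.2 (Ioi_subset_Ioi hs.le)]
  have h2 : ∀ s : ℝ, 0 < s → volume.map (tailQuantile P Z) (Ioi s) = P.map Z (Ioi s) := by
    intro s hs
    rw [Measure.map_apply hQ measurableSet_Ioi, tailQuantile_preimage_Ioi hZ hs.le,
      Real.volume_Ioo, sub_zero, ofReal_measureReal, Measure.map_apply hZ measurableSet_Ioi]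
    rfl
  refine ext_of_Ioi_pos (h0 _) (h0 _) (fun s hs => ?_) (fun s hs => ?_)
  · have := Measure.isProbabilityMeasure_map (μ := P) hZ.aemeasurable
    rw [h1 _ s hs, h2 s hs]
    exact measure_ne_top _ _
  · rw [h1 _ s hs, h1 _ s hs, h2 s hs]

theorem integral_eq_integral_tailQuantile (hZ : Measurable Z) {k : ℝ → ℝ} (hk : Measurable k)
    (hk0 : ∀ z ≤ 0, k z = 0) : ∫ ω, k (Z ω) ∂P = ∫ u, k (tailQuantile P Z u) := by
  have hs : Function.support k ⊆ Ioi 0 := fun z hz => by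
    by_contra h
    exact hz (hk0 z (not_lt.1 h))
  rw [← integral_map hZ.aemeasurable hk.aestronglyMeasurable,
    ← integral_map (measurable_tailQuantile hZ).aemeasurable hk.aestronglyMeasurable,
    ← setIntegral_eq_integral_of_forall_compl_eq_zero (s := Ioi 0)
      (fun x hx => hk0 x (not_lt.1 hx)), ← map_tailQuantile hZ,
    setIntegral_eq_integral_of_forall_compl_eq_zero (s := Ioi 0)
      (fun x hx => hk0 x (not_lt.1 hx))]

variable {α c : ℝ} {T : ℝ → ℝ}

/-- Inverts the tail asymptotics through the equivalence `s < Q u ↔ u < P(Z > s)`, comparing with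
levels `x * a'` and `x * b'` slightly inside the required bounds. -/
theorem tendsto_tailQuantile (hZ : Measurable Z) (hα : 0 < α) (hc : 0 ≤ c)
    (hT : ∀ x, 0 < T x)
    (htail : ∀ y : ℝ, 0 < y →
      Tendsto (fun x => P.real {ω | x * y < Z ω} / T x) atTop (𝓝 (c * y ^ (-α))))
    {w : ℝ} (hw : 0 < w) :
    Tendsto (fun x => tailQuantile P Z (T x * w) / x) atTop (𝓝 ((c / w) ^ α⁻¹)) := by
  have hℓ : 0 ≤ (c / w) ^ α⁻¹ := by positivity
  refine tendsto_order.2 ⟨fun a ha => ?_, fun b hb => ?_⟩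
  · rcases lt_or_ge a 0 with ha0 | ha0
    · filter_upwards [eventually_gt_atTop 0] with x hx
      exact lt_of_lt_of_le ha0 (div_nonneg (tailQuantile_nonneg _) hx.le)
    · obtain ⟨a', haa', ha'⟩ := exists_between ha
      have ha'0 : 0 < a' := ha0.trans_lt haa'
      have h1 : w < c * a' ^ (-α) := by
        rw [Real.lt_rpow_inv_iff_of_pos ha'0.le (by positivity) hα, lt_div_iff₀ hw] at ha'
        rw [Real.rpow_neg ha'0.le, ← div_eq_mul_inv, lt_div_iff₀ (by positivity), mul_comm]
        exact ha'
      filter_upwards [(tendsto_order.1 (htail a' ha'0)).1 w h1, eventually_gt_atTop 0] with x h2 hx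
      rw [lt_div_iff₀ hx]
      refine lt_trans (b := x * a') (by rw [mul_comm]; gcongr) ?_
      rw [lt_tailQuantile_iff hZ (mul_pos (hT x) hw) (by positivity)]
      rwa [lt_div_iff₀ (hT x), mul_comm] at h2
  · obtain ⟨b', hb', hbb'⟩ := exists_between hb
    have hb'0 : 0 < b' := hℓ.trans_lt hb'
    have h1 : c * b' ^ (-α) < w := by
      rw [Real.rpow_inv_lt_iff_of_pos (by positivity) hb'0.le hα, div_lt_iff₀ hw] at hb'
      rw [Real.rpow_neg hb'0.le, ← div_eq_mul_inv, div_lt_iff₀ (by positivity), mul_comm]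
      exact hb'
    filter_upwards [(tendsto_order.1 (htail b' hb'0)).2 w h1, eventually_gt_atTop 0] with x h2 hx
    rw [div_lt_iff₀ hx]
    refine lt_of_le_of_lt (b := x * b') ?_ (by rw [mul_comm]; gcongr)
    rw [← not_lt, lt_tailQuantile_iff hZ (mul_pos (hT x) hw) (by positivity), not_lt]
    rw [div_lt_iff₀ (hT x), mul_comm w] at h2
    exact h2.le

/-- The substitutions `Z = Q(u)` and `u = T x * w` absorb the normalisation `T x` and replace
convergence of measures by pointwise convergence in `w`. The integrands `K x` may depend on `x`,
provided that they converge along convergent arguments. -/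
theorem tendsto_integral_tail (hZ : Measurable Z) (hα : 0 < α) (hc : 0 ≤ c)
    (hT : ∀ x, 0 < T x)
    (htail : ∀ y : ℝ, 0 < y →
      Tendsto (fun x => P.real {ω | x * y < Z ω} / T x) atTop (𝓝 (c * y ^ (-α))))
    {K : ℝ → ℝ → ℝ} {k : ℝ → ℝ} {C δ : ℝ} (hδ : 0 < δ) (hK : ∀ x, Measurable (K x))
    (hk : Measurable k) (hC : ∀ x z, |K x z| ≤ C) (hK0 : ∀ x, ∀ z ≤ δ, K x z = 0)
    (hconv : 0 < c → ∀ z > 0, ∀ ζ : ℝ → ℝ, Tendsto ζ atTop (𝓝 z) →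
      Tendsto (fun x => K x (ζ x)) atTop (𝓝 (k z))) :
    Tendsto (fun x => (∫ ω, K x (Z ω / x) ∂P) / T x) atTop
      (𝓝 (c * ∫ z, k z ∂(powMeasure α))) := by
  set Q := tailQuantile P Z with hQ
  have hQm : Measurable Q := measurable_tailQuantile hZ
  have hC0 : 0 ≤ C := (abs_nonneg _).trans (hC 0 0)
  have hQ0 : ∀ x, 0 < x → ∀ w ≤ 0, K x (Q (T x * w) / x) = 0 := by
    intro x hx w hw
    have : Q (T x * w) = 0 := by
      rw [hQ, tailQuantile, if_neg]
      exact not_lt.2 (mul_nonpos_of_nonneg_of_nonpos (hT x).le hw)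
    rw [this, zero_div]
    exact hK0 x 0 hδ.le
  have e1 : ∀ x, 0 < x → (∫ ω, K x (Z ω / x) ∂P) / T x =
      ∫ w in Ioi 0, K x (Q (T x * w) / x) := by
    intro x hx
    have hkm : Measurable fun z => K x (z / x) := (hK x).comp (measurable_id.div_const x)
    rw [integral_eq_integral_tailQuantile hZ hkm fun z hz =>
      hK0 x _ ((div_nonpos_of_nonpos_of_nonneg hz hx.le).trans hδ.le),
      setIntegral_eq_integral_of_forall_compl_eq_zero (s := Ioi 0) fun w hw => hQ0 x hx w (not_lt.1 hw),
      Measure.integral_comp_mul_left (fun u => K x (Q u / x)) (T x), abs_of_pos (inv_pos.2 (hT x)),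
      smul_eq_mul, div_eq_inv_mul]
  set F : ℝ → ℝ := fun w => if 0 < c then k ((c / w) ^ α⁻¹) else 0 with hF
  have e2 : ∫ w in Ioi 0, F w = c * ∫ z, k z ∂(powMeasure α) := by
    rcases hc.eq_or_lt with hc' | hc'
    · simp [hF, ← hc']
    · simp only [hF, if_pos hc']
      have hm : Measurable fun w : ℝ => (c / w) ^ α⁻¹ :=
        (measurable_const.div measurable_id).pow_const _
      rw [← integral_map (μ := volume.restrict (Ioi (0 : ℝ))) (f := k) hm.aemeasurable
        hk.aestronglyMeasurable, map_rpow_volume hα hc', integral_smul_measure,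
        ENNReal.toReal_ofReal hc, smul_eq_mul]
  rw [← e2]
  refine Tendsto.congr' (f₁ := fun x => ∫ w in Ioi 0, K x (Q (T x * w) / x))
    ((eventually_gt_atTop 0).mono fun x hx => (e1 x hx).symm) ?_
  -- For `w ≥ c δ^{-α} + 1` and `x` large, the rescaled quantile is at most `δ`, where `K x`
  -- vanishes; this bounds the support in `w`.
  refine tendsto_integral_filter_of_dominated_convergence
    (fun w => (Iio (c * δ ^ (-α) + 1)).indicator (fun _ => C) w) ?_ ?_ ?_ ?_
  · refine Eventually.of_forall fun x => Measurable.aestronglyMeasurable ?_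
    exact (hK x).comp ((hQm.comp (measurable_const_mul _)).div_const x)
  · filter_upwards [(tendsto_order.1 (htail δ hδ)).2 _ (lt_add_one _), eventually_gt_atTop 0]
      with x hx hx0
    refine (ae_restrict_mem measurableSet_Ioi).mono fun w hw => ?_
    have hw' : 0 < w := hw
    by_cases hwm : w < c * δ ^ (-α) + 1
    · rw [indicator_of_mem (by exact hwm)]
      exact hC _ _
    · rw [indicator_of_notMem (by exact hwm), hK0, norm_zero]
      rw [div_le_iff₀ hx0, ← not_lt, lt_tailQuantile_iff hZ (mul_pos (hT x) hw') (by positivity),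
        not_lt, mul_comm δ]
      rw [div_lt_iff₀ (hT x)] at hx
      refine hx.le.trans ?_
      rw [mul_comm]
      exact mul_le_mul_of_nonneg_left (not_lt.1 hwm) (hT x).le
  · refine (integrable_indicator_iff measurableSet_Iio).2 (integrableOn_const ?_)
    rw [Measure.restrict_apply measurableSet_Iio, inter_comm, Ioi_inter_Iio]
    exact measure_Ioo_lt_top.ne
  · refine (ae_restrict_mem measurableSet_Ioi).mono fun w hw => ?_
    have hw' : 0 < w := hw
    have hlim := tendsto_tailQuantile hZ hα hc hT htail hw'
    rcases hc.eq_or_lt with hc' | hc'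
    -- For `c = 0` nothing is known about convergence of `K`, but the rescaled quantile tends to `0`
    -- and finally falls below `δ`.
    · rw [← hc', zero_div, Real.zero_rpow (inv_pos.2 hα).ne'] at hlim
      simp only [hF, ← hc', lt_irrefl, if_false]
      refine tendsto_const_nhds.congr' ?_
      filter_upwards [(tendsto_order.1 hlim).2 δ hδ] with x hx
      exact (hK0 x _ hx.le).symm
    · simp only [hF, if_pos hc']
      exact hconv hc' _ (by positivity) _ hlim

end Quantile

/-! ### Consequences for two-sided tails -/

theorem HasRegVaryingTails.real_tail_pos {Ω : Type*} [MeasurableSpace Ω] {P : Measure Ω}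
    [IsProbabilityMeasure P] {ξ : Ω → ℝ} {α p : ℝ} (h : HasRegVaryingTails P ξ α p) (x : ℝ) :
    0 < P.real {ω | x < |ξ ω|} := by
  have h1 := h.tendsto_abs 1 one_pos
  rw [Real.one_rpow] at h1
  -- A quotient with zero denominator is `0`, so a limit equal to `1` forces the tail to be positive
  -- at arbitrarily high levels.
  have h2 := (h1.eventually_ne one_ne_zero).and (eventually_ge_atTop x)
  obtain ⟨y, hy, hxy⟩ := h2.exists
  have hy' : P.real {ω | y < |ξ ω|} ≠ 0 := fun h0 => hy (by rw [h0, div_zero])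
  exact (lt_of_le_of_ne measureReal_nonneg hy'.symm).trans_le
    (measureReal_mono fun ω hω => lt_of_le_of_lt hxy hω)

theorem HasRegVaryingTails.tendsto_signed {Ω : Type*} [MeasurableSpace Ω] {P : Measure Ω}
    [IsProbabilityMeasure P] {ξ : Ω → ℝ} (hξ : Measurable ξ) {α p : ℝ}
    (h : HasRegVaryingTails P ξ α p) {σ : ℝ} (hσ : σ = 1 ∨ σ = -1) :
    Tendsto (fun x => P.real {ω | x < σ * ξ ω} / P.real {ω | x < |ξ ω|}) atTop
      (𝓝 (signWeight p σ)) := by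
  rcases hσ with rfl | rfl
  · simpa [signWeight] using h.tendsto_pos
  · have hw : signWeight p (-1) = 1 - p := by rw [signWeight, if_neg (by norm_num)]
    rw [hw]
    refine (tendsto_const_nhds.sub h.tendsto_pos).congr' ?_
    filter_upwards [eventually_ge_atTop 0] with x hx
    have e : {ω | x < |ξ ω|} = {ω | x < ξ ω} ∪ {ω | x < -1 * ξ ω} := by
      ext ω; simp [lt_abs]
    have hd : Disjoint {ω | x < ξ ω} {ω | x < -1 * ξ ω} := by
      rw [Set.disjoint_left]
      intro ω h1 h2
      have h1' : x < ξ ω := h1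
      have h2' : x < -1 * ξ ω := h2
      linarith
    have h3 : P.real {ω | x < |ξ ω|} = P.real {ω | x < ξ ω} + P.real {ω | x < -1 * ξ ω} := by
      rw [e, measureReal_union hd (measurableSet_lt measurable_const (hξ.const_mul _))]
    have h4 := h.real_tail_pos x
    rw [eq_div_iff h4.ne', sub_mul, div_mul_cancel₀ _ h4.ne']
    linarith

theorem HasRegVaryingTails.tendsto_signed_mul {Ω : Type*} [MeasurableSpace Ω] {P : Measure Ω}
    [IsProbabilityMeasure P] {ξ : Ω → ℝ} (hξ : Measurable ξ) {α p : ℝ}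
    (h : HasRegVaryingTails P ξ α p) {σ : ℝ} (hσ : σ = 1 ∨ σ = -1) {y : ℝ} (hy : 0 < y) :
    Tendsto (fun x => P.real {ω | x * y < σ * ξ ω} / P.real {ω | x < |ξ ω|}) atTop
      (𝓝 (signWeight p σ * y ^ (-α))) := by
  refine (((h.tendsto_signed hξ hσ).comp (tendsto_id.atTop_mul_const hy)).mul
    (h.tendsto_abs y hy)).congr fun x => ?_
  simp only [Function.comp, id]
  exact div_mul_div_cancel₀ (h.real_tail_pos _).ne'

theorem signWeight_nonneg {p : ℝ} (hp : p ∈ Icc (0 : ℝ) 1) (σ : ℝ) : 0 ≤ signWeight p σ := by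
  unfold signWeight
  split_ifs
  · exact hp.1
  · linarith [hp.2]

theorem powMeasure_Ioi_lt_top {α δ : ℝ} (hα : 0 < α) (hδ : 0 < δ) : powMeasure α (Ioi δ) < ∞ := by
  rw [powMeasure_Ioi hα hδ]; exact ENNReal.ofReal_lt_top

theorem integrable_powMeasure {α δ C : ℝ} (hα : 0 < α) (hδ : 0 < δ) {k : ℝ → ℝ}
    (hk : Measurable k) (hC : ∀ z, |k z| ≤ C) (hk0 : ∀ z, |z| ≤ δ → k z = 0) :
    Integrable k (powMeasure α) := by
  have h1 : Integrable ((Ioi δ).indicator fun _ => C) (powMeasure α) :=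
    (integrable_indicator_iff measurableSet_Ioi).2
      (integrableOn_const (powMeasure_Ioi_lt_top hα hδ).ne)
  refine h1.mono' hk.aestronglyMeasurable ((ae_powMeasure_pos α).mono fun z hz => ?_)
  by_cases h : δ < z
  · rw [indicator_of_mem (by exact h)]
    exact hC z
  · rw [indicator_of_notMem (by exact h), hk0 z (by rw [abs_of_pos hz]; exact not_lt.1 h), norm_zero]

/-- The one-sided result is applied to `ξ` and `-ξ`. Convergence of `K` is asked only on half-lines
of positive weight, since `Ψ` is uncontrolled on the others. -/
theorem HasRegVaryingTails.tendsto_integral {Ω : Type*} [MeasurableSpace Ω] {P : Measure Ω}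
    [IsProbabilityMeasure P] {ξ : Ω → ℝ} (hξ : Measurable ξ) {α p : ℝ}
    (h : HasRegVaryingTails P ξ α p) {K : ℝ → ℝ → ℝ} {k : ℝ → ℝ} {C δ : ℝ} (hδ : 0 < δ)
    (hK : ∀ x, Measurable (K x)) (hk : Measurable k) (hC : ∀ x z, |K x z| ≤ C)
    (hK0 : ∀ x z, |z| ≤ δ → K x z = 0) (hkC : ∀ z, |k z| ≤ C) (hk0 : ∀ z, |z| ≤ δ → k z = 0)
    (hconv : ∀ σ : ℝ, σ = 1 ∨ σ = -1 → 0 < signWeight p σ → ∀ z > 0, ∀ ζ : ℝ → ℝ,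
      Tendsto ζ atTop (𝓝 (σ * z)) → Tendsto (fun x => K x (ζ x)) atTop (𝓝 (k (σ * z)))) :
    Tendsto (fun x => (∫ ω, K x (x⁻¹ * ξ ω) ∂P) / P.real {ω | x < |ξ ω|}) atTop
      (𝓝 (∫ z, k z ∂(tailMeasure α p))) := by
  have hα := h.index_pos
  have hp := h.weight_mem
  set T : ℝ → ℝ := fun x => P.real {ω | x < |ξ ω|} with hTdef
  have hC0 : 0 ≤ C := (abs_nonneg _).trans (hkC 0)
  have side : ∀ σ : ℝ, σ = 1 ∨ σ = -1 →
      Tendsto (fun x => (∫ ω, (Ioi 0).indicator (fun z => K x (σ * z)) (σ * ξ ω / x) ∂P) / T x) atTop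
        (𝓝 (signWeight p σ * ∫ z, k (σ * z) ∂(powMeasure α))) := by
    intro σ hσ
    have hσ1 : |σ| = 1 := by rcases hσ with rfl | rfl <;> simp
    have hσ2 : σ * σ = 1 := by rcases hσ with rfl | rfl <;> simp
    refine tendsto_integral_tail (hξ.const_mul σ) hα (signWeight_nonneg hp σ)
      (fun x => h.real_tail_pos x) (fun y hy => h.tendsto_signed_mul hξ hσ hy) hδ
      (C := C) (K := fun x => (Ioi 0).indicator fun z => K x (σ * z))
      (fun x => ((hK x).comp (measurable_const_mul σ)).indicator measurableSet_Ioi)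
      (hk.comp (measurable_const_mul σ)) ?_ ?_ ?_
    · intro x z
      by_cases hz : z ∈ Ioi (0 : ℝ)
      · rw [indicator_of_mem hz]; exact hC _ _
      · rw [indicator_of_notMem hz, abs_zero]; exact hC0
    · intro x z hz
      by_cases hz' : z ∈ Ioi (0 : ℝ)
      · rw [indicator_of_mem hz', hK0]
        rwa [abs_mul, hσ1, one_mul, abs_of_pos hz']
      · rw [indicator_of_notMem hz']
    · intro hpos z hz ζ hζ
      refine (hconv σ hσ hpos z hz _ (hζ.const_mul σ)).congr' ?_
      filter_upwards [(tendsto_order.1 hζ).1 0 hz] with x hx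
      rw [indicator_of_mem (by exact hx)]
  have hint : ∀ x, 0 < x → ∀ σ : ℝ, Integrable (fun ω =>
      (Ioi 0).indicator (fun z => K x (σ * z)) (σ * ξ ω / x)) P := by
    intro x hx σ
    refine Integrable.of_bound (C := C) (Measurable.aestronglyMeasurable ?_)
      (Eventually.of_forall fun ω => ?_)
    · exact (((hK x).comp (measurable_const_mul σ)).indicator measurableSet_Ioi).comp
        ((hξ.const_mul σ).div_const x)
    · by_cases hz : σ * ξ ω / x ∈ Ioi (0 : ℝ)
      · rw [indicator_of_mem hz]; exact hC _ _
      · rw [indicator_of_notMem hz, norm_zero]; exact hC0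
  have hsum := (side 1 (Or.inl rfl)).add (side (-1) (Or.inr rfl))
  have elim : ∫ z, k z ∂(tailMeasure α p) =
      signWeight p 1 * ∫ z, k (1 * z) ∂(powMeasure α) +
        signWeight p (-1) * ∫ z, k (-1 * z) ∂(powMeasure α) := by
    have hi := integrable_powMeasure hα hδ hk hkC hk0
    have hi' := integrable_powMeasure hα hδ (hk.comp measurable_neg) (fun z => hkC (-z))
      (fun z hz => hk0 (-z) (by rwa [abs_neg]))
    have hi'' : Integrable k ((powMeasure α).map Neg.neg) :=
      (integrable_map_measure hk.aestronglyMeasurable measurable_neg.aemeasurable).2 hi'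
    rw [tailMeasure, integral_add_measure (hi.smul_measure ENNReal.ofReal_ne_top)
      (hi''.smul_measure ENNReal.ofReal_ne_top), integral_smul_measure, integral_smul_measure,
      integral_map measurable_neg.aemeasurable hk.aestronglyMeasurable,
      ENNReal.toReal_ofReal hp.1, ENNReal.toReal_ofReal (by linarith [hp.2])]
    have hw : signWeight p (-1) = 1 - p := by rw [signWeight, if_neg (by norm_num)]
    rw [hw, signWeight, if_pos rfl]
    simp
  rw [elim]
  refine hsum.congr' ?_
  filter_upwards [eventually_gt_atTop 0] with x hx
  rw [← add_div, ← integral_add (hint x hx 1) (hint x hx (-1))]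
  congr 1
  refine integral_congr_ae (Eventually.of_forall fun ω => ?_)
  simp only [indicator, mem_Ioi, one_mul, neg_mul]
  rw [inv_mul_eq_div, neg_div, neg_neg]
  rcases lt_trichotomy (ξ ω / x) 0 with h1 | h1 | h1
  · rw [if_neg h1.not_gt, if_pos (by linarith), zero_add]
  · rw [h1, if_neg (lt_irrefl 0), if_neg (by simp), hK0 x 0 (by simpa using hδ.le), zero_add]
  · rw [if_pos h1, if_neg (by linarith), add_zero]

/-! ### Recursions driven by independent innovations -/

/-- The `k`-th state of the recursion `x ↦ Ψ x (e k)` started at `x`. -/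
def recFlow {S : Type*} (Ψ : ℝ → S → ℝ) : ℕ → ℝ → (ℕ → S) → ℝ
  | 0, x, _ => x
  | k + 1, x, e => Ψ (recFlow Ψ k x e) (e k)

section RecFlow

variable {S : Type*} {Ψ : ℝ → S → ℝ}

theorem recFlow_congr {k : ℕ} {x : ℝ} {e e' : ℕ → S} (h : ∀ i < k, e i = e' i) :
    recFlow Ψ k x e = recFlow Ψ k x e' := by
  induction k with
  | zero => rfl
  | succ k ih =>
    simp only [recFlow]
    rw [ih fun i hi => h i (hi.trans (Nat.lt_succ_self k)), h k (Nat.lt_succ_self k)]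
variable [MeasurableSpace S]

theorem measurable_recFlow (hΨ : Measurable (Function.uncurry Ψ)) (k : ℕ) :
    Measurable fun q : ℝ × (ℕ → S) => recFlow Ψ k q.1 q.2 := by
  induction k with
  | zero => exact measurable_fst
  | succ k ih => exact hΨ.comp (ih.prodMk ((measurable_pi_apply k).comp measurable_snd))

theorem measurable_recFlow_vec (hΨ : Measurable (Function.uncurry Ψ)) (n : ℕ) :
    Measurable fun q : ℝ × (ℕ → S) => (fun j : Fin (n + 1) => recFlow Ψ j q.1 q.2) :=
  measurable_pi_iff.2 fun j => measurable_recFlow hΨ j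

theorem lintegral_of_indepFun {Ω A B : Type*} [MeasurableSpace Ω] [MeasurableSpace A]
    [MeasurableSpace B] {P : Measure Ω} [IsProbabilityMeasure P] {U : Ω → A} {V : Ω → B}
    (hU : Measurable U) (hV : Measurable V) (hind : IndepFun U V P) {h : A × B → ℝ≥0∞}
    (hh : Measurable h) :
    ∫⁻ ω, h (U ω, V ω) ∂P = ∫⁻ ω, ∫⁻ v, h (U ω, v) ∂(P.map V) ∂P := by
  have := Measure.isProbabilityMeasure_map (μ := P) hV.aemeasurable
  rw [← lintegral_map hh (hU.prodMk hV),
    (indepFun_iff_map_prod_eq_prod_map_map hU.aemeasurable hV.aemeasurable).1 hind,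
    lintegral_prod _ hh.aemeasurable, lintegral_map hh.lintegral_prod_right' hU]

theorem integral_of_indepFun {Ω A B : Type*} [MeasurableSpace Ω] [MeasurableSpace A]
    [MeasurableSpace B] {P : Measure Ω} [IsProbabilityMeasure P] {U : Ω → A} {V : Ω → B}
    (hU : Measurable U) (hV : Measurable V) (hind : IndepFun U V P) {h : A × B → ℝ}
    (hh : Measurable h) {C : ℝ} (hC : ∀ q, |h q| ≤ C) :
    ∫ ω, h (U ω, V ω) ∂P = ∫ ω, ∫ ω', h (U ω, V ω') ∂P ∂P := by
  have := Measure.isProbabilityMeasure_map (μ := P) hV.aemeasurable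
  have := Measure.isProbabilityMeasure_map (μ := P) hU.aemeasurable
  have hi : Integrable h ((P.map U).prod (P.map V)) :=
    Integrable.of_bound hh.aestronglyMeasurable C (Eventually.of_forall hC)
  rw [← integral_map (hU.prodMk hV).aemeasurable hh.aestronglyMeasurable,
    (indepFun_iff_map_prod_eq_prod_map_map hU.aemeasurable hV.aemeasurable).1 hind,
    integral_prod _ hi, integral_map hU.aemeasurable
      hh.stronglyMeasurable.integral_prod_right'.aestronglyMeasurable]
  refine integral_congr_ae (Eventually.of_forall fun ω => ?_)
  exact integral_map hV.aemeasurable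
    (hh.comp (measurable_const.prodMk measurable_id)).aestronglyMeasurable

variable {Ω : Type*} [MeasurableSpace Ω] {P : Measure Ω} [IsProbabilityMeasure P] {ε : ℕ → Ω → S}

/-- The states up to time `n` of a recursion driven by independent innovations, started at an
independent random point, are independent of the `n`-th innovation. -/
theorem hasKernelTransitions_recFlow (hΨ : Measurable (Function.uncurry Ψ))
    (hε : ∀ n, Measurable (ε n)) (hind : iIndepFun ε P)
    (hid : ∀ n, P.map (ε n) = P.map (ε 0)) {κ : Kernel ℝ ℝ}
    (hκ : ∀ x, κ x = (P.map (ε 0)).map (Ψ x)) (x : ℝ) :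
    HasKernelTransitions P κ (fun k ω => recFlow Ψ k x (fun i => ε i ω)) := by
  intro n f hf
  have hne : Nonempty S := by
    obtain ⟨ω⟩ : Nonempty Ω := nonempty_of_isProbabilityMeasure P
    exact ⟨ε 0 ω⟩
  obtain ⟨s₀⟩ := hne
  -- The first `n` innovations, padded by an arbitrary constant. The states up to time `n` read no
  -- others, so they are functions of a family independent of `ε n`.
  set ext : (Finset.range n → S) → ℕ → S := fun r i =>
    if h : i ∈ Finset.range n then r ⟨i, h⟩ else s₀ with hext
  have hextm : Measurable ext := by
    refine measurable_pi_iff.2 fun i => ?_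
    by_cases h : i ∈ Finset.range n
    · simp only [hext, dif_pos h]
      exact measurable_pi_apply _
    · simp only [hext, dif_neg h]
      exact measurable_const
  set U : Ω → (Fin (n + 1) → ℝ) := fun ω j => recFlow Ψ j x (fun i => ε i ω) with hU
  have hUe : U = (fun r (j : Fin (n + 1)) => recFlow Ψ j x (ext r)) ∘
      (fun ω (i : Finset.range n) => ε i ω) := by
    funext ω j
    refine recFlow_congr fun i hi => ?_
    have : i ∈ Finset.range n := Finset.mem_range.2 (hi.trans_le (Nat.lt_succ_iff.1 j.2))
    simp only [hext, dif_pos this]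
  have hgm : Measurable fun (r : Finset.range n → S) (j : Fin (n + 1)) => recFlow Ψ j x (ext r) :=
    (measurable_recFlow_vec hΨ n).comp (measurable_const.prodMk hextm)
  have hUm : Measurable U := by
    rw [hUe]
    exact hgm.comp (measurable_pi_iff.2 fun i => hε i)
  have hUV : IndepFun U (ε n) P := by
    have h1 := hind.indepFun_finset (Finset.range n) {n} (by simp) hε
    have h2 := h1.comp hgm (measurable_pi_apply (⟨n, by simp⟩ : ({n} : Finset ℕ)))
    rw [hUe]
    exact h2
  have hΨ' : Measurable fun q : (Fin (n + 1) → ℝ) × S => Ψ (q.1 (Fin.last n)) q.2 := by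
    have hq : Measurable fun q : (Fin (n + 1) → ℝ) × S => (q.1 (Fin.last n), q.2) :=
      ((measurable_pi_apply (Fin.last n)).comp measurable_fst).prodMk measurable_snd
    exact hΨ.comp hq
  have hh : Measurable fun q : (Fin (n + 1) → ℝ) × S =>
      f (Fin.snoc q.1 (Ψ (q.1 (Fin.last n)) q.2)) :=
    (hf.comp measurable_finSnoc).comp (measurable_fst.prodMk hΨ')
  have key := lintegral_of_indepFun hUm (hε n) hUV hh
  refine key.trans (lintegral_congr fun ω => ?_)
  have hΨx : ∀ y, Measurable (Ψ y) := fun y => hΨ.comp (measurable_const.prodMk measurable_id)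
  have hfs : Measurable fun y => f (Fin.snoc (U ω) y) :=
    (hf.comp measurable_finSnoc).comp (measurable_const.prodMk measurable_id)
  rw [hκ, lintegral_map hfs (hΨx _), hid n]
  simp [U]

end RecFlow

/-! ### The limit recursion -/

/-- A version of the limit `φ` that is measurable and vanishes where it is not prescribed. -/
noncomputable def limitSlope {S : Type*} (V : Set S) (p : ℝ) (φ : S → ℝ → ℝ) (v : S) (σ : ℝ) : ℝ :=
  open Classical in
  if v ∈ V ∧ (σ = 1 ∨ σ = -1) ∧ 0 < signWeight p σ then φ v σ else 0

/-- The limit recursion. -/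
noncomputable def limitMap {S : Type*} (V : Set S) (p : ℝ) (φ : S → ℝ → ℝ) (x : ℝ) (v : S) : ℝ :=
  x * limitSlope V p φ v (Real.sign x)

/-- `x = 0`, or the sign of `x` has positive weight. -/
def HasGoodSign (p x : ℝ) : Prop := x = 0 ∨ 0 < signWeight p (Real.sign x)

/-- The condition of linear growth. -/
def LinearlyBounded (g : ℝ → ℝ) : Prop :=
  ∃ C x₀ : ℝ, ∀ x : ℝ, x₀ ≤ x → ∀ y : ℝ, |y| ≤ x → |g y| ≤ C * x

/-- The argument `x * u x` runs to infinity with the sign of `y`, and `x⁻¹ g(x u) = u * (g(x u) / (x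
u))`. -/
theorem tendsto_scaled_of_ne_zero {g : ℝ → ℝ} {u : ℝ → ℝ} {y a : ℝ} (hy : y ≠ 0)
    (hu : Tendsto u atTop (𝓝 y))
    (hg : Tendsto (fun x : ℝ => g (Real.sign y * x) / (Real.sign y * x)) atTop (𝓝 a)) :
    Tendsto (fun x => x⁻¹ * g (x * u x)) atTop (𝓝 (y * a)) := by
  have hs : Real.sign y * Real.sign y = 1 := by
    rcases lt_or_gt_of_ne hy with h | h
    · rw [Real.sign_of_neg h]; norm_num
    · rw [Real.sign_of_pos h]; norm_num
  have hsy : 0 < Real.sign y * y := by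
    rcases lt_or_gt_of_ne hy with h | h
    · rw [Real.sign_of_neg h]; linarith
    · rw [Real.sign_of_pos h]; linarith
  have h1 : Tendsto (fun x => x * (Real.sign y * u x)) atTop atTop :=
    tendsto_id.atTop_mul_pos hsy (hu.const_mul _)
  refine (hu.mul (hg.comp h1)).congr' ?_
  filter_upwards [eventually_gt_atTop 0, hu.eventually_ne hy] with x hx hux
  have e : Real.sign y * (x * (Real.sign y * u x)) = x * u x := by
    rw [show Real.sign y * (x * (Real.sign y * u x)) =
      (Real.sign y * Real.sign y) * (x * u x) by ring, hs, one_mul]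
  simp only [Function.comp, e]
  field_simp

/-- Here `x * u x` need not be large, so slopes at infinity say nothing. Linear growth applied on
`|y| ≤ η x` gives the bound `C η`. -/
theorem tendsto_scaled_of_zero {g : ℝ → ℝ} {u : ℝ → ℝ} (hu : Tendsto u atTop (𝓝 0))
    (hg : LinearlyBounded g) : Tendsto (fun x => x⁻¹ * g (x * u x)) atTop (𝓝 0) := by
  obtain ⟨C, x₀, hC⟩ := hg
  rw [Metric.tendsto_atTop']
  intro r hr
  -- Chosen so that `|C| * η ≤ r / 2 < r`; the added `1` avoids division by zero.
  set η := r / (|C| + 1) / 2 with hη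
  have hηpos : 0 < η := by positivity
  have hCη : |C| * η < r := by
    have : |C| * η ≤ (|C| + 1) * η := by gcongr; linarith
    have h2 : (|C| + 1) * η = r / 2 := by rw [hη]; field_simp
    linarith
  have hev : ∀ᶠ x in atTop, |x⁻¹ * g (x * u x)| < r := by
    filter_upwards [eventually_gt_atTop 0, eventually_ge_atTop (x₀ / η),
      (Metric.tendsto_nhds.1 hu) η hηpos] with x hx hx0 hux
    rw [Real.dist_eq, sub_zero] at hux
    have h1 : |g (x * u x)| ≤ C * (η * x) := by
      refine hC (η * x) (by rwa [div_le_iff₀ hηpos, mul_comm] at hx0) _ ?_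
      rw [abs_mul, abs_of_pos hx, mul_comm]
      gcongr
    rw [abs_mul, abs_of_pos (inv_pos.2 hx), inv_mul_lt_iff₀ hx]
    calc |g (x * u x)| ≤ C * (η * x) := h1
      _ ≤ |C| * (η * x) := by gcongr; exact le_abs_self C
      _ = x * (|C| * η) := by ring
      _ < x * r := by gcongr
  obtain ⟨N, hN⟩ := eventually_atTop.1 hev
  exact ⟨N, fun x hx => by rw [Real.dist_eq, sub_zero]; exact hN x (le_of_lt hx)⟩

theorem Real.sign_eq_one_or_neg_one {y : ℝ} (hy : y ≠ 0) : Real.sign y = 1 ∨ Real.sign y = -1 := by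
  rcases lt_or_gt_of_ne hy with h | h
  · exact Or.inr (Real.sign_of_neg h)
  · exact Or.inl (Real.sign_of_pos h)

/-- The induction carries two facts about the limit state: its sign has positive weight, and if it
is `0` then linear growth is available. They are needed only before a further step, whence `k + 1 <
n` in `h2` and `h3`. For `n = 1` these are void, which allows the moment inequality to be proved
before sign preservation is known. -/
theorem tendsto_recFlow {S : Type*} {V : Set S} {p : ℝ} {φ : S → ℝ → ℝ} {Ψ : ℝ → S → ℝ}
    {e : ℕ → S} (h1 : ∀ k, ∀ σ : ℝ, σ = 1 ∨ σ = -1 → 0 < signWeight p σ →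
      Tendsto (fun x : ℝ => Ψ (σ * x) (e k) / (σ * x)) atTop (𝓝 (limitSlope V p φ (e k) σ)))
    {n : ℕ} (h2 : ∀ k, k + 1 < n → ∀ x, HasGoodSign p x → HasGoodSign p (limitMap V p φ x (e k)))
    (h3 : (∃ k, k + 1 < n ∧ ∃ σ : ℝ, (σ = 1 ∨ σ = -1) ∧ 0 < signWeight p σ ∧
      limitSlope V p φ (e k) σ = 0) → ∀ k, LinearlyBounded fun x => Ψ x (e k))
    {z : ℝ} (hz : z ≠ 0) (hzg : HasGoodSign p z) {ζ : ℝ → ℝ} (hζ : Tendsto ζ atTop (𝓝 z)) (k : ℕ)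
    (hk : k ≤ n) :
    Tendsto (fun x => x⁻¹ * recFlow Ψ k (x * ζ x) e) atTop
      (𝓝 (recFlow (limitMap V p φ) k z e)) := by
  suffices H : Tendsto (fun x => x⁻¹ * recFlow Ψ k (x * ζ x) e) atTop
      (𝓝 (recFlow (limitMap V p φ) k z e)) ∧
      (k < n → HasGoodSign p (recFlow (limitMap V p φ) k z e) ∧
        (recFlow (limitMap V p φ) k z e = 0 → ∀ k, LinearlyBounded fun x => Ψ x (e k))) from H.1
  induction k with
  | zero =>
    refine ⟨hζ.congr' ?_, fun _ => ⟨hzg, fun h => absurd h hz⟩⟩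
    filter_upwards [eventually_gt_atTop 0] with x hx
    simp only [recFlow]
    field_simp
  | succ k ih =>
    obtain ⟨ih1, ih2⟩ := ih (Nat.le_of_succ_le hk)
    obtain ⟨ih2, ih3⟩ := ih2 hk
    set y := recFlow (limitMap V p φ) k z e with hy
    have hstep : ∀ᶠ x : ℝ in atTop, x⁻¹ * Ψ (x * (x⁻¹ * recFlow Ψ k (x * ζ x) e)) (e k) =
        x⁻¹ * recFlow Ψ (k + 1) (x * ζ x) e := by
      filter_upwards [eventually_gt_atTop 0] with x hx
      rw [mul_inv_cancel_left₀ hx.ne', recFlow]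
    refine ⟨?_, fun hkn => ⟨h2 k hkn y ih2, fun h0 => ?_⟩⟩
    · rcases eq_or_ne y 0 with h0 | h0
      · have := (tendsto_scaled_of_zero (by rwa [h0] at ih1) (ih3 h0 k)).congr' hstep
        have e0 : recFlow (limitMap V p φ) (k + 1) z e = 0 := by
          rw [recFlow, ← hy, h0, limitMap, zero_mul]
        rwa [e0]
      · exact (tendsto_scaled_of_ne_zero (g := fun x => Ψ x (e k)) h0 ih1 (h1 k _ (Real.sign_eq_one_or_neg_one h0)
          (ih2.resolve_left h0))).congr' hstep
    · rcases eq_or_ne y 0 with hy0 | hy0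
      · exact ih3 hy0
      · rw [recFlow, ← hy, limitMap, mul_eq_zero] at h0
        exact h3 ⟨k, hkn, _, Real.sign_eq_one_or_neg_one hy0, ih2.resolve_left hy0,
          h0.resolve_left hy0⟩

/-! ### Measurability of the limit recursion and its transition kernel -/

section LimitMap

variable {S : Type*} {Ψ : ℝ → S → ℝ} {V : Set S} {p : ℝ} {φ : S → ℝ → ℝ}

/-- The convergence part of the condition on the asymptotics of `Ψ`. -/
def HasSlopesOn (Ψ : ℝ → S → ℝ) (p : ℝ) (φ : S → ℝ → ℝ) (V : Set S) : Prop :=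
  ∀ σ ∈ ({-1, 1} : Set ℝ), 0 < signWeight p σ → ∀ v ∈ V,
      Tendsto (fun x : ℝ => Ψ (σ * x) v / (σ * x)) atTop (𝓝 (φ v σ))

theorem HasSlopesOn.tendsto (h : HasSlopesOn Ψ p φ V) {σ : ℝ} (hσ : σ = 1 ∨ σ = -1)
    (hp : 0 < signWeight p σ) {v : S} (hv : v ∈ V) :
    Tendsto (fun x : ℝ => Ψ (σ * x) v / (σ * x)) atTop (𝓝 (limitSlope V p φ v σ)) := by
  rw [limitSlope, if_pos ⟨hv, hσ, hp⟩]
  exact h σ (by rcases hσ with rfl | rfl <;> simp) hp v hv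

variable [MeasurableSpace S]

/-- No measurability of `φ` is assumed; it is recovered here as a pointwise limit of measurable
functions along the integers. -/
theorem HasSlopesOn.measurable_limitSlope (h : HasSlopesOn Ψ p φ V) (hV : MeasurableSet V)
    (hΨ : Measurable (Function.uncurry Ψ)) (σ : ℝ) :
    Measurable fun v => limitSlope V p φ v σ := by
  by_cases hσ : (σ = 1 ∨ σ = -1) ∧ 0 < signWeight p σ
  · refine measurable_of_tendsto_metrizable
      (f := fun n : ℕ => V.indicator fun v => Ψ (σ * n) v / (σ * n)) (fun n => ?_)
      (tendsto_pi_nhds.2 fun v => ?_)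
    · exact ((hΨ.comp (measurable_const.prodMk measurable_id)).div_const _).indicator hV
    · by_cases hv : v ∈ V
      · simp only [indicator_of_mem hv]
        exact (h.tendsto hσ.1 hσ.2 hv).comp tendsto_natCast_atTop_atTop
      · simp only [indicator_of_notMem hv]
        rw [limitSlope, if_neg (by tauto)]
        exact tendsto_const_nhds
  · have : (fun v => limitSlope V p φ v σ) = fun _ => 0 := by
      funext v
      rw [limitSlope, if_neg (by tauto)]
    rw [this]
    exact measurable_const

theorem HasSlopesOn.measurable_limitMap (h : HasSlopesOn Ψ p φ V) (hV : MeasurableSet V)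
    (hΨ : Measurable (Function.uncurry Ψ)) :
    Measurable (Function.uncurry (limitMap V p φ)) := by
  have hg : ∀ σ, Measurable fun q : ℝ × S => q.1 * limitSlope V p φ q.2 σ := fun σ =>
    measurable_fst.mul ((h.measurable_limitSlope hV hΨ σ).comp measurable_snd)
  have : Function.uncurry (limitMap V p φ) = fun q : ℝ × S =>
      if q.1 < 0 then q.1 * limitSlope V p φ q.2 (-1)
      else if 0 < q.1 then q.1 * limitSlope V p φ q.2 1
      else q.1 * limitSlope V p φ q.2 0 := by
    funext q
    simp only [Function.uncurry, limitMap, Real.sign]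
    split_ifs <;> rfl
  rw [this]
  exact Measurable.ite (measurable_fst measurableSet_Iio) (hg _)
    (Measurable.ite (measurable_fst measurableSet_Ioi) (hg _) (hg _))

variable {ν : Measure S} [IsProbabilityMeasure ν]

theorem HasSlopesOn.lintegral_forwardLaw (h : HasSlopesOn Ψ p φ V) (hV : MeasurableSet V)
    (hΨ : Measurable (Function.uncurry Ψ)) (hν : ν V = 1) (hp : p ∈ Icc (0 : ℝ) 1)
    {F : ℝ × ℝ → ℝ≥0∞} (hF : Measurable F) :
    ∫⁻ q, F q ∂(forwardLaw ν p φ) =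
      ENNReal.ofReal p * ∫⁻ v, F (1, limitMap V p φ 1 v) ∂ν +
        ENNReal.ofReal (1 - p) * ∫⁻ v, F (-1, limitMap V p φ (-1) v) ∂ν := by
  set l : Measure ℝ := ENNReal.ofReal p • Measure.dirac (1 : ℝ) +
      ENNReal.ofReal (1 - p) • Measure.dirac (-1 : ℝ) with hl
  have hVae : ∀ᵐ v ∂ν, v ∈ V := (prob_compl_eq_zero_iff hV).2 hν
  have hms : MeasurableSet {x : ℝ | (x = 1 ∨ x = -1) ∧ 0 < signWeight p x} :=
    ((Set.toFinite ({1, -1} : Set ℝ)).subset fun x hx => hx.1).measurableSet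
  have hl0 : ∀ᵐ x ∂l, (x = 1 ∨ x = -1) ∧ 0 < signWeight p x := by
    rw [hl, ae_add_measure_iff]
    constructor
    · rcases hp.1.eq_or_lt with h0 | h0
      · rw [← h0, ENNReal.ofReal_zero, zero_smul]; exact ae_zero.le (by simp)
      · refine Measure.ae_smul_measure ((ae_dirac_iff hms).2 ?_) _
        exact ⟨Or.inl rfl, by rwa [signWeight, if_pos rfl]⟩
    · rcases hp.2.eq_or_lt with h0 | h0
      · rw [h0, sub_self, ENNReal.ofReal_zero, zero_smul]; exact ae_zero.le (by simp)
      · refine Measure.ae_smul_measure ((ae_dirac_iff hms).2 ?_) _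
        exact ⟨Or.inr rfl, by rw [signWeight, if_neg (by norm_num)]; linarith⟩
  have hm := h.measurable_limitMap hV hΨ
  have hG : Measurable fun q : ℝ × S => (q.1, limitMap V p φ q.1 q.2) := measurable_fst.prodMk hm
  -- The map defining `forwardLaw` may fail to be measurable, but it agrees almost everywhere with a
  -- measurable one, so the push-forward is the intended measure.
  have hae : (fun q : ℝ × S => (q.1, q.1 * φ q.2 (Real.sign q.1))) =ᵐ[l.prod ν]
      fun q => (q.1, limitMap V p φ q.1 q.2) := by
    have h1 : ∀ᵐ q ∂(l.prod ν), (q.1 = 1 ∨ q.1 = -1) ∧ 0 < signWeight p q.1 :=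
      Measure.quasiMeasurePreserving_fst.ae hl0
    have h2 : ∀ᵐ q ∂(l.prod ν), q.2 ∈ V := Measure.quasiMeasurePreserving_snd.ae hVae
    filter_upwards [h1, h2] with q hq hq2
    have hs : Real.sign q.1 = q.1 := by
      rcases hq.1 with h | h <;> rw [h]
      · exact Real.sign_one
      · exact Real.sign_of_neg (by norm_num)
    rw [limitMap, hs, limitSlope, if_pos ⟨hq2, hq⟩]
  have hFG : Measurable fun q : ℝ × S => F (q.1, limitMap V p φ q.1 q.2) := hF.comp hG
  rw [forwardLaw, Measure.map_congr hae, lintegral_map hF hG,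
    lintegral_prod _ hFG.aemeasurable]
  have hm2 : Measurable fun x => ∫⁻ v, F (x, limitMap V p φ x v) ∂ν :=
    hFG.lintegral_prod_right'
  rw [hl, lintegral_add_measure, lintegral_smul_measure, lintegral_smul_measure,
    lintegral_dirac' _ hm2, lintegral_dirac' _ hm2]
  rfl

theorem HasSlopesOn.isProbabilityMeasure_forwardLaw (h : HasSlopesOn Ψ p φ V)
    (hV : MeasurableSet V) (hΨ : Measurable (Function.uncurry Ψ)) (hν : ν V = 1)
    (hp : p ∈ Icc (0 : ℝ) 1) : IsProbabilityMeasure (forwardLaw ν p φ) := by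
  constructor
  have := h.lintegral_forwardLaw hV hΨ hν hp (F := 1) measurable_one
  simp only [Pi.one_apply, lintegral_const, measure_univ, mul_one, one_mul] at this
  rw [this, ← ENNReal.ofReal_add hp.1 (by linarith [hp.2]), add_sub_cancel, ENNReal.ofReal_one]

theorem HasSlopesOn.forwardLaw_fst (h : HasSlopesOn Ψ p φ V)
    (hV : MeasurableSet V) (hΨ : Measurable (Function.uncurry Ψ)) (hν : ν V = 1)
    (hp : p ∈ Icc (0 : ℝ) 1) (x : ℝ) : forwardLaw ν p φ {q | q.1 = x} =
      ENNReal.ofReal p * ({x} : Set ℝ).indicator 1 1 +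
        ENNReal.ofReal (1 - p) * ({x} : Set ℝ).indicator 1 (-1) := by
  have := h.lintegral_forwardLaw hV hΨ hν hp (F := {q | q.1 = x}.indicator 1)
    (measurable_one.indicator (measurableSet_fst_eq x))
  rw [lintegral_indicator_one (measurableSet_fst_eq x)] at this
  rw [this]
  have e : ∀ a b : ℝ, ({q | q.1 = x} : Set (ℝ × ℝ)).indicator (1 : ℝ × ℝ → ℝ≥0∞) (a, b) =
    ({x} : Set ℝ).indicator 1 a := fun a b => rfl
  simp only [e, lintegral_const, measure_univ, mul_one]

/-- The kernel of the forward law is the transition kernel of the limit recursion. -/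
theorem HasSlopesOn.tailKernel_forwardLaw (h : HasSlopesOn Ψ p φ V)
    (hV : MeasurableSet V) (hΨ : Measurable (Function.uncurry Ψ)) (hν : ν V = 1)
    (hp : p ∈ Icc (0 : ℝ) 1) [IsProbabilityMeasure (forwardLaw ν p φ)] (x : ℝ) :
    tailKernel (forwardLaw ν p φ) x = ν.map (limitMap V p φ x) := by
  have hm := h.measurable_limitMap hV hΨ
  have hmx : ∀ x, Measurable (limitMap V p φ x) := fun x =>
    hm.comp (measurable_const.prodMk measurable_id)
  have hns : ∀ σ, ¬ ((σ = 1 ∨ σ = -1) ∧ 0 < signWeight p σ) →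
      (fun v : S => limitSlope V p φ v σ) = fun _ => 0 := fun σ hσ => by
    funext v
    rw [limitSlope, if_neg (by tauto)]
  have key : ∀ σ : ℝ, σ = 1 ∨ σ = -1 → tailNoise (forwardLaw ν p φ) σ =
      ν.map fun v => limitSlope V p φ v σ := by
    intro σ hσ
    have hσ0 : σ ≠ 0 := by rcases hσ with rfl | rfl <;> norm_num
    have hσs : Real.sign σ = σ := by
      rcases hσ with rfl | rfl
      · exact Real.sign_one
      · exact Real.sign_of_neg (by norm_num)
    have hw : forwardLaw ν p φ {q | q.1 = σ} = ENNReal.ofReal (signWeight p σ) := by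
      rw [h.forwardLaw_fst hV hΨ hν hp]
      rcases hσ with rfl | rfl
      · simp [signWeight, indicator]; norm_num
      · simp [signWeight, indicator]; norm_num
    by_cases hpos : 0 < signWeight p σ
    · have hw0 : ENNReal.ofReal (signWeight p σ) ≠ 0 := (ENNReal.ofReal_pos.2 hpos).ne'
      ext B hB
      have h1 := setLIntegral_fst_eq (forwardLaw ν p φ) hσ0
        (F := fun q => B.indicator 1 (q.2 / q.1))
        ((measurable_one.indicator hB).comp measurable_snd_div_fst)
      have h2 := h.lintegral_forwardLaw hV hΨ hν hp
        (F := {q | q.1 = σ}.indicator fun q => B.indicator 1 (q.2 / q.1))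
        (((measurable_one.indicator hB).comp measurable_snd_div_fst).indicator
          (measurableSet_fst_eq σ))
      rw [lintegral_indicator (measurableSet_fst_eq σ), h1, hw] at h2
      have h3 : ∫⁻ e, B.indicator (1 : ℝ → ℝ≥0∞) (σ * e / σ) ∂(tailNoise (forwardLaw ν p φ) σ) =
          tailNoise (forwardLaw ν p φ) σ B := by
        simp only [mul_div_cancel_left₀ _ hσ0]
        exact lintegral_indicator_one hB
      have h4 : ∫⁻ v, B.indicator (1 : ℝ → ℝ≥0∞) (limitMap V p φ σ v / σ) ∂ν =
          (ν.map fun v => limitSlope V p φ v σ) B := by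
        rw [← lintegral_indicator_one hB,
          lintegral_map (measurable_one.indicator hB) (h.measurable_limitSlope hV hΨ σ)]
        simp only [limitMap, hσs, mul_div_cancel_left₀ _ hσ0]
      rw [h3] at h2
      rw [← h4]
      refine (ENNReal.mul_right_inj hw0 ENNReal.ofReal_ne_top).1 (h2.trans ?_)
      rcases hσ with rfl | rfl
      · simp [signWeight, indicator]; norm_num
      · simp [signWeight, indicator]; norm_num
    -- At a sign of weight zero both sides take their defaults, noise `δ₀` and slope `0`, which
    -- agree.
    · have hw0 : signWeight p σ = 0 :=
        le_antisymm (not_lt.1 hpos) (signWeight_nonneg hp σ)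
      rw [tailNoise, if_pos (by rw [hw, hw0, ENNReal.ofReal_zero]), hns σ (by tauto)]
      simp
  rw [tailKernel, signKernel_apply]
  rcases eq_or_ne x 0 with rfl | hx
  · have : limitMap V p φ 0 = fun _ => 0 := by funext v; rw [limitMap, zero_mul]
    rw [this]
    simp
  · rw [key _ (Real.sign_eq_one_or_neg_one hx),
      Measure.map_map (measurable_const_mul x) (h.measurable_limitSlope hV hΨ _)]
    rfl

end LimitMap

/-- The transition kernel `x ↦ law of Ψ (x, v)`. -/
noncomputable def stepKernel {S : Type*} [MeasurableSpace S] (ν : Measure S) [IsProbabilityMeasure ν]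
    (Ψ : ℝ → S → ℝ) : Kernel ℝ ℝ :=
  (Kernel.id ×ₖ Kernel.const ℝ ν).map (Function.uncurry Ψ)

theorem stepKernel_apply {S : Type*} [MeasurableSpace S] {ν : Measure S} [IsProbabilityMeasure ν]
    {Ψ : ℝ → S → ℝ} (hΨ : Measurable (Function.uncurry Ψ)) (x : ℝ) :
    stepKernel ν Ψ x = ν.map (Ψ x) := by
  rw [stepKernel, Kernel.map_apply _ hΨ, Kernel.prod_apply, Kernel.id_apply, Kernel.const_apply,
    Measure.dirac_prod, Measure.map_map hΨ measurable_prodMk_left]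
  rfl

theorem isMarkovKernel_stepKernel {S : Type*} [MeasurableSpace S] {ν : Measure S}
    [IsProbabilityMeasure ν] {Ψ : ℝ → S → ℝ} (hΨ : Measurable (Function.uncurry Ψ)) :
    IsMarkovKernel (stepKernel ν Ψ) :=
  Kernel.IsMarkovKernel.map _ hΨ

theorem integrable_of_bounded_of_support {E : Type*} [MeasurableSpace E] {m : Measure E}
    {f : E → ℝ} (hf : Measurable f) {C : ℝ} (hC : ∀ v, |f v| ≤ C) {A : Set E} (hA : MeasurableSet A)
    (hmA : m A ≠ ∞) (hfA : ∀ v ∉ A, f v = 0) : Integrable f m := by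
  refine ((integrable_indicator_iff hA).2 (integrableOn_const (C := C) hmA)).mono'
    hf.aestronglyMeasurable (Eventually.of_forall fun v => ?_)
  by_cases h : v ∈ A
  · rw [indicator_of_mem h]; exact hC v
  · rw [indicator_of_notMem h, hfA v h, norm_zero]

theorem tailMeasure_lt_abs_lt_top {α p δ : ℝ} (hα : 0 < α) (hδ : 0 < δ) :
    tailMeasure α p {x | δ < |x|} < ∞ := by
  have hm : MeasurableSet {x : ℝ | δ < |x|} := measurableSet_lt measurable_const measurable_id.abs
  have h0 : powMeasure α {x | δ < |x|} = powMeasure α (Ioi δ) := by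
    refine measure_congr ((ae_powMeasure_pos α).mono fun z hz => ?_)
    have : (δ < |z|) = (δ < z) := by rw [abs_of_pos hz]
    exact this
  have h1 : (powMeasure α).map Neg.neg {x | δ < |x|} = powMeasure α (Ioi δ) := by
    rw [Measure.map_apply measurable_neg hm, ← h0]
    congr 1
    ext x
    simp
  rw [tailMeasure, Measure.add_apply, Measure.smul_apply, Measure.smul_apply, h0, h1]
  exact ENNReal.add_lt_top.2 ⟨ENNReal.mul_lt_top ENNReal.ofReal_lt_top
    (powMeasure_Ioi_lt_top hα hδ), ENNReal.mul_lt_top ENNReal.ofReal_lt_top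
    (powMeasure_Ioi_lt_top hα hδ)⟩

/-! ### The stationary chain started far from the origin -/

section Stationary

variable {Ω S : Type*} [MeasurableSpace Ω] [MeasurableSpace S] {P : Measure Ω}
  {Ψ : ℝ → S → ℝ} {ε : ℕ → Ω → S} {X : ℕ → Ω → ℝ}

theorem IsStationaryRecursion.map_innov (hX : IsStationaryRecursion P Ψ ε X) (n : ℕ) :
    P.map (ε n) = P.map (ε 0) := (hX.innov_identDistrib n).map_eq

theorem IsStationaryRecursion.measurable_innovSeq (hX : IsStationaryRecursion P Ψ ε X) :
    Measurable fun ω n => ε n ω := measurable_pi_iff.2 hX.measurable_innov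

theorem IsStationaryRecursion.ae_eq_recFlow (hX : IsStationaryRecursion P Ψ ε X) :
    ∀ᵐ ω ∂P, ∀ k, X k ω = recFlow Ψ k (X 0 ω) (fun n => ε n ω) := by
  filter_upwards [ae_all_iff.2 hX.recursion] with ω hω k
  induction k with
  | zero => rfl
  | succ k ih => rw [hω k, recFlow, ← ih]

theorem IsStationaryRecursion.map_one (hX : IsStationaryRecursion P Ψ ε X) :
    P.map (X 1) = P.map (X 0) := by
  rw [← hX.stationary]
  exact Measure.map_congr (hX.recursion 0)

variable [IsProbabilityMeasure P]

theorem IsStationaryRecursion.lintegral_recFlow (hX : IsStationaryRecursion P Ψ ε X)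
    {Φ : ℝ → S → ℝ} (hΦ : Measurable (Function.uncurry Φ)) {κ : Kernel ℝ ℝ} [IsMarkovKernel κ]
    (hκ : ∀ x, κ x = (P.map (ε 0)).map (Φ x)) (n : ℕ) {f : (Fin (n + 1) → ℝ) → ℝ≥0∞}
    (hf : Measurable f) (x : ℝ) :
    ∫⁻ ω, f (fun j => recFlow Φ j x (fun i => ε i ω)) ∂P = pathInt κ n f x := by
  rw [(hasKernelTransitions_recFlow hΦ hX.measurable_innov hX.innov_indep hX.map_innov hκ
    x).lintegral_eq n hf]
  simp [recFlow]

theorem IsStationaryRecursion.lintegral_chain (hX : IsStationaryRecursion P Ψ ε X)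
    {κ : Kernel ℝ ℝ} [IsMarkovKernel κ] (hκ : ∀ x, κ x = (P.map (ε 0)).map (Ψ x)) (n : ℕ)
    {f : (Fin (n + 1) → ℝ) → ℝ≥0∞} (hf : Measurable f) :
    ∫⁻ ω, f (fun j => X j ω) ∂P = ∫⁻ ω, pathInt κ n f (X 0 ω) ∂P := by
  have h1 : ∫⁻ ω, f (fun j => X j ω) ∂P =
      ∫⁻ ω, f (fun j => recFlow Ψ j (X 0 ω) (fun i => ε i ω)) ∂P :=
    lintegral_congr_ae (hX.ae_eq_recFlow.mono fun ω hω =>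
      congrArg f (funext fun j : Fin (n + 1) => hω j))
  have hm := measurable_recFlow_vec hX.measurable_map n
  rw [h1, lintegral_of_indepFun (hX.measurable_chain 0) hX.measurable_innovSeq hX.init_indep
    (h := fun q => f fun j => recFlow Ψ j q.1 q.2) (hf.comp hm)]
  refine lintegral_congr fun ω => ?_
  have hfm : Measurable fun e : ℕ → S => f fun j : Fin (n + 1) => recFlow Ψ j (X 0 ω) e :=
    (hf.comp hm).comp (measurable_const.prodMk measurable_id)
  rw [lintegral_map hfm hX.measurable_innovSeq]
  exact hX.lintegral_recFlow hX.measurable_map hκ n hf _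

/-- Stationarity of the vectors of consecutive states. -/
theorem IsStationaryRecursion.map_vec_succ (hX : IsStationaryRecursion P Ψ ε X) (n : ℕ) :
    P.map (fun ω => (fun j : Fin (n + 1) => X (j + 1) ω)) =
      P.map (fun ω => (fun j : Fin (n + 1) => X j ω)) := by
  have := Measure.isProbabilityMeasure_map (μ := P) (hX.measurable_innov 0).aemeasurable
  have := isMarkovKernel_stepKernel (ν := P.map (ε 0)) hX.measurable_map
  have hκ := stepKernel_apply (ν := P.map (ε 0)) hX.measurable_map
  refine Measure.ext_of_lintegral _ fun f hf => ?_
  rw [lintegral_map hf (measurable_pi_iff.2 fun j => hX.measurable_chain _),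
    lintegral_map hf (measurable_pi_iff.2 fun j => hX.measurable_chain _),
    hX.lintegral_chain hκ n hf]
  have htl : Measurable fun v : Fin (n + 2) → ℝ => f (Fin.tail v) :=
    hf.comp (measurable_pi_iff.2 fun j => measurable_pi_apply _)
  have h1 := hX.lintegral_chain hκ (n + 1) htl
  have e1 : ∀ ω, Fin.tail (fun j : Fin (n + 2) => X j ω) = fun j : Fin (n + 1) => X (j + 1) ω := by
    intro ω; funext j; simp [Fin.tail]
  simp only [e1] at h1
  have hpm := measurable_pathInt (κ := stepKernel (P.map (ε 0)) Ψ) n hf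
  -- By the Markov property the shifted vector has expectation `E[pathInt n f (X 1)]`, and `X 1` has
  -- the law of `X 0`.
  have h2 := hX.lintegral_chain hκ 1 (f := fun v => pathInt (stepKernel (P.map (ε 0)) Ψ) n f (v 1))
    (hpm.comp (measurable_pi_apply _))
  have h3 : ∫⁻ ω, pathInt (stepKernel (P.map (ε 0)) Ψ) n f (X 1 ω) ∂P =
      ∫⁻ ω, pathInt (stepKernel (P.map (ε 0)) Ψ) n f (X 0 ω) ∂P := by
    rw [← lintegral_map hpm (hX.measurable_chain 1), hX.map_one,
      lintegral_map hpm (hX.measurable_chain 0)]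
  rw [h1, ← h3]
  refine Eq.trans ?_ h2.symm
  simp only [pathInt, Fin.tail_cons]
  rfl

variable {α p : ℝ} {Φ : ℝ → S → ℝ}

theorem IsStationaryRecursion.bind_pathKernel_eq (hX : IsStationaryRecursion P Ψ ε X)
    (hΦ : Measurable (Function.uncurry Φ)) {κ : Kernel ℝ ℝ} [IsMarkovKernel κ]
    (hκ : ∀ x, κ x = (P.map (ε 0)).map (Φ x)) (l : Measure ℝ) [SFinite l] (n : ℕ) :
    l.bind (pathKernel κ n) =
      (l.prod P).map (fun q => (fun j : Fin (n + 1) => recFlow Φ j q.1 (fun i => ε i q.2))) := by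
  have hm : Measurable fun q : ℝ × Ω => (fun j : Fin (n + 1) => recFlow Φ j q.1 (fun i => ε i q.2)) :=
    (measurable_recFlow_vec hΦ n).comp (measurable_fst.prodMk
      (hX.measurable_innovSeq.comp measurable_snd))
  refine Measure.ext_of_lintegral _ fun f hf => ?_
  have hfm : Measurable fun q : ℝ × Ω =>
    f (fun j : Fin (n + 1) => recFlow Φ j q.1 (fun i => ε i q.2)) := hf.comp hm
  rw [lintegral_bind_pathKernel l n hf, lintegral_map hf hm, lintegral_prod _ hfm.aemeasurable]
  exact lintegral_congr fun x => (hX.lintegral_recFlow hΦ hκ n hf x).symm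

theorem IsStationaryRecursion.integral_bind_pathKernel (hX : IsStationaryRecursion P Ψ ε X)
    (hΦ : Measurable (Function.uncurry Φ)) {κ : Kernel ℝ ℝ} [IsMarkovKernel κ]
    (hκ : ∀ x, κ x = (P.map (ε 0)).map (Φ x)) (hα : 0 < α) (n : ℕ)
    {f : (Fin (n + 1) → ℝ) → ℝ} (hf : Measurable f) {C δ : ℝ} (hC : ∀ v, |f v| ≤ C) (hδ : 0 < δ)
    (hf0 : ∀ v, |v 0| ≤ δ → f v = 0) :
    ∫ v, f v ∂((tailMeasure α p).bind (pathKernel κ n)) =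
      ∫ z, ∫ ω, f (fun j => recFlow Φ j z (fun i => ε i ω)) ∂P ∂(tailMeasure α p) := by
  have hm : Measurable fun q : ℝ × Ω => (fun j : Fin (n + 1) => recFlow Φ j q.1 (fun i => ε i q.2)) :=
    (measurable_recFlow_vec hΦ n).comp (measurable_fst.prodMk
      (hX.measurable_innovSeq.comp measurable_snd))
  rw [hX.bind_pathKernel_eq hΦ hκ, integral_map hm.aemeasurable hf.aestronglyMeasurable,
    integral_prod]
  have hA : MeasurableSet {x : ℝ | δ < |x|} := measurableSet_lt measurable_const measurable_id.abs
  refine integrable_of_bounded_of_support (A := {x : ℝ | δ < |x|} ×ˢ univ) (hf.comp hm)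
    (fun q => hC _) (hA.prod MeasurableSet.univ) ?_ fun q hq => ?_
  · rw [Measure.prod_prod]
    exact ENNReal.mul_ne_top (tailMeasure_lt_abs_lt_top hα hδ).ne (measure_ne_top _ _)
  · refine hf0 _ (not_lt.1 fun h => hq ⟨h, mem_univ _⟩)

/-- Convergence of the rescaled chain on functions that vanish when the initial state is small. -/
theorem IsStationaryRecursion.tendsto_integral_vec (hX : IsStationaryRecursion P Ψ ε X)
    (hRV : HasRegVaryingTails P (X 0) α p) (hΦ : Measurable (Function.uncurry Φ)) (n : ℕ)
    (hpath : ∀ σ : ℝ, σ = 1 ∨ σ = -1 → 0 < signWeight p σ → ∀ z > 0, ∀ᵐ ω ∂P, ∀ ζ : ℝ → ℝ,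
      Tendsto ζ atTop (𝓝 (σ * z)) → ∀ j ≤ n,
        Tendsto (fun x => x⁻¹ * recFlow Ψ j (x * ζ x) (fun i => ε i ω)) atTop
          (𝓝 (recFlow Φ j (σ * z) (fun i => ε i ω))))
    {f : (Fin (n + 1) → ℝ) → ℝ} (hf : Continuous f) {C δ : ℝ} (hC : ∀ v, |f v| ≤ C) (hδ : 0 < δ)
    (hf0 : ∀ v, |v 0| ≤ δ → f v = 0) :
    Tendsto (fun x => (∫ ω, f (fun j => x⁻¹ * X j ω) ∂P) / P.real {ω | x < |X 0 ω|}) atTop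
      (𝓝 (∫ z, ∫ ω, f (fun j => recFlow Φ j z (fun i => ε i ω)) ∂P ∂(tailMeasure α p))) := by
  have hmf : Measurable f := hf.measurable
  have hmΨ : ∀ x : ℝ, Measurable fun q : ℝ × (ℕ → S) =>
      f (fun j : Fin (n + 1) => x⁻¹ * recFlow Ψ j (x * q.1) q.2) := fun x => by
    refine hmf.comp (measurable_pi_iff.2 fun j => ?_)
    exact ((measurable_recFlow hX.measurable_map j).comp
      ((measurable_fst.const_mul x).prodMk measurable_snd)).const_mul _
  have hmΦ : Measurable fun q : ℝ × (ℕ → S) => f (fun j : Fin (n + 1) => recFlow Φ j q.1 q.2) :=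
    hmf.comp (measurable_recFlow_vec hΦ n)
  have hsq : Measurable fun q : ℝ × Ω => (q.1, fun i => ε i q.2) :=
    measurable_fst.prodMk (hX.measurable_innovSeq.comp measurable_snd)
  have hbound : ∀ g : Ω → (Fin (n + 1) → ℝ), |∫ ω, f (g ω) ∂P| ≤ C := fun g => by
    refine (norm_integral_le_of_norm_le_const (C := C) (f := fun ω => f (g ω))
      (Eventually.of_forall fun ω => hC _)).trans ?_
    simp
  -- Expectation over the innovations alone, with the initial state frozen at `x * z`; independence
  -- of `X 0` and the innovations brings back the original expectation.
  set K : ℝ → ℝ → ℝ := fun x z =>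
    ∫ ω, f (fun j : Fin (n + 1) => x⁻¹ * recFlow Ψ j (x * z) (fun i => ε i ω)) ∂P with hK
  set k : ℝ → ℝ := fun z => ∫ ω, f (fun j : Fin (n + 1) => recFlow Φ j z (fun i => ε i ω)) ∂P
    with hk
  have key := hRV.tendsto_integral (hX.measurable_chain 0) (K := K) (k := k) (C := C) hδ
    (fun x => ((hmΨ x).comp hsq).stronglyMeasurable.integral_prod_right'.measurable)
    (hmΦ.comp hsq).stronglyMeasurable.integral_prod_right'.measurable
    (fun x z => hbound _) ?_ (fun z => hbound _) ?_ ?_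
  · refine key.congr' ?_
    filter_upwards [eventually_gt_atTop 0] with x hx
    congr 1
    have h1 : ∫ ω, f (fun j => x⁻¹ * X j ω) ∂P =
        ∫ ω, f (fun j : Fin (n + 1) => x⁻¹ * recFlow Ψ j (x * (x⁻¹ * X 0 ω)) (fun i => ε i ω)) ∂P := by
      refine integral_congr_ae (hX.ae_eq_recFlow.mono fun ω hω => ?_)
      simp only [mul_inv_cancel_left₀ hx.ne']
      exact congrArg f (funext fun j : Fin (n + 1) => by rw [hω j])
    have hU : Measurable fun ω => x⁻¹ * X 0 ω := (hX.measurable_chain 0).const_mul _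
    have hind : IndepFun (fun ω => x⁻¹ * X 0 ω) (fun ω n => ε n ω) P :=
      hX.init_indep.comp (measurable_const_mul x⁻¹) measurable_id
    rw [h1, integral_of_indepFun hU hX.measurable_innovSeq hind (hmΨ x) fun q => hC _]
  · intro x z hz
    simp only [hK]
    rw [integral_eq_zero_of_ae]
    refine Eventually.of_forall fun ω => hf0 _ ?_
    simp only [Fin.val_zero, recFlow]
    rcases eq_or_ne x 0 with rfl | hx
    · simpa using hδ.le
    · rwa [inv_mul_cancel_left₀ hx]
  · intro z hz
    simp only [hk]
    rw [integral_eq_zero_of_ae]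
    exact Eventually.of_forall fun ω => hf0 _ hz
  · intro σ hσ hpos z hz ζ hζ
    refine tendsto_integral_filter_of_dominated_convergence (fun _ => C) ?_ ?_
      (integrable_const _) ?_
    · refine Eventually.of_forall fun x => Measurable.aestronglyMeasurable ?_
      exact (hmΨ x).comp (measurable_const.prodMk hX.measurable_innovSeq)
    · exact Eventually.of_forall fun x => Eventually.of_forall fun ω => hC _
    · filter_upwards [hpath σ hσ hpos z hz] with ω hω
      exact (hf.tendsto _).comp (tendsto_pi_nhds.2 fun j =>
        hω ζ hζ j (Nat.lt_succ_iff.1 j.2))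

end Stationary

theorem limitMap_mul {S : Type*} {V : Set S} {p : ℝ} {φ : S → ℝ → ℝ} {z : ℝ} (hz : 0 < z) (x : ℝ)
    (v : S) : limitMap V p φ (z * x) v = z * limitMap V p φ x v := by
  rw [limitMap, limitMap, Real.sign_mul_of_pos hz, mul_assoc]

theorem bind_pathKernel_lt_top {κ : Kernel ℝ ℝ} [IsMarkovKernel κ] {α p δ : ℝ} (hα : 0 < α)
    (hδ : 0 < δ) (n : ℕ) :
    (tailMeasure α p).bind (pathKernel κ n) {v | δ < |v 0|} < ∞ := by
  have hA : MeasurableSet {v : Fin (n + 1) → ℝ | δ < |v 0|} :=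
    measurableSet_lt measurable_const (measurable_pi_apply 0).abs
  have hA1 : MeasurableSet {x : ℝ | δ < |x|} := measurableSet_lt measurable_const measurable_id.abs
  rw [← lintegral_indicator_one hA, lintegral_bind_pathKernel _ n (measurable_one.indicator hA)]
  refine lt_of_eq_of_lt ?_ (tailMeasure_lt_abs_lt_top (p := p) hα hδ)
  rw [← lintegral_indicator_one hA1]
  refine lintegral_congr fun x => ?_
  rw [pathInt_congr (g := fun _ => {x : ℝ | δ < |x|}.indicator 1 x) n fun v hv => ?_, pathInt_const]
  simp [indicator, hv]

theorem measurableSet_pair (τ : ℝ) :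
    MeasurableSet {v : Fin 2 → ℝ | 1 < τ * v 1 ∧ v 0 ≠ 0} := by
  have h1 : Measurable fun v : Fin 2 → ℝ => τ * v 1 :=
    (measurable_const_mul τ).comp (measurable_pi_apply 1)
  exact (measurableSet_lt measurable_const h1).inter
    (measurable_pi_apply 0 (measurableSet_singleton 0).compl)

/-! ### Membership of the forward law in `M_{p,α}` -/

section Moment

variable {Ω S : Type*} [MeasurableSpace Ω] [MeasurableSpace S] {P : Measure Ω}
  {Ψ : ℝ → S → ℝ} {ε : ℕ → Ω → S} {X : ℕ → Ω → ℝ}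
  {V : Set S} {α p : ℝ} {φ : S → ℝ → ℝ}

theorem IsStationaryRecursion.ae_innov_mem (hX : IsStationaryRecursion P Ψ ε X)
    {B : Set S} (hB : ∀ᵐ v ∂(P.map (ε 0)), v ∈ B) : ∀ᵐ ω ∂P, ∀ n, ε n ω ∈ B := by
  refine ae_all_iff.2 fun n => ?_
  rw [← hX.map_innov n] at hB
  exact ae_of_ae_map (hX.measurable_innov n).aemeasurable hB

theorem sign_mul_of_pos {σ z : ℝ} (hσ : σ = 1 ∨ σ = -1) (hz : 0 < z) : Real.sign (σ * z) = σ := by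
  rcases hσ with rfl | rfl
  · rw [one_mul, Real.sign_of_pos hz]
  · rw [neg_one_mul, Real.sign_of_neg (neg_neg_of_pos hz)]

theorem IsStationaryRecursion.tendsto_recFlow_one (hX : IsStationaryRecursion P Ψ ε X)
    (h : HasSlopesOn Ψ p φ V) (hV : ∀ᵐ v ∂(P.map (ε 0)), v ∈ V) {σ : ℝ} (hσ : σ = 1 ∨ σ = -1)
    (hp : 0 < signWeight p σ) {z : ℝ} (hz : 0 < z) : ∀ᵐ ω ∂P, ∀ ζ : ℝ → ℝ,
      Tendsto ζ atTop (𝓝 (σ * z)) → ∀ j ≤ 1,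
        Tendsto (fun x => x⁻¹ * recFlow Ψ j (x * ζ x) (fun i => ε i ω)) atTop
          (𝓝 (recFlow (limitMap V p φ) j (σ * z) (fun i => ε i ω))) := by
  filter_upwards [hX.ae_innov_mem hV] with ω hω ζ hζ j hj
  refine tendsto_recFlow (n := 1) (fun k σ hσ hp => h.tendsto hσ hp (hω k))
    (fun k hk => by omega) (fun ⟨k, hk, _⟩ => by omega) ?_ (Or.inr ?_) hζ j hj
  · rcases hσ with rfl | rfl
    · linarith
    · linarith
  · rwa [sign_mul_of_pos hσ hz]

/-- A continuous approximation of the indicator of `{v | 1 < τ v₁, v₀ ≠ 0}`. -/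
noncomputable def cutoffPair (τ : ℝ) (n : ℕ) (v : Fin 2 → ℝ) : ℝ :=
  min 1 (max 0 (n * (τ * v 1 - 1))) * min 1 (max 0 (n * |v 0| - 1))

theorem cutoffPair_nonneg (τ : ℝ) (n : ℕ) (v : Fin 2 → ℝ) : 0 ≤ cutoffPair τ n v :=
  mul_nonneg (le_min zero_le_one (le_max_left _ _)) (le_min zero_le_one (le_max_left _ _))

theorem cutoffPair_le (τ : ℝ) (n : ℕ) (v : Fin 2 → ℝ) :
    cutoffPair τ n v ≤ {v : Fin 2 → ℝ | 1 < τ * v 1}.indicator 1 v := by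
  by_cases h : 1 < τ * v 1
  · rw [indicator_of_mem (by exact h)]
    exact mul_le_one₀ (min_le_left _ _) (le_min zero_le_one (le_max_left _ _)) (min_le_left _ _)
  · rw [indicator_of_notMem (by exact h), cutoffPair, max_eq_left, min_eq_right zero_le_one, zero_mul]
    exact mul_nonpos_of_nonneg_of_nonpos (Nat.cast_nonneg n) (by linarith)

theorem tendsto_cutoffPair {τ : ℝ} {v : Fin 2 → ℝ} (h1 : 1 < τ * v 1) (h0 : v 0 ≠ 0) :
    Tendsto (fun n => cutoffPair τ n v) atTop (𝓝 1) := by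
  refine tendsto_const_nhds.congr' ?_
  obtain ⟨N, hN⟩ := exists_nat_gt (τ * v 1 - 1)⁻¹
  obtain ⟨N', hN'⟩ := exists_nat_gt (2 / |v 0|)
  have h1' : 0 < τ * v 1 - 1 := by linarith
  have h0' : 0 < |v 0| := abs_pos.2 h0
  filter_upwards [eventually_ge_atTop N, eventually_ge_atTop N'] with n hn hn'
  have a : (1 : ℝ) ≤ n * (τ * v 1 - 1) := by
    rw [← inv_le_iff_one_le_mul₀ h1']
    exact hN.le.trans (by exact_mod_cast hn)
  have b : (1 : ℝ) ≤ n * |v 0| - 1 := by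
    have : 2 / |v 0| ≤ n := hN'.le.trans (by exact_mod_cast hn')
    rw [div_le_iff₀ h0'] at this
    linarith
  rw [cutoffPair, max_eq_right (by linarith), max_eq_right (by linarith), min_eq_left a,
    min_eq_left b, one_mul]

variable [IsProbabilityMeasure P]

/-- The limiting mass of `{τ v₁ > 1}` seen from non-zero initial states cannot exceed the whole
limiting mass of `{τ X 1 > x}`, which by stationarity is the weight of `τ`. Continuous minorants and
Fatou's lemma reach the open set. -/
theorem IsStationaryRecursion.bind_pathKernel_le (hX : IsStationaryRecursion P Ψ ε X)
    (hRV : HasRegVaryingTails P (X 0) α p) (h : HasSlopesOn Ψ p φ V) (hVm : MeasurableSet V)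
    (hV : ∀ᵐ v ∂(P.map (ε 0)), v ∈ V) {κ : Kernel ℝ ℝ} [IsMarkovKernel κ]
    (hκ : ∀ x, κ x = (P.map (ε 0)).map (limitMap V p φ x)) {τ : ℝ} (hτ : τ = 1 ∨ τ = -1) :
    (tailMeasure α p).bind (pathKernel κ 1) {v | 1 < τ * v 1 ∧ v 0 ≠ 0} ≤
      ENNReal.ofReal (signWeight p τ) := by
  have hα := hRV.index_pos
  have hΦ := h.measurable_limitMap hVm hX.measurable_map
  have hcont : ∀ n, Continuous (cutoffPair τ n) := fun n => by unfold cutoffPair; fun_prop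
  have hle1 : ∀ n v, |cutoffPair τ n v| ≤ 1 := fun n v => by
    rw [abs_of_nonneg (cutoffPair_nonneg τ n v)]
    refine (cutoffPair_le τ n v).trans (indicator_le_self' (fun _ _ => zero_le_one) v)
  have hδ : ∀ n : ℕ, (0 : ℝ) < 1 / ((n : ℝ) + 1) := fun n => by positivity
  have hf0 : ∀ n : ℕ, ∀ v : Fin 2 → ℝ, |v 0| ≤ 1 / ((n : ℝ) + 1) → cutoffPair τ n v = 0 :=
    fun n v hv => by
      have : (n : ℝ) * |v 0| - 1 ≤ 0 := by
        rw [le_div_iff₀ (by positivity)] at hv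
        nlinarith [abs_nonneg (v 0)]
      rw [cutoffPair, max_eq_left this, min_eq_right zero_le_one, mul_zero]
  have hbound : ∀ n, ∫ v, cutoffPair τ n v ∂((tailMeasure α p).bind (pathKernel κ 1)) ≤
      signWeight p τ := by
    intro n
    rw [hX.integral_bind_pathKernel hΦ hκ hα 1 (hcont n).measurable (hle1 n) (hδ n) (hf0 n)]
    have hlim := hX.tendsto_integral_vec hRV hΦ 1
      (fun σ hσ hp z hz => hX.tendsto_recFlow_one h hV hσ hp hz) (hcont n) (hle1 n) (hδ n) (hf0 n)
    refine le_of_tendsto_of_tendsto hlim (hRV.tendsto_signed (hX.measurable_chain 0) hτ) ?_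
    filter_upwards [eventually_gt_atTop 0] with x hx
    refine div_le_div_of_nonneg_right ?_ measureReal_nonneg
    have hm1 : MeasurableSet {y : ℝ | x < τ * y} :=
      measurableSet_lt measurable_const (measurable_const_mul τ)
    -- Only the equality of the laws of `X 0` and `X 1` enters here.
    have e1 : P.real {ω | x < τ * X 0 ω} = P.real {ω | x < τ * X 1 ω} := by
      have a := map_measureReal_apply (μ := P) (hX.measurable_chain 0) hm1
      have b := map_measureReal_apply (μ := P) (hX.measurable_chain 1) hm1
      rw [hX.map_one] at b
      exact a.symm.trans b
    have hm2 : MeasurableSet {ω | x < τ * X 1 ω} := (hX.measurable_chain 1) hm1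
    rw [e1, ← integral_indicator_one hm2]
    refine integral_mono ?_ ((integrable_const (1 : ℝ)).indicator hm2) fun ω => ?_
    · refine Integrable.of_bound (C := 1) (Measurable.aestronglyMeasurable ?_)
        (Eventually.of_forall fun ω => hle1 n _)
      exact (hcont n).measurable.comp
        (measurable_pi_iff.2 fun j => (hX.measurable_chain j).const_mul _)
    · refine (cutoffPair_le τ n _).trans (le_of_eq ?_)
      have : (1 < τ * (x⁻¹ * X 1 ω)) ↔ x < τ * X 1 ω := by
        rw [mul_left_comm, inv_mul_eq_div, one_lt_div hx]
      simp only [indicator, mem_ofPred_eq, Fin.val_one, this, Pi.one_apply]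
  have hA := measurableSet_pair τ
  have hA0 : ∀ n : ℕ, MeasurableSet {v : Fin 2 → ℝ | 1 / ((n : ℝ) + 1) < |v 0|} := fun n =>
    measurableSet_lt measurable_const (measurable_pi_apply 0).abs
  have hint : ∀ n, ∫⁻ v, ENNReal.ofReal (cutoffPair τ n v)
      ∂((tailMeasure α p).bind (pathKernel κ 1)) ≤ ENNReal.ofReal (signWeight p τ) := fun n => by
    rw [← ofReal_integral_eq_lintegral_ofReal
      (integrable_of_bounded_of_support (hcont n).measurable (hle1 n) (hA0 n)
        (bind_pathKernel_lt_top hα (hδ n) 1).ne fun v hv => hf0 n v (not_lt.1 hv))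
      (Eventually.of_forall fun v => cutoffPair_nonneg τ n v)]
    exact ENNReal.ofReal_le_ofReal (hbound n)
  rw [← lintegral_indicator_one hA]
  calc ∫⁻ v, {v : Fin 2 → ℝ | 1 < τ * v 1 ∧ v 0 ≠ 0}.indicator 1 v
        ∂((tailMeasure α p).bind (pathKernel κ 1))
      ≤ ∫⁻ v, liminf (fun n => ENNReal.ofReal (cutoffPair τ n v)) atTop
        ∂((tailMeasure α p).bind (pathKernel κ 1)) := by
        refine lintegral_mono fun v => ?_
        by_cases hv : 1 < τ * v 1 ∧ v 0 ≠ 0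
        · rw [indicator_of_mem (by exact hv),
            (ENNReal.tendsto_ofReal (tendsto_cutoffPair hv.1 hv.2)).liminf_eq]
          simp
        · rw [indicator_of_notMem (by exact hv)]
          exact zero_le
    _ ≤ liminf (fun n => ∫⁻ v, ENNReal.ofReal (cutoffPair τ n v)
        ∂((tailMeasure α p).bind (pathKernel κ 1))) atTop :=
        lintegral_liminf_le fun n => (hcont n).measurable.ennreal_ofReal
    _ ≤ liminf (fun _ => ENNReal.ofReal (signWeight p τ)) (atTop : Filter ℕ) :=
        liminf_le_liminf (Eventually.of_forall hint)
    _ = ENNReal.ofReal (signWeight p τ) := liminf_const _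

/-- Layer-cake formula: `(u)_+^α` is the `powMeasure` of `{z | 1 < u z}`, followed by Tonelli. -/
theorem lintegral_posPow {ν : Measure S} [IsProbabilityMeasure ν] (hα : 0 < α) {g : S → ℝ}
    (hg : Measurable g) : ∫⁻ v, posPow α (g v) ∂ν =
      ∫⁻ z, ∫⁻ v, {y : ℝ | 1 < y}.indicator 1 (g v * z) ∂ν ∂(powMeasure α) := by
  rw [lintegral_lintegral_swap]
  · refine lintegral_congr fun v => ?_
    have h := powMeasure_corner hα (g v) (g v)
    rw [min_self] at h
    simp only [and_self] at h
    rw [← h, ← lintegral_indicator_one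
      (measurableSet_lt measurable_const (measurable_const_mul (g v)))]
    rfl
  · exact ((measurable_one.indicator (measurableSet_lt measurable_const measurable_id)).comp
      ((hg.comp measurable_snd).mul measurable_fst)).aemeasurable

/-- The forward law of a stationary recursion belongs to `M_{p,α}`. -/
theorem IsStationaryRecursion.isTailPairLaw_forwardLaw (hX : IsStationaryRecursion P Ψ ε X)
    (hRV : HasRegVaryingTails P (X 0) α p) (h : HasSlopesOn Ψ p φ V) (hVm : MeasurableSet V)
    (hV1 : P.map (ε 0) V = 1) : IsTailPairLaw α p (forwardLaw (P.map (ε 0)) p φ) := by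
  have := Measure.isProbabilityMeasure_map (μ := P) (hX.measurable_innov 0).aemeasurable
  have hα := hRV.index_pos
  have hp := hRV.weight_mem
  have hΨ := hX.measurable_map
  have hΦ := h.measurable_limitMap hVm hΨ
  have hV : ∀ᵐ v ∂(P.map (ε 0)), v ∈ V := (prob_compl_eq_zero_iff hVm).2 hV1
  have hfst : ∀ σ : ℝ, σ = 1 ∨ σ = -1 →
      forwardLaw (P.map (ε 0)) p φ {q | q.1 = σ} = ENNReal.ofReal (signWeight p σ) := by
    intro σ hσ
    rw [h.forwardLaw_fst hVm hΨ hV1 hp]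
    rcases hσ with rfl | rfl
    · simp [signWeight, indicator]; norm_num
    · simp [signWeight, indicator]; norm_num
  have hposm : Measurable (posPow α) :=
    ((measurable_id.max measurable_const).pow_const α).ennreal_ofReal
  refine ⟨h.isProbabilityMeasure_forwardLaw hVm hΨ hV1 hp, ?_, ?_, fun τ hτ => ?_⟩
  · rw [hfst 1 (Or.inl rfl), signWeight, if_pos rfl]
  · rw [hfst (-1) (Or.inr rfl), signWeight, if_neg (by norm_num)]
  · have hτ' : τ = 1 ∨ τ = -1 := by
      rcases hτ with h | h
      · exact Or.inr h
      · exact Or.inl h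
    rw [hfst τ hτ']
    have := isMarkovKernel_stepKernel (ν := P.map (ε 0)) hΦ
    have hκ := stepKernel_apply (ν := P.map (ε 0)) hΦ
    -- By homogeneity, the moment `E[(τ M)_+^α]` equals the mass bounded in `bind_pathKernel_le`.
    refine le_trans (le_of_eq ?_) (hX.bind_pathKernel_le hRV h hVm hV hκ hτ')
    have hA := measurableSet_pair τ
    have hind : Measurable ({y : ℝ | 1 < y}.indicator (1 : ℝ → ℝ≥0∞)) :=
      measurable_one.indicator (measurableSet_lt measurable_const measurable_id)
    have hg : Measurable fun q : ℝ × S =>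
        {y : ℝ | 1 < y}.indicator (1 : ℝ → ℝ≥0∞) (τ * limitMap V p φ q.1 q.2) :=
      hind.comp (hΦ.const_mul τ)
    have hΦx : ∀ x, Measurable (limitMap V p φ x) := fun x =>
      hΦ.comp (measurable_const.prodMk measurable_id)
    have e1 : ∫⁻ x, pathInt (stepKernel (P.map (ε 0)) (limitMap V p φ)) 1
        ({v : Fin 2 → ℝ | 1 < τ * v 1 ∧ v 0 ≠ 0}.indicator 1) x ∂(tailMeasure α p) =
        ∫⁻ x, ∫⁻ v, {y : ℝ | 1 < y}.indicator (1 : ℝ → ℝ≥0∞) (τ * limitMap V p φ x v)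
          ∂(P.map (ε 0)) ∂(tailMeasure α p) := by
      refine lintegral_congr_ae ((ae_tailMeasure_ne_zero α p).mono fun x hx => ?_)
      simp only [pathInt]
      have hf : Measurable fun y : ℝ => {y : ℝ | 1 < y}.indicator (1 : ℝ → ℝ≥0∞) (τ * y) :=
        hind.comp (measurable_const_mul τ)
      rw [hκ, ← lintegral_map hf (hΦx x)]
      refine lintegral_congr fun y => ?_
      simp [indicator, hx]
    have hF : Measurable fun q : ℝ × ℝ => posPow α (τ * q.2) :=
      hposm.comp (measurable_snd.const_mul τ)
    rw [h.lintegral_forwardLaw hVm hΨ hV1 hp hF,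
      ← lintegral_indicator_one hA, lintegral_bind_pathKernel _ 1 (measurable_one.indicator hA), e1,
      lintegral_tailMeasure _ _ hg.lintegral_prod_right',
      lintegral_posPow hα ((hΦx 1).const_mul τ), lintegral_posPow hα ((hΦx (-1)).const_mul τ)]
    congr 2
    · refine lintegral_congr_ae ((ae_powMeasure_pos α).mono fun z hz => ?_)
      refine lintegral_congr fun v => ?_
      have := limitMap_mul (V := V) (p := p) (φ := φ) hz 1 v
      rw [mul_one] at this
      rw [this]
      congr 1
      ring
    · refine lintegral_congr_ae ((ae_powMeasure_pos α).mono fun z hz => ?_)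
      refine lintegral_congr fun v => ?_
      have := limitMap_mul (V := V) (p := p) (φ := φ) hz (-1) v
      rw [mul_neg_one] at this
      rw [this]
      congr 1
      ring

end Moment

/-! ### Preservation of signs and convergence of whole paths -/

section PathConvergence

variable {Ω S : Type*} [MeasurableSpace Ω] [MeasurableSpace S] {P : Measure Ω}
  {Ψ : ℝ → S → ℝ} {ε : ℕ → Ω → S} {X : ℕ → Ω → ℝ} {V : Set S} {α p : ℝ} {φ : S → ℝ → ℝ}

theorem measurable_posPow (α : ℝ) : Measurable (posPow α) :=
  ((measurable_id.max measurable_const).pow_const α).ennreal_ofReal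

theorem posPow_eq_zero_iff {α u : ℝ} (hα : 0 < α) : posPow α u = 0 ↔ u ≤ 0 := by
  rw [posPow, ENNReal.ofReal_eq_zero]
  constructor
  · intro h
    by_contra hu
    push Not at hu
    rw [max_eq_left hu.le] at h
    exact absurd h (not_le.2 (Real.rpow_pos_of_pos hu α))
  · intro h
    rw [max_eq_right h, Real.zero_rpow hα.ne']

/-- The random maps that realise the tail kernel preserve the set of states of positive weight. -/
theorem IsTailPairLaw.ae_hasGoodSign {μ : Measure (ℝ × ℝ)} [IsFiniteMeasure μ]
    (hμ : IsTailPairLaw α p μ) (hα : 0 < α) (hp : p ∈ Icc (0 : ℝ) 1) {ν : Measure S}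
    {G : ℝ → S → ℝ} (hG : ∀ x, Measurable (G x)) (hGμ : ∀ x, tailKernel μ x = ν.map (G x))
    (hG0 : ∀ v, G 0 v = 0) (hGmul : ∀ z > 0, ∀ x v, G (z * x) v = z * G x v) :
    ∀ᵐ v ∂ν, ∀ x, HasGoodSign p x → HasGoodSign p (G x v) := by
  -- If `τ` has weight zero, the moment inequality makes `E[(τ M)_+^α]` vanish, so from a sign of
  -- positive weight the map almost surely does not move to sign `τ`.
  have key : ∀ τ ∈ ({1, -1} : Set ℝ), ∀ σ ∈ ({1, -1} : Set ℝ), ∀ᵐ v ∂ν, 0 < signWeight p σ →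
      signWeight p τ = 0 → τ * G σ v ≤ 0 := by
    intro τ hτ σ hσ
    by_cases hpos : 0 < signWeight p σ ∧ signWeight p τ = 0
    · have hF : Measurable fun q : ℝ × ℝ => posPow α (τ * q.2) :=
        (measurable_posPow α).comp (measurable_snd.const_mul τ)
      have hF' : Measurable fun y : ℝ => posPow α (τ * y) :=
        (measurable_posPow α).comp (measurable_const_mul τ)
      have h1 := hμ.lintegral_eq hp hF
      simp only [hGμ] at h1
      rw [lintegral_map hF' (hG 1), lintegral_map hF' (hG (-1))] at h1
      have h2 : ∫⁻ q, posPow α (τ * q.2) ∂μ = 0 := by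
        refine le_antisymm ((hμ.moment τ (Set.pair_comm (1 : ℝ) (-1) ▸ hτ)).trans ?_) zero_le
        rcases hτ with rfl | rfl
        · rw [hμ.plus]
          have := hpos.2
          rw [signWeight, if_pos rfl] at this
          rw [this, ENNReal.ofReal_zero]
        · rw [hμ.minus]
          have := hpos.2
          rw [signWeight, if_neg (by norm_num)] at this
          rw [this, ENNReal.ofReal_zero]
      rw [h2] at h1
      obtain ⟨h3, h4⟩ := add_eq_zero.1 h1.symm
      have h5 : ∫⁻ v, posPow α (τ * G σ v) ∂ν = 0 := by
        have hpos1 := hpos.1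
        rcases hσ with rfl | rfl
        · rw [signWeight, if_pos rfl] at hpos1
          exact (mul_eq_zero.1 h3).resolve_left (ENNReal.ofReal_pos.2 hpos1).ne'
        · rw [signWeight, if_neg (by norm_num)] at hpos1
          exact (mul_eq_zero.1 h4).resolve_left (ENNReal.ofReal_pos.2 hpos1).ne'
      have hFG : Measurable fun v => posPow α (τ * G σ v) :=
        (measurable_posPow α).comp ((hG σ).const_mul τ)
      rw [lintegral_eq_zero_iff hFG] at h5
      filter_upwards [h5] with v hv _ _
      exact (posPow_eq_zero_iff hα).1 hv
    · exact Eventually.of_forall fun v a b => absurd ⟨a, b⟩ hpos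
  have hc : ({1, -1} : Set ℝ).Countable := (Set.toFinite _).countable
  filter_upwards [(ae_ball_iff hc).2 fun τ hτ => (ae_ball_iff hc).2 (key τ hτ)] with v hv x hx
  rcases eq_or_ne x 0 with rfl | hx0
  · exact Or.inl (hG0 v)
  have hx := hx.resolve_left hx0
  by_contra hbad
  rw [HasGoodSign, not_or, not_lt] at hbad
  set y := G x v with hy
  have hsx : Real.sign x ∈ ({1, -1} : Set ℝ) := Real.sign_eq_one_or_neg_one hx0
  have hsy : Real.sign y ∈ ({1, -1} : Set ℝ) := Real.sign_eq_one_or_neg_one hbad.1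
  have h1 := hv _ hsy _ hsx hx (le_antisymm hbad.2 (signWeight_nonneg hp _))
  have hxx : x = |x| * Real.sign x := by
    rcases lt_or_gt_of_ne hx0 with h | h
    · rw [abs_of_neg h, Real.sign_of_neg h]; ring
    · rw [abs_of_pos h, Real.sign_of_pos h]; ring
  have h2 : y = |x| * G (Real.sign x) v := by
    rw [hy]
    nth_rewrite 1 [hxx]
    exact hGmul _ (abs_pos.2 hx0) _ v
  have h3 : 0 < Real.sign y * y := by
    rcases lt_or_gt_of_ne hbad.1 with h | h
    · rw [Real.sign_of_neg h]; linarith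
    · rw [Real.sign_of_pos h]; linarith
  rw [h2, mul_left_comm, ← h2] at h3
  exact absurd h3 (not_lt.2 (mul_nonpos_of_nonneg_of_nonpos (abs_nonneg x) h1))

theorem HasSlopesOn.ae_hasGoodSign {ν : Measure S} [IsProbabilityMeasure ν]
    (h : HasSlopesOn Ψ p φ V) (hVm : MeasurableSet V) (hΨ : Measurable (Function.uncurry Ψ))
    (hν : ν V = 1) (hα : 0 < α) (hp : p ∈ Icc (0 : ℝ) 1)
    (hμ : IsTailPairLaw α p (forwardLaw ν p φ)) :
    ∀ᵐ v ∂ν, ∀ x, HasGoodSign p x → HasGoodSign p (limitMap V p φ x v) := by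
  have := hμ.prob
  exact hμ.ae_hasGoodSign hα hp
    (fun x => (h.measurable_limitMap hVm hΨ).comp (measurable_const.prodMk measurable_id))
    (h.tailKernel_forwardLaw hVm hΨ hν hp) (fun v => by rw [limitMap, zero_mul])
    fun z hz x v => limitMap_mul hz x v

/-- Convergence of the rescaled recursion, started far away, to the limit recursion. -/
theorem IsStationaryRecursion.tendsto_recFlow_limitMap [IsProbabilityMeasure P]
    (hX : IsStationaryRecursion P Ψ ε X)
    (h : HasSlopesOn Ψ p φ V) (hVm : MeasurableSet V) (hV1 : P.map (ε 0) V = 1)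
    (hW : (∃ σ ∈ ({-1, 1} : Set ℝ), 0 < signWeight p σ ∧ 0 < P.map (ε 0) {v | φ v σ = 0}) →
      ∃ W : Set S, W ⊆ V ∧ MeasurableSet W ∧ P.map (ε 0) W = 1 ∧
        ∀ v ∈ W, LinearlyBounded fun x => Ψ x v)
    (hgood : ∀ᵐ v ∂(P.map (ε 0)), ∀ x, HasGoodSign p x → HasGoodSign p (limitMap V p φ x v))
    {σ : ℝ} (hσ : σ = 1 ∨ σ = -1) (hp : 0 < signWeight p σ) {z : ℝ} (hz : 0 < z) :
    ∀ᵐ ω ∂P, ∀ ζ : ℝ → ℝ, Tendsto ζ atTop (𝓝 (σ * z)) → ∀ k,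
        Tendsto (fun x => x⁻¹ * recFlow Ψ k (x * ζ x) (fun i => ε i ω)) atTop
          (𝓝 (recFlow (limitMap V p φ) k (σ * z) (fun i => ε i ω))) := by
  have := Measure.isProbabilityMeasure_map (μ := P) (hX.measurable_innov 0).aemeasurable
  have hV : ∀ᵐ v ∂(P.map (ε 0)), v ∈ V := (prob_compl_eq_zero_iff hVm).2 hV1
  -- Either the slopes almost surely do not vanish and the limit path never reaches `0`, or the
  -- second part of the hypothesis supplies linear growth.
  have hlin : (∀ᵐ v ∂(P.map (ε 0)), ∀ σ : ℝ, σ = 1 ∨ σ = -1 → 0 < signWeight p σ →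
      limitSlope V p φ v σ ≠ 0) ∨ ∀ᵐ v ∂(P.map (ε 0)), LinearlyBounded fun x => Ψ x v := by
    by_cases hz : ∃ σ ∈ ({-1, 1} : Set ℝ), 0 < signWeight p σ ∧ 0 < P.map (ε 0) {v | φ v σ = 0}
    · obtain ⟨W, -, hWm, hW1, hWb⟩ := hW hz
      have hWae : ∀ᵐ v ∂(P.map (ε 0)), v ∈ W := (prob_compl_eq_zero_iff hWm).2 hW1
      exact Or.inr (hWae.mono hWb)
    · left
      push Not at hz
      have hc : ({-1, 1} : Set ℝ).Countable := (Set.toFinite _).countable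
      have : ∀ σ ∈ ({-1, 1} : Set ℝ), ∀ᵐ v ∂(P.map (ε 0)), 0 < signWeight p σ → φ v σ ≠ 0 := by
        intro σ hσ
        by_cases hpos : 0 < signWeight p σ
        · have h0 := nonpos_iff_eq_zero.1 (hz σ hσ hpos)
          exact (measure_eq_zero_iff_ae_notMem.1 h0).mono fun v hv _ => hv
        · exact Eventually.of_forall fun v h => absurd h hpos
      filter_upwards [(ae_ball_iff hc).2 this, hV] with v hv hvV σ hσ hpos
      rw [limitSlope, if_pos ⟨hvV, hσ, hpos⟩]
      exact hv σ hσ.symm hpos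
  have hzg : σ * z ≠ 0 ∧ HasGoodSign p (σ * z) := by
    refine ⟨?_, Or.inr (by rwa [sign_mul_of_pos hσ hz])⟩
    rcases hσ with rfl | rfl
    · linarith
    · linarith
  have h3 : ∀ᵐ ω ∂P, ((∃ k, ∃ σ : ℝ, (σ = 1 ∨ σ = -1) ∧ 0 < signWeight p σ ∧
      limitSlope V p φ (ε k ω) σ = 0) → ∀ k, LinearlyBounded fun x => Ψ x (ε k ω)) := by
    rcases hlin with hl | hl
    · filter_upwards [hX.ae_innov_mem hl] with ω hω
      rintro ⟨k, σ, hσ, hpos, h0⟩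
      exact absurd h0 (hω k σ hσ hpos)
    · filter_upwards [hX.ae_innov_mem hl] with ω hω _
      exact hω
  filter_upwards [hX.ae_innov_mem hV, hX.ae_innov_mem hgood, h3] with ω hωV hωg hω3 ζ hζ k
  exact tendsto_recFlow (n := k) (fun k σ hσ hp => h.tendsto hσ hp (hωV k))
    (fun k _ => hωg k) (fun ⟨k, _, hk⟩ => hω3 ⟨k, hk⟩) hzg.1 hzg.2 hζ k le_rfl

end PathConvergence

/-! ### The tail measure of the chain: finiteness and recursion -/

theorem measurable_finTail {n : ℕ} : Measurable (Fin.tail : (Fin (n + 1) → ℝ) → Fin n → ℝ) :=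
  measurable_pi_iff.2 fun _ => measurable_pi_apply _

/-- The vectors with some coordinate of modulus larger than `δ`. -/
def exceedSet (n : ℕ) (δ : ℝ) : Set (Fin (n + 1) → ℝ) := {v | ∃ i, δ < |v i|}

theorem measurableSet_exceedSet (n : ℕ) (δ : ℝ) : MeasurableSet (exceedSet n δ) := by
  have : exceedSet n δ = ⋃ i, {v : Fin (n + 1) → ℝ | δ < |v i|} := by
    ext v; simp [exceedSet]
  rw [this]
  exact MeasurableSet.iUnion fun i => measurableSet_lt measurable_const (measurable_pi_apply i).abs

theorem notMem_exceedSet {n : ℕ} {δ : ℝ} {v : Fin (n + 1) → ℝ} :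
    v ∉ exceedSet n δ ↔ ∀ i, |v i| ≤ δ := by
  simp [exceedSet]

section ChainMeasure

variable {κ κ' : Kernel ℝ ℝ} [IsMarkovKernel κ] [IsMarkovKernel κ'] {l l₁ l₁' : Measure ℝ}

theorem lintegral_chainMeasure_stationary (h0 : κ 0 = Measure.dirac 0)
    (hd : AreDualKernels κ κ' l l₁ l₁') (n : ℕ) {g : (Fin (n + 1) → ℝ) → ℝ≥0∞}
    (hg : Measurable g) (hg0 : g 0 = 0) :
    ∫⁻ v, g v ∂(chainMeasure κ l₁ l n) =
      ∫⁻ v, g v ∂((l.bind (pathKernel κ (n + 1))).map Fin.tail + chainMeasure κ l₁ l₁ n) := by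
  have hgt : Measurable fun v : Fin (n + 2) → ℝ => g (Fin.tail v) := hg.comp measurable_finTail
  rw [lintegral_add_measure, lintegral_map hg measurable_finTail,
    lintegral_bind_pathKernel _ _ hgt, lintegral_chainMeasure _ _ _ hg,
    lintegral_chainMeasure _ _ _ hg, tailInt_stationary h0 hd n hg hg0]

/-- Dropping the first coordinate of the limit measure gives the one of lower dimension, but only
off the origin: paths that are zero after their first coordinate project to it. -/
theorem chainMeasure_restrict_ne_zero (h0 : κ 0 = Measure.dirac 0)
    (hd : AreDualKernels κ κ' l l₁ l₁') (n : ℕ) :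
    (chainMeasure κ l₁ l n).restrict {0}ᶜ =
      ((l.bind (pathKernel κ (n + 1))).map Fin.tail + chainMeasure κ l₁ l₁ n).restrict {0}ᶜ := by
  ext B hB
  have hB' := hB.inter (measurableSet_singleton (0 : Fin (n + 1) → ℝ)).compl
  rw [Measure.restrict_apply hB, Measure.restrict_apply hB, ← lintegral_indicator_one hB',
    ← lintegral_indicator_one hB']
  exact lintegral_chainMeasure_stationary h0 hd n (measurable_one.indicator hB') (by simp)

theorem bind_pathKernel_fst (n : ℕ) {A : Set ℝ} (hA : MeasurableSet A) :
    l.bind (pathKernel κ n) {v | v 0 ∈ A} = l A := by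
  have hA' : MeasurableSet {v : Fin (n + 1) → ℝ | v 0 ∈ A} := measurable_pi_apply 0 hA
  rw [← lintegral_indicator_one hA', lintegral_bind_pathKernel _ n (measurable_one.indicator hA'),
    ← lintegral_indicator_one hA]
  refine lintegral_congr fun x => ?_
  rw [pathInt_congr (g := fun _ => A.indicator 1 x) n fun v hv => ?_, pathInt_const]
  subst hv
  rfl

/-- An exceedance occurs in the first coordinate, which is controlled by `l`, or in the remaining
ones, which by stationarity of the limit measure are controlled by the previous dimension. -/
theorem chainMeasure_exceedSet (h0 : κ 0 = Measure.dirac 0)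
    (hd : AreDualKernels κ κ' l l₁ l₁') {δ : ℝ} (hδ : 0 < δ) (hl : l {x | δ < |x|} < ∞) (n : ℕ) :
    chainMeasure κ l₁ l n (exceedSet n δ) < ∞ := by
  have hA : MeasurableSet {x : ℝ | δ < |x|} := measurableSet_lt measurable_const measurable_id.abs
  induction n with
  | zero =>
    have : exceedSet 0 δ = {v : Fin 1 → ℝ | v 0 ∈ {x : ℝ | δ < |x|}} := by
      ext v; simp [exceedSet]
    rw [this, chainMeasure, bind_pathKernel_fst 0 hA]
    exact hl
  | succ n ih =>
    have hE := measurableSet_exceedSet n δ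
    have hs := lintegral_chainMeasure_stationary h0 hd n (measurable_one.indicator hE)
      (indicator_of_notMem (notMem_exceedSet.2 fun i => by simpa using hδ.le) _)
    rw [lintegral_indicator_one hE, lintegral_indicator_one hE, Measure.add_apply,
      Measure.map_apply measurable_finTail hE] at hs
    rw [hs, ENNReal.add_lt_top] at ih
    rw [chainMeasure, Measure.add_apply,
      Measure.map_apply measurable_finCons_zero (measurableSet_exceedSet _ _), ENNReal.add_lt_top]
    constructor
    · have hsub : exceedSet (n + 1) δ ⊆ {v | v 0 ∈ {x : ℝ | δ < |x|}} ∪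
          Fin.tail ⁻¹' exceedSet n δ := by
        rintro v ⟨i, hi⟩
        refine Fin.cases (fun hi => Or.inl hi) (fun i hi => Or.inr ⟨i, hi⟩) i hi
      refine ((measure_mono hsub).trans (measure_union_le _ _)).trans_lt ?_
      rw [bind_pathKernel_fst _ hA]
      exact ENNReal.add_lt_top.2 ⟨hl, ih.1⟩
    · refine lt_of_le_of_lt (measure_mono ?_) ih.2
      rintro v ⟨i, hi⟩
      refine Fin.cases (fun hi => ?_) (fun i hi => ⟨i, by simpa using hi⟩) i hi
      simp only [Fin.cons_zero, abs_zero] at hi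
      exact absurd hi (not_lt.2 hδ.le)

/-- The limit counterpart of the decomposition `f = [f - f(0, ·)] + f(0, ·)`: the bracket vanishes
on the summands with a leading zero, and stationarity lowers the dimension in the last term. Since
`f` is signed, integrability of every piece has to be checked. -/
theorem integral_chainMeasure_succ (h0 : κ 0 = Measure.dirac 0)
    (hd : AreDualKernels κ κ' l l₁ l₁') {δ : ℝ} (hδ : 0 < δ) (hl : l {x | δ < |x|} < ∞) (n : ℕ)
    {f : (Fin (n + 2) → ℝ) → ℝ} (hf : Measurable f) {C : ℝ} (hC : ∀ v, |f v| ≤ C)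
    (hf0 : ∀ v, (∀ i, |v i| ≤ δ) → f v = 0) :
    ∫ v, f v ∂(chainMeasure κ l₁ l (n + 1)) =
      ∫ v, (f v - f (Fin.cons 0 (Fin.tail v))) ∂(l.bind (pathKernel κ (n + 1))) +
        ∫ v, f (Fin.cons 0 v) ∂(chainMeasure κ l₁ l n) := by
  have hg : Measurable fun v : Fin (n + 1) → ℝ => f (Fin.cons 0 v) :=
    hf.comp measurable_finCons_zero
  have hg0 : ∀ v ∉ exceedSet n δ, f (Fin.cons 0 v) = 0 := fun v hv => by
    refine hf0 _ fun i => ?_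
    refine Fin.cases (by simpa using hδ.le) (fun i => ?_) i
    simpa using notMem_exceedSet.1 hv i
  have hE := chainMeasure_exceedSet h0 hd hδ hl
  have i1 : Integrable f (chainMeasure κ l₁ l (n + 1)) :=
    integrable_of_bounded_of_support hf hC (measurableSet_exceedSet _ δ) (hE _).ne
      fun v hv => hf0 v (notMem_exceedSet.1 hv)
  have i2 : Integrable (fun v => f (Fin.cons 0 v)) (chainMeasure κ l₁ l n) :=
    integrable_of_bounded_of_support hg (fun v => hC _) (measurableSet_exceedSet _ δ) (hE _).ne hg0
  rw [chainMeasure, integrable_add_measure] at i1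
  obtain ⟨i3, i4⟩ := i1
  have hz : ∀ v : Fin (n + 1) → ℝ, v ∉ ({0}ᶜ : Set (Fin (n + 1) → ℝ)) → f (Fin.cons 0 v) = 0 := by
    intro v hv
    rw [notMem_compl_iff] at hv
    rw [mem_singleton_iff.1 hv]
    exact hg0 _ (notMem_exceedSet.2 fun i => by simpa using hδ.le)
  have hsplit := chainMeasure_restrict_ne_zero h0 hd n
  have i5 : Integrable (fun v => f (Fin.cons 0 v))
      ((l.bind (pathKernel κ (n + 1))).map Fin.tail + chainMeasure κ l₁ l₁ n) := by
    rw [← integrableOn_iff_integrable_of_support_subset (s := {0}ᶜ)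
      (fun v hv => by_contra fun h => hv (hz v h)), IntegrableOn, ← hsplit]
    exact i2.restrict
  have e1 : ∫ v, f (Fin.cons 0 v) ∂(chainMeasure κ l₁ l n) =
      ∫ v, f (Fin.cons 0 v)
        ∂((l.bind (pathKernel κ (n + 1))).map Fin.tail + chainMeasure κ l₁ l₁ n) := by
    rw [← setIntegral_eq_integral_of_forall_compl_eq_zero (s := {0}ᶜ) hz, hsplit,
      setIntegral_eq_integral_of_forall_compl_eq_zero (s := {0}ᶜ) hz]
  rw [integrable_add_measure] at i5
  obtain ⟨i6, i7⟩ := i5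
  have i8 : Integrable (fun v => f (Fin.cons 0 (Fin.tail v))) (l.bind (pathKernel κ (n + 1))) :=
    (integrable_map_measure hg.aestronglyMeasurable measurable_finTail.aemeasurable).1 i6
  rw [e1, integral_add_measure i6 i7, integral_sub i3 i8,
    integral_map measurable_finTail.aemeasurable hg.aestronglyMeasurable, chainMeasure,
    integral_add_measure i3 i4,
    integral_map measurable_finCons_zero.aemeasurable hf.aestronglyMeasurable]
  ring

end ChainMeasure

/-! ### Convergence of the rescaled chain -/

theorem continuous_toCube {d : ℕ} : Continuous (toCube (d := d)) :=
  continuous_pi fun j => continuous_coe_real_ereal.comp (continuous_apply j)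

theorem toCube_cons {d : ℕ} (x : ℝ) (v : Fin d → ℝ) :
    toCube (Fin.cons x v : Fin (d + 1) → ℝ) = Fin.cons (x : EReal) (toCube v) := by
  funext j
  refine Fin.cases ?_ (fun j => ?_) j <;> simp [toCube]

/-- Uniformity in the remaining coordinates comes from compactness of `[-∞, ∞]^n`, through the tube
lemma. -/
theorem exists_abs_sub_cons_lt {n : ℕ} {f : (Fin (n + 1) → EReal) → ℝ} (hf : Continuous f)
    {r : ℝ} (hr : 0 < r) : ∃ η > 0, ∀ y : ℝ, |y| < η → ∀ v : Fin n → ℝ,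
      |f (toCube (Fin.cons y v)) - f (toCube (Fin.cons 0 v))| < r := by
  set g : EReal × (Fin n → EReal) → ℝ := fun q => f (Fin.cons q.1 q.2) - f (Fin.cons 0 q.2) with hg
  have hgc : Continuous g := by
    refine Continuous.sub (hf.comp ?_) (hf.comp ?_)
    · exact Continuous.finCons (A := fun _ => EReal) continuous_fst continuous_snd
    · exact Continuous.finCons (A := fun _ => EReal) continuous_const continuous_snd
  have hopen : IsOpen {q | |g q| < r} := isOpen_lt hgc.abs continuous_const
  obtain ⟨u, v, hu, -, hu0, hv, huv⟩ := generalized_tube_lemma (s := {(0 : EReal)})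
    isCompact_singleton (isCompact_univ (X := Fin n → EReal)) hopen (by
      rintro ⟨a, b⟩ ⟨ha, -⟩
      rw [mem_singleton_iff] at ha
      simp only at ha
      subst ha
      simpa [hg] using hr)
  have h0 : ∀ᶠ y : ℝ in 𝓝 0, (y : EReal) ∈ u :=
    continuous_coe_real_ereal.continuousAt.eventually (hu.mem_nhds (hu0 rfl))
  obtain ⟨η, hη, hball⟩ := Metric.eventually_nhds_iff.1 h0
  refine ⟨η, hη, fun y hy w => ?_⟩
  have := huv (mk_mem_prod (hball (by simpa [Real.dist_eq] using hy)) (hv (mem_univ (toCube w))))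
  simpa [hg, toCube_cons] using this

/-- A continuous function that vanishes for `|y| ≤ η` and equals `1` for `|y| ≥ 2 η`. -/
noncomputable def cutoffAbs (η y : ℝ) : ℝ := min 1 (max 0 (|y| / η - 1))

theorem continuous_cutoffAbs (η : ℝ) : Continuous (cutoffAbs η) := by
  unfold cutoffAbs; fun_prop

theorem cutoffAbs_mem (η y : ℝ) : cutoffAbs η y ∈ Icc (0 : ℝ) 1 :=
  ⟨le_min zero_le_one (le_max_left _ _), min_le_left _ _⟩

theorem cutoffAbs_eq_zero {η y : ℝ} (hη : 0 < η) (h : |y| ≤ η) : cutoffAbs η y = 0 := by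
  have : |y| / η - 1 ≤ 0 := by rw [sub_nonpos, div_le_one hη]; exact h
  rw [cutoffAbs, max_eq_left this, min_eq_right zero_le_one]

theorem cutoffAbs_eq_one {η y : ℝ} (hη : 0 < η) (h : 2 * η ≤ |y|) : cutoffAbs η y = 1 := by
  have : 1 ≤ |y| / η - 1 := by rw [le_sub_iff_add_le, le_div_iff₀ hη]; linarith
  rw [cutoffAbs, max_eq_right (by linarith), min_eq_left this]

section Convergence

variable {Ω S : Type*} [MeasurableSpace Ω] [MeasurableSpace S] {P : Measure Ω}
  [IsProbabilityMeasure P]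
  {Ψ : ℝ → S → ℝ} {ε : ℕ → Ω → S} {X : ℕ → Ω → ℝ} {α p : ℝ} {Φ : ℝ → S → ℝ}

theorem IsStationaryRecursion.map_eq (hX : IsStationaryRecursion P Ψ ε X) (n : ℕ) :
    P.map (X n) = P.map (X 0) := by
  induction n with
  | zero => rfl
  | succ n ih =>
    rw [← ih]
    have h := congrArg (fun m => m.map (fun v : Fin (n + 1) → ℝ => v (Fin.last n)))
      (hX.map_vec_succ n)
    rw [Measure.map_map (measurable_pi_apply _)
      (measurable_pi_iff.2 fun j => hX.measurable_chain _),
      Measure.map_map (measurable_pi_apply _)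
      (measurable_pi_iff.2 fun j => hX.measurable_chain _)] at h
    simpa [Function.comp_def] using h

theorem IsStationaryRecursion.exists_bound_exceedSet (hX : IsStationaryRecursion P Ψ ε X)
    (hRV : HasRegVaryingTails P (X 0) α p) (n : ℕ) {δ : ℝ} (hδ : 0 < δ) :
    ∃ K : ℝ, ∀ᶠ x : ℝ in atTop, P.real {ω | (fun j : Fin (n + 1) => x⁻¹ * X j ω) ∈ exceedSet n δ} /
      P.real {ω | x < |X 0 ω|} ≤ K := by
  have h1 := (hRV.tendsto_abs δ hδ).const_mul ((n : ℝ) + 1)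
  refine ⟨((n : ℝ) + 1) * δ ^ (-α) + 1, ?_⟩
  filter_upwards [h1.eventually_le_const (lt_add_one _), eventually_gt_atTop 0] with x hx hx0
  refine le_trans ?_ hx
  rw [← mul_div_assoc]
  refine div_le_div_of_nonneg_right ?_ measureReal_nonneg
  have hset : {ω | (fun j : Fin (n + 1) => x⁻¹ * X j ω) ∈ exceedSet n δ} =
      ⋃ j : Fin (n + 1), {ω | x * δ < |X j ω|} := by
    ext ω
    simp only [exceedSet, mem_ofPred_eq, mem_iUnion, abs_mul, abs_of_pos (inv_pos.2 hx0)]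
    refine exists_congr fun j => ?_
    rw [lt_inv_mul_iff₀ hx0]
  have hm : MeasurableSet {y : ℝ | x * δ < |y|} :=
    measurableSet_lt measurable_const measurable_id.abs
  have heq : ∀ j, P.real {ω | x * δ < |X j ω|} = P.real {ω | x * δ < |X 0 ω|} := fun j => by
    have a := map_measureReal_apply (μ := P) (hX.measurable_chain j) hm
    have b := map_measureReal_apply (μ := P) (hX.measurable_chain 0) hm
    rw [hX.map_eq j] at a
    exact a.symm.trans b
  rw [hset]
  refine (measureReal_iUnion_fintype_le _).trans (le_of_eq ?_)
  simp [heq]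

/-- Multiplying `D` by a cutoff in the first coordinate gives the case already treated. The error is
uniformly small and supported where some coordinate exceeds `δ`, an event whose probability is of
the order of the normalisation. -/
theorem IsStationaryRecursion.tendsto_integral_sub (hX : IsStationaryRecursion P Ψ ε X)
    (hRV : HasRegVaryingTails P (X 0) α p) (hΦ : Measurable (Function.uncurry Φ))
    {κ : Kernel ℝ ℝ} [IsMarkovKernel κ] (hκ : ∀ x, κ x = (P.map (ε 0)).map (Φ x)) (n : ℕ)
    (hpath : ∀ σ : ℝ, σ = 1 ∨ σ = -1 → 0 < signWeight p σ → ∀ z > 0, ∀ᵐ ω ∂P, ∀ ζ : ℝ → ℝ,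
      Tendsto ζ atTop (𝓝 (σ * z)) → ∀ j ≤ n,
        Tendsto (fun x => x⁻¹ * recFlow Ψ j (x * ζ x) (fun i => ε i ω)) atTop
          (𝓝 (recFlow Φ j (σ * z) (fun i => ε i ω))))
    {D : (Fin (n + 1) → ℝ) → ℝ} (hD : Continuous D) {C δ : ℝ} (hC : ∀ v, |D v| ≤ C) (hδ : 0 < δ)
    (hD0 : ∀ v, (∀ i, |v i| ≤ δ) → D v = 0)
    (hDu : ∀ r > 0, ∃ η > 0, ∀ v, |v 0| < η → |D v| ≤ r)
    (hfin : (tailMeasure α p).bind (pathKernel κ n) (exceedSet n δ) < ∞) :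
    Tendsto (fun x => (∫ ω, D (fun j => x⁻¹ * X j ω) ∂P) / P.real {ω | x < |X 0 ω|}) atTop
      (𝓝 (∫ v, D v ∂((tailMeasure α p).bind (pathKernel κ n)))) := by
  have hα := hRV.index_pos
  set ρ := (tailMeasure α p).bind (pathKernel κ n) with hρ
  have hη : ∀ m : ℕ, (0 : ℝ) < 1 / ((m : ℝ) + 1) := fun m => by positivity
  set Dη : ℕ → (Fin (n + 1) → ℝ) → ℝ := fun m v => cutoffAbs (1 / ((m : ℝ) + 1)) (v 0) * D v with hDη
  have hDηc : ∀ m, Continuous (Dη m) := fun m =>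
    ((continuous_cutoffAbs _).comp (continuous_apply 0)).mul hD
  have hDηle : ∀ m v, |Dη m v| ≤ |D v| := fun m v => by
    rw [hDη, abs_mul, abs_of_nonneg (cutoffAbs_mem _ _).1]
    exact mul_le_of_le_one_left (abs_nonneg _) (cutoffAbs_mem _ _).2
  have hlim1 : ∀ m, Tendsto (fun x => (∫ ω, Dη m (fun j => x⁻¹ * X j ω) ∂P) /
      P.real {ω | x < |X 0 ω|}) atTop (𝓝 (∫ v, Dη m v ∂ρ)) := fun m => by
    have h0 : ∀ v : Fin (n + 1) → ℝ, |v 0| ≤ 1 / ((m : ℝ) + 1) → Dη m v = 0 := fun v hv => by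
      rw [hDη]; simp only; rw [cutoffAbs_eq_zero (hη m) hv, zero_mul]
    rw [hρ, hX.integral_bind_pathKernel hΦ hκ hα n (hDηc m).measurable
      (fun v => (hDηle m v).trans (hC v)) (hη m) h0]
    exact hX.tendsto_integral_vec hRV hΦ n hpath (hDηc m) (fun v => (hDηle m v).trans (hC v))
      (hη m) h0
  -- Since the first coordinate is almost everywhere non-zero, the cutoffs converge to `1` and
  -- removing them does not change the limit integral.
  have hR0 : ∀ᵐ v ∂ρ, v 0 ≠ 0 := by
    have : ρ {v | v 0 ∈ ({0} : Set ℝ)} = 0 := by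
      rw [hρ, bind_pathKernel_fst n (measurableSet_singleton 0)]
      exact (measure_eq_zero_iff_ae_notMem.2 ((ae_tailMeasure_ne_zero α p).mono fun x hx => hx))
    exact measure_eq_zero_iff_ae_notMem.1 this
  have hDint : Integrable D ρ := integrable_of_bounded_of_support hD.measurable hC
    (measurableSet_exceedSet n δ) hfin.ne fun v hv => hD0 v (notMem_exceedSet.1 hv)
  have hlim2 : Tendsto (fun m => ∫ v, Dη m v ∂ρ) atTop (𝓝 (∫ v, D v ∂ρ)) := by
    refine tendsto_integral_of_dominated_convergence (fun v => |D v|)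
      (fun m => (hDηc m).measurable.aestronglyMeasurable) hDint.abs
      (fun m => Eventually.of_forall (hDηle m)) (hR0.mono fun v hv => ?_)
    refine tendsto_const_nhds.congr' ?_
    obtain ⟨N, hN⟩ := exists_nat_gt (2 / |v 0|)
    filter_upwards [eventually_ge_atTop N] with m hm
    have hv' : 0 < |v 0| := abs_pos.2 hv
    have : 2 * (1 / ((m : ℝ) + 1)) ≤ |v 0| := by
      rw [mul_one_div, div_le_iff₀ (by positivity), mul_comm, ← div_le_iff₀ hv']
      have : (N : ℝ) ≤ m := by exact_mod_cast hm
      linarith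
    rw [hDη]; simp only; rw [cutoffAbs_eq_one (hη m) this, one_mul]
  obtain ⟨K, hK⟩ := hX.exists_bound_exceedSet hRV n hδ
  rw [Metric.tendsto_nhds]
  intro r hr
  -- The three errors are at most `r' * |K|`, `r'` and `r'`, with sum below `r' * (|K| + 3) = r`.
  set r' := r / (|K| + 3) with hr'
  have hr'pos : 0 < r' := by positivity
  obtain ⟨η, hηpos, hηu⟩ := hDu r' hr'pos
  -- With this choice the cutoff equals `1` for `|v 0| ≥ η`, so it modifies `D` only where `|D| ≤
  -- r'`.
  have hsmall : ∀ᶠ m : ℕ in atTop, 2 * (1 / ((m : ℝ) + 1)) < η := by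
    have := (tendsto_one_div_add_atTop_nhds_zero_nat (𝕜 := ℝ)).const_mul 2
    rw [mul_zero] at this
    exact this.eventually_lt_const hηpos
  obtain ⟨m, hm1, hm2⟩ := (hsmall.and (Metric.tendsto_nhds.1 hlim2 r' hr'pos)).exists
  have hdiff : ∀ v, |D v - Dη m v| ≤ (exceedSet n δ).indicator (fun _ => r') v := by
    intro v
    by_cases hv : v ∈ exceedSet n δ
    · rw [indicator_of_mem hv]
      by_cases hv0 : |v 0| < η
      · have e : D v - Dη m v = (1 - cutoffAbs (1 / ((m : ℝ) + 1)) (v 0)) * D v := by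
          rw [hDη]; ring
        have hc := cutoffAbs_mem (1 / ((m : ℝ) + 1)) (v 0)
        rw [e, abs_mul, abs_of_nonneg (by linarith [hc.2])]
        exact (mul_le_of_le_one_left (abs_nonneg _) (by linarith [hc.1])).trans (hηu v hv0)
      · have : Dη m v = D v := by
          rw [hDη]; simp only; rw [cutoffAbs_eq_one (hη m) (by linarith), one_mul]
        rw [this, sub_self, abs_zero]
        exact hr'pos.le
    · have h0 := hD0 v (notMem_exceedSet.1 hv)
      rw [indicator_of_notMem hv, hDη]
      simp [h0]
  filter_upwards [hK, Metric.tendsto_nhds.1 (hlim1 m) r' hr'pos] with x hx hxm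
  have hvec : Measurable fun ω => (fun j : Fin (n + 1) => x⁻¹ * X j ω) :=
    measurable_pi_iff.2 fun j => (hX.measurable_chain j).const_mul _
  have hT : 0 < P.real {ω | x < |X 0 ω|} := hRV.real_tail_pos x
  have hb : |(∫ ω, D (fun j => x⁻¹ * X j ω) ∂P) / P.real {ω | x < |X 0 ω|} -
      (∫ ω, Dη m (fun j => x⁻¹ * X j ω) ∂P) / P.real {ω | x < |X 0 ω|}| ≤ r' * |K| := by
    have hi : ∀ {F : (Fin (n + 1) → ℝ) → ℝ}, Continuous F → (∀ v, |F v| ≤ C) →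
        Integrable (fun ω => F (fun j : Fin (n + 1) => x⁻¹ * X j ω)) P := fun hF hb =>
      Integrable.of_bound (hF.measurable.comp hvec).aestronglyMeasurable C
        (Eventually.of_forall fun ω => hb _)
    have hE : MeasurableSet {ω | (fun j : Fin (n + 1) => x⁻¹ * X j ω) ∈ exceedSet n δ} :=
      hvec (measurableSet_exceedSet n δ)
    rw [← sub_div, ← integral_sub (hi hD hC) (hi (hDηc m) fun v => (hDηle m v).trans (hC v)),
      abs_div, abs_of_pos hT]
    have h1 : |∫ ω, (D (fun j => x⁻¹ * X j ω) - Dη m (fun j => x⁻¹ * X j ω)) ∂P| ≤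
        ∫ ω, {ω | (fun j : Fin (n + 1) => x⁻¹ * X j ω) ∈ exceedSet n δ}.indicator
          (fun _ => r') ω ∂P := by
      rw [← Real.norm_eq_abs]
      exact norm_integral_le_of_norm_le ((integrable_const r').indicator hE)
        (Eventually.of_forall fun ω => hdiff _)
    rw [integral_indicator hE, setIntegral_const, smul_eq_mul] at h1
    refine (div_le_div_of_nonneg_right h1 hT.le).trans ?_
    rw [mul_div_right_comm, mul_comm]
    exact mul_le_mul_of_nonneg_left (hx.trans (le_abs_self K)) hr'pos.le
  rw [Real.dist_eq] at hxm hm2 ⊢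
  have htri : ∀ a b c d : ℝ, |a - d| ≤ |a - b| + |b - c| + |c - d| := fun a b c d =>
    (abs_sub_le a c d).trans (by linarith [abs_sub_le a b c])
  refine (htri _ _ _ _).trans_lt (lt_of_lt_of_le
    (add_lt_add (add_lt_add_of_le_of_lt hb hxm) hm2) ?_)
  have : r' * (|K| + 3) = r := by rw [hr']; field_simp
  nlinarith

/-- Convergence of the rescaled chain on continuous functions on `[-∞, ∞]^{n+1}` that vanish near
the origin. -/
theorem IsStationaryRecursion.tendsto_integral_chain (hX : IsStationaryRecursion P Ψ ε X)
    (hRV : HasRegVaryingTails P (X 0) α p) (hΦ : Measurable (Function.uncurry Φ))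
    {κ κ' : Kernel ℝ ℝ} [IsMarkovKernel κ] [IsMarkovKernel κ']
    (hκ : ∀ x, κ x = (P.map (ε 0)).map (Φ x))
    (h0 : κ 0 = Measure.dirac 0) {l₁ l₁' : Measure ℝ}
    (hd : AreDualKernels κ κ' (tailMeasure α p) l₁ l₁')
    (hpath : ∀ σ : ℝ, σ = 1 ∨ σ = -1 → 0 < signWeight p σ → ∀ z > 0, ∀ᵐ ω ∂P, ∀ ζ : ℝ → ℝ,
      Tendsto ζ atTop (𝓝 (σ * z)) → ∀ j,
        Tendsto (fun x => x⁻¹ * recFlow Ψ j (x * ζ x) (fun i => ε i ω)) atTop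
          (𝓝 (recFlow Φ j (σ * z) (fun i => ε i ω)))) (n : ℕ)
    {f : (Fin (n + 1) → EReal) → ℝ} (hf : Continuous f) {δ : ℝ} (hδ : 0 < δ)
    (hf0 : ∀ v : Fin (n + 1) → ℝ, (∀ i, |v i| ≤ δ) → f (toCube v) = 0) :
    Tendsto (fun x => (∫ ω, f (toCube fun j => x⁻¹ * X j ω) ∂P) / P.real {ω | x < |X 0 ω|}) atTop
      (𝓝 (∫ v, f (toCube v) ∂(chainMeasure κ l₁ (tailMeasure α p) n))) := by
  have hα := hRV.index_pos
  have hl : tailMeasure α p {x | δ < |x|} < ∞ := tailMeasure_lt_abs_lt_top hα hδ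
  have hpath' := fun (n : ℕ) (σ : ℝ) (hσ : σ = 1 ∨ σ = -1) (hp : 0 < signWeight p σ) (z : ℝ)
    (hz : 0 < z) => (hpath σ hσ hp z hz).mono fun ω hω ζ hζ j (_ : j ≤ n) => hω ζ hζ j
  have hbdd : ∀ {n : ℕ} {f : (Fin (n + 1) → EReal) → ℝ}, Continuous f → ∃ C, ∀ v, |f v| ≤ C :=
    fun {n f} hf => by
      obtain ⟨C, hC⟩ := isCompact_univ.exists_bound_of_continuousOn hf.continuousOn
      exact ⟨C, fun v => hC v (mem_univ v)⟩
  induction n with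
  | zero =>
    obtain ⟨C, hC⟩ := hbdd hf
    have hF := hf.comp (continuous_toCube (d := 1))
    have hF0 : ∀ v : Fin 1 → ℝ, |v 0| ≤ δ → f (toCube v) = 0 := fun v hv =>
      hf0 v fun i => by
      rwa [Fin.fin_one_eq_zero i]
    rw [chainMeasure, hX.integral_bind_pathKernel hΦ hκ hα 0 (f := fun v => f (toCube v))
      hF.measurable (fun v => hC _) hδ hF0]
    exact hX.tendsto_integral_vec hRV hΦ 0 (hpath' 0) hF (fun v => hC _) hδ hF0
  | succ n ih =>
    obtain ⟨C, hC⟩ := hbdd hf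
    have hF := hf.comp (continuous_toCube (d := n + 2))
    have hfc : Continuous fun w : Fin (n + 1) → EReal => f (Fin.cons 0 w) :=
      hf.comp (Continuous.finCons (A := fun _ => EReal) continuous_const continuous_id)
    have hfc0 : ∀ v : Fin (n + 1) → ℝ, (∀ i, |v i| ≤ δ) → f (Fin.cons 0 (toCube v)) = 0 := by
      intro v hv
      have := hf0 (Fin.cons 0 v) fun i => by
        refine Fin.cases (by simpa using hδ.le) (fun i => by simpa using hv i) i
      rwa [toCube_cons] at this
    have hlim1 := ih hfc hfc0
    have hE : (tailMeasure α p).bind (pathKernel κ (n + 1)) (exceedSet (n + 1) δ) < ∞ := by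
      have := chainMeasure_exceedSet h0 hd hδ hl (n + 1)
      rw [chainMeasure, Measure.add_apply] at this
      exact (ENNReal.add_lt_top.1 this).1
    have hlim2 := hX.tendsto_integral_sub hRV hΦ hκ (n + 1) (hpath' (n + 1))
      (D := fun v => f (toCube v) - f (toCube (Fin.cons 0 (Fin.tail v)))) (C := C + C)
      (hF.sub (hF.comp (Continuous.finCons (A := fun _ => ℝ) continuous_const
        (continuous_pi fun j => continuous_apply (Fin.succ j)))))
      (fun v => (abs_sub _ _).trans (add_le_add (hC _) (hC _))) hδ ?_ ?_ hE
    · rw [integral_chainMeasure_succ h0 hd hδ hl n (f := fun v => f (toCube v)) hF.measurable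
        (fun v => hC _) hf0]
      simp only [toCube_cons] at hlim2 ⊢
      refine (hlim2.add hlim1).congr fun x => ?_
      rw [← add_div]
      congr 1
      have hvec : ∀ k : ℕ, Measurable fun ω => (fun j : Fin (k + 1) => x⁻¹ * X j ω) := fun k =>
        measurable_pi_iff.2 fun j => (hX.measurable_chain j).const_mul _
      have hvec' : Measurable fun ω => (fun j : Fin (n + 1) => x⁻¹ * X (j + 1) ω) :=
        measurable_pi_iff.2 fun j => (hX.measurable_chain _).const_mul _
      have hG : Measurable fun v : Fin (n + 1) → ℝ => f (Fin.cons 0 (toCube v)) :=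
        (hfc.comp continuous_toCube).measurable
      have i1 : Integrable (fun ω => f (toCube fun j : Fin (n + 2) => x⁻¹ * X j ω)) P :=
        Integrable.of_bound (hF.measurable.comp (hvec _)).aestronglyMeasurable C
          (Eventually.of_forall fun ω => hC _)
      have i2 : Integrable (fun ω => f (Fin.cons 0 (toCube fun j : Fin (n + 1) =>
          x⁻¹ * X (j + 1) ω))) P :=
        Integrable.of_bound (hG.comp hvec').aestronglyMeasurable C
          (Eventually.of_forall fun ω => hC _)
      have hsc : Measurable fun v : Fin (n + 1) → ℝ => (fun j => x⁻¹ * v j) :=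
        measurable_pi_iff.2 fun j => (measurable_const_mul _).comp (measurable_pi_apply j)
      have hG' : Measurable fun v : Fin (n + 1) → ℝ => f (Fin.cons 0 (toCube fun j => x⁻¹ * v j)) :=
        hG.comp hsc
      -- Stationarity replaces `(X 1, …, X (n + 1))` by `(X 0, …, X n)`, to which the induction
      -- hypothesis refers.
      have e := congrArg (fun m => ∫ v, f (Fin.cons 0 (toCube fun j => x⁻¹ * v j)) ∂m)
        (hX.map_vec_succ n)
      beta_reduce at e
      rw [integral_map (measurable_pi_iff.2 fun j => hX.measurable_chain _).aemeasurable
          hG'.aestronglyMeasurable,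
        integral_map (measurable_pi_iff.2 fun j => hX.measurable_chain _).aemeasurable
          hG'.aestronglyMeasurable] at e
      simp only [EReal.coe_zero]
      rw [← e]
      exact (congrArg (· + _) (integral_sub i1 i2)).trans (sub_add_cancel _ _)
    · intro v hv
      have := hfc0 (Fin.tail v) fun i => hv i.succ
      simp only [toCube_cons, EReal.coe_zero, this, hf0 v hv, sub_zero]
    · intro r hr
      obtain ⟨η, hη, h⟩ := exists_abs_sub_cons_lt hf hr
      refine ⟨η, hη, fun v hv => ?_⟩
      have := h (v 0) hv (Fin.tail v)
      rw [Fin.cons_self_tail] at this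
      exact this.le

end Convergence

/-! ### Vague convergence in the punctured cube -/

theorem exists_exceedSet_of_isCompact {t : ℕ} {K : Set (PuncturedCube (t + 1))}
    (hK : IsCompact K) : ∃ δ > 0, ∀ v : Fin (t + 1) → ℝ, (∀ i, |v i| ≤ δ) →
      toCube v ∉ Subtype.val '' K := by
  -- A compact subset of the punctured cube remains compact in the cube, so it is closed there and
  -- stays away from the origin.
  have hK' : IsClosed (Subtype.val '' K) := (hK.image continuous_subtype_val).isClosed
  have h0 : toCube (0 : Fin (t + 1) → ℝ) ∉ Subtype.val '' K := by
    rintro ⟨x, -, hx⟩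
    exact x.2 (hx.trans (funext fun j => rfl))
  have h1 : ∀ᶠ v : Fin (t + 1) → ℝ in 𝓝 0, toCube v ∉ Subtype.val '' K :=
    continuous_toCube.continuousAt.eventually (hK'.isOpen_compl.mem_nhds h0)
  obtain ⟨r, hr, hball⟩ := Metric.eventually_nhds_iff.1 h1
  refine ⟨r / 2, by positivity, fun v hv => hball ?_⟩
  rw [dist_pi_lt_iff hr]
  intro i
  rw [Real.dist_eq, Pi.zero_apply, sub_zero]
  linarith [hv i]

theorem isFiniteMeasureOnCompacts_cubeMeasure {t : ℕ} {m : Measure (Fin (t + 1) → ℝ)}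
    (hm : ∀ δ > 0, m (exceedSet t δ) < ∞) : IsFiniteMeasureOnCompacts (cubeMeasure m) := by
  refine ⟨fun K hK => ?_⟩
  obtain ⟨δ, hδ, h⟩ := exists_exceedSet_of_isCompact hK
  have hK' : MeasurableSet (Subtype.val '' K) :=
    (hK.image continuous_subtype_val).isClosed.measurableSet
  have e : cubeMeasure m K = m (toCube ⁻¹' (Subtype.val '' K)) :=
    ((MeasurableEmbedding.subtype_coe (measurableSet_cube_ne_zero _)).comap_apply _ _).trans
      (Measure.map_apply measurable_toCube hK')
  rw [e]
  refine (measure_mono fun v hv => ?_).trans_lt (hm δ hδ)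
  by_contra hv'
  exact h v (notMem_exceedSet.1 hv') hv

theorem exists_extension_integral_cubeMeasure {t : ℕ} (f : C_c(PuncturedCube (t + 1), ℝ)) :
    ∃ g : (Fin (t + 1) → EReal) → ℝ, Continuous g ∧
      (∃ δ > 0, ∀ v : Fin (t + 1) → ℝ, (∀ i, |v i| ≤ δ) → g (toCube v) = 0) ∧
      ∀ m : Measure (Fin (t + 1) → ℝ), ∫ y, f y ∂(cubeMeasure m) = ∫ v, g (toCube v) ∂m := by
  have hopen : IsOpen {x : Fin (t + 1) → EReal | x ≠ 0} := isOpen_compl_singleton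
  set g : (Fin (t + 1) → EReal) → ℝ := Subtype.val.extend f 0 with hg
  -- Extension by zero is continuous at the origin because the support is compact in the punctured
  -- cube; points at infinity already belong to that cube.
  have hgc : Continuous g :=
    f.hasCompactSupport.continuous_extend_zero hopen f.continuous
  have hgv : ∀ x : PuncturedCube (t + 1), g x.1 = f x := fun x =>
    Subtype.val_injective.extend_apply _ _ _
  have hg0 : ∀ x : Fin (t + 1) → EReal, x ∉ Subtype.val '' tsupport f → g x = 0 := by
    intro x hx
    by_cases h : ∃ y : PuncturedCube (t + 1), y.1 = x
    · obtain ⟨y, rfl⟩ := h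
      rw [hgv]
      exact image_eq_zero_of_notMem_tsupport fun hy => hx ⟨y, hy, rfl⟩
    · rw [hg, Function.extend_apply' _ _ _ h]; rfl
  obtain ⟨δ, hδ, h⟩ := exists_exceedSet_of_isCompact f.hasCompactSupport
  refine ⟨g, hgc, ⟨δ, hδ, fun v hv => hg0 _ (h v hv)⟩, fun m => ?_⟩
  simp only [← hgv]
  rw [← integral_map measurable_subtype_coe.aemeasurable hgc.measurable.aestronglyMeasurable,
    map_val_cubeMeasure, setIntegral_eq_integral_of_forall_compl_eq_zero
      (s := {x : Fin (t + 1) → EReal | x ≠ 0}),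
    integral_map measurable_toCube.aemeasurable hgc.measurable.aestronglyMeasurable]
  intro x hx
  refine hg0 x ?_
  rintro ⟨y, -, rfl⟩
  exact hx y.2

theorem scaledLaw_eq_cubeMeasure {Ω : Type*} [MeasurableSpace Ω] (P : Measure Ω) {d : ℕ}
    {ξ : Fin d → Ω → ℝ} (hξ : ∀ j, Measurable (ξ j)) (x : ℝ) :
    scaledLaw P ξ x = cubeMeasure (P.map fun ω j => x⁻¹ * ξ j ω) := by
  rw [scaledLaw, cubeMeasure, Measure.map_map measurable_toCube
    (measurable_pi_iff.2 fun j => (hξ j).const_mul _)]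
  rfl

section Vague

variable {Ω S : Type*} [MeasurableSpace Ω] [MeasurableSpace S] {P : Measure Ω}
  [IsProbabilityMeasure P] {Ψ : ℝ → S → ℝ} {ε : ℕ → Ω → S} {X : ℕ → Ω → ℝ} {α p : ℝ}
  {φ : S → ℝ → ℝ} {μ' : Measure (ℝ × ℝ)}

theorem AreAdjointLaws.limitMeasure_exceedSet {μ : Measure (ℝ × ℝ)} [IsProbabilityMeasure μ]
    [IsProbabilityMeasure μ'] (hα : 0 < α) (hp : p ∈ Icc (0 : ℝ) 1) (h : AreAdjointLaws α p μ μ')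
    (t : ℕ) {δ : ℝ} (hδ : 0 < δ) : limitMeasure α p μ μ' t (exceedSet t δ) < ∞ :=
  chainMeasure_exceedSet (tailKernel_zero μ) (h.areDualKernels hα hp) hδ
    (tailMeasure_lt_abs_lt_top hα hδ) t

theorem IsStationaryRecursion.isTailPairLaw_of_hasTailLimit (hX : IsStationaryRecursion P Ψ ε X)
    (hRV : HasRegVaryingTails P (X 0) α p) (hφ : HasTailLimit (P.map (ε 0)) Ψ p φ) :
    IsTailPairLaw α p (forwardLaw (P.map (ε 0)) p φ) := by
  obtain ⟨V, hVm, hV1, hV, -⟩ := hφ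
  exact hX.isTailPairLaw_forwardLaw hRV hV hVm hV1

theorem IsStationaryRecursion.tendstoVaguely (hX : IsStationaryRecursion P Ψ ε X)
    (hRV : HasRegVaryingTails P (X 0) α p) (hφ : HasTailLimit (P.map (ε 0)) Ψ p φ)
    [IsProbabilityMeasure (forwardLaw (P.map (ε 0)) p φ)] [IsProbabilityMeasure μ']
    (hμ' : AreAdjointLaws α p (forwardLaw (P.map (ε 0)) p φ) μ') (t : ℕ) :
    TendstoVaguely (fun x : ℝ => (P {ω | x < |X 0 ω|})⁻¹ •
      scaledLaw P (fun j : Fin (t + 1) => X j) x) atTop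
      (cubeMeasure (limitMeasure α p (forwardLaw (P.map (ε 0)) p φ) μ' t)) := by
  have := Measure.isProbabilityMeasure_map (μ := P) (hX.measurable_innov 0).aemeasurable
  have hα := hRV.index_pos
  have hp := hRV.weight_mem
  obtain ⟨V, hVm, hV1, hV, hW⟩ := hφ
  have hV : HasSlopesOn Ψ p φ V := hV
  have hΨ := hX.measurable_map
  intro f
  obtain ⟨g, hgc, ⟨δ, hδ, hg0⟩, hgi⟩ := exists_extension_integral_cubeMeasure f
  have hgood := hV.ae_hasGoodSign hVm hΨ hV1 hα hp hμ'.left_mem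
  have key := hX.tendsto_integral_chain hRV (hV.measurable_limitMap hVm hΨ)
    (hV.tailKernel_forwardLaw hVm hΨ hV1 hp) (tailKernel_zero _) (hμ'.areDualKernels hα hp)
    (fun σ hσ hp z hz => hX.tendsto_recFlow_limitMap hV hVm hV1 hW hgood hσ hp hz) t hgc hδ hg0
  rw [hgi]
  refine key.congr fun x => ?_
  have hvec : Measurable fun ω => (fun j : Fin (t + 1) => x⁻¹ * X j ω) :=
    measurable_pi_iff.2 fun j => (hX.measurable_chain j).const_mul _
  have hgm : Measurable fun v : Fin (t + 1) → ℝ => g (toCube v) :=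
    (hgc.comp continuous_toCube).measurable
  rw [integral_smul_measure, scaledLaw_eq_cubeMeasure P (fun j => hX.measurable_chain j), hgi,
    integral_map hvec.aemeasurable hgm.aestronglyMeasurable,
    ENNReal.toReal_inv, smul_eq_mul, div_eq_inv_mul]
  rfl

theorem HasForwardFormulas.ne_zero {M : ℤ → Ω → ℝ} {t : ℕ} {m : Measure (PuncturedCube (t + 1))}
    (hα : 0 < α) (h : HasForwardFormulas P α M t m) : m ≠ 0 := by
  rintro rfl
  have h1 := (h (fun _ => 1) measurable_const).1
  simp only [Measure.restrict_zero, lintegral_const, measure_univ, mul_one,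
    one_mul] at h1
  have h2 : powMeasure α (Ioi 1) = 0 := measure_mono_null (subset_univ _) h1.symm
  rw [powMeasure_Ioi hα one_pos] at h2
  simp at h2

theorem HasRegVaryingTails.isMultivariateRegVarying
    (hRV : HasRegVaryingTails P (X 0) α p) {t : ℕ} {m : Measure (PuncturedCube (t + 1))}
    [IsFiniteMeasureOnCompacts m] (hm : m ≠ 0)
    (h : TendstoVaguely (fun x : ℝ => (P {ω | x < |X 0 ω|})⁻¹ •
      scaledLaw P (fun j : Fin (t + 1) => X j) x) atTop m) :
    IsMultivariateRegVarying P (fun j : Fin (t + 1) => X j) := by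
  refine ⟨α, fun x => P.real {ω | x < |X 0 ω|}, m, hRV.index_pos, ⟨?_, ?_, ?_⟩, inferInstance, hm,
    ?_⟩
  · refine Antitone.measurable fun x y hxy => measureReal_mono fun ω hω => ?_
    exact lt_of_le_of_lt hxy hω
  · exact Eventually.of_forall fun x => hRV.real_tail_pos x
  · exact hRV.tendsto_abs
  · have e : ∀ x : ℝ, ENNReal.ofReal (P.real {ω | x < |X 0 ω|})⁻¹ = (P {ω | x < |X 0 ω|})⁻¹ := by
      intro x
      rw [ENNReal.ofReal_inv_of_pos (hRV.real_tail_pos x), ofReal_measureReal]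
    simpa only [e] using h

end Vague

/-! ### Existence of adjoint laws -/

section AdjointLaw

variable {α p : ℝ} {μ : Measure (ℝ × ℝ)}

/-- The part of `I = σ` that is not charged by the adjoint transitions. -/
noncomputable def adjointDefect (α : ℝ) (μ : Measure (ℝ × ℝ)) (σ : ℝ) : ℝ≥0∞ :=
  μ {q | q.1 = σ} - ∫⁻ q, posPow α (σ * q.2) ∂μ

/-- The law adjoint to `μ`. -/
noncomputable def adjointLaw (α : ℝ) (μ : Measure (ℝ × ℝ)) : Measure (ℝ × ℝ) :=
  (μ.withDensity fun q => ENNReal.ofReal (|q.2| ^ α)).map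
      (fun q => (Real.sign q.2, q.1 / |q.2|)) +
    (adjointDefect α μ 1 • Measure.dirac (1, 0) + adjointDefect α μ (-1) • Measure.dirac (-1, 0))

theorem measurable_real_sign : Measurable Real.sign := by
  unfold Real.sign
  exact Measurable.ite measurableSet_Iio measurable_const
    (Measurable.ite measurableSet_Ioi measurable_const measurable_const)

theorem measurable_adjointMap : Measurable fun q : ℝ × ℝ => (Real.sign q.2, q.1 / |q.2|) :=
  (measurable_real_sign.comp measurable_snd).prodMk (measurable_fst.div measurable_snd.abs)

theorem lintegral_adjointLaw {F : ℝ × ℝ → ℝ≥0∞} (hF : Measurable F) :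
    ∫⁻ q, F q ∂(adjointLaw α μ) =
      ∫⁻ q, ENNReal.ofReal (|q.2| ^ α) * F (Real.sign q.2, q.1 / |q.2|) ∂μ +
        (adjointDefect α μ 1 * F (1, 0) + adjointDefect α μ (-1) * F (-1, 0)) := by
  have hd : Measurable fun q : ℝ × ℝ => ENNReal.ofReal (|q.2| ^ α) :=
    (measurable_snd.abs.pow_const α).ennreal_ofReal
  rw [adjointLaw, lintegral_add_measure, lintegral_add_measure, lintegral_smul_measure,
    lintegral_smul_measure, lintegral_dirac' _ hF, lintegral_dirac' _ hF,
    lintegral_map hF measurable_adjointMap,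
    lintegral_withDensity_eq_lintegral_mul _ hd (g := fun q : ℝ × ℝ => F (Real.sign q.2, q.1 / |q.2|))
      (hF.comp measurable_adjointMap)]
  rfl

theorem ofReal_rpow_mul_posPow {c : ℝ} (hc : 0 ≤ c) (u : ℝ) :
    ENNReal.ofReal (c ^ α) * posPow α u = posPow α (c * u) := by
  rw [posPow, posPow, ← ENNReal.ofReal_mul (Real.rpow_nonneg hc α),
    ← Real.mul_rpow hc (le_max_right _ _), mul_max_of_nonneg _ _ hc, mul_zero]

theorem posPow_zero (hα : 0 < α) : posPow α 0 = 0 := (posPow_eq_zero_iff hα).2 le_rfl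

theorem posPow_one : posPow α 1 = 1 := by simp [posPow]

theorem IsTailPairLaw.lintegral_posPow_fst (hα : 0 < α) (hp : p ∈ Icc (0 : ℝ) 1)
    (hμ : IsTailPairLaw α p μ) {σ : ℝ} (hσ : σ = 1 ∨ σ = -1) :
    ∫⁻ q, posPow α (σ * q.1) ∂μ = μ {q | q.1 = σ} := by
  rw [← lintegral_indicator_one (measurableSet_fst_eq σ)]
  refine lintegral_congr_ae ((hμ.ae_fst hp).mono fun q hq => ?_)
  by_cases h : q.1 = σ
  · have : σ * σ = 1 := by rcases hσ with rfl | rfl <;> norm_num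
    simp [indicator, h, this, posPow_one]
  · have : σ * q.1 = -1 := by
      rcases hσ with rfl | rfl <;> rcases hq with hq | hq <;> simp_all
    have h0 : posPow α (-1) = 0 := (posPow_eq_zero_iff hα).2 (by norm_num)
    simp [indicator, h, this, h0]

/-- The reweighted part gives the sign `σ` mass `E[(σ M)_+^α]`, and the defect supplies the rest;
the moment inequality makes the truncated subtraction exact. -/
theorem IsTailPairLaw.adjointLaw_fst (hα : 0 < α) (hμ : IsTailPairLaw α p μ) {σ : ℝ}
    (hσ : σ = 1 ∨ σ = -1) : adjointLaw α μ {q | q.1 = σ} = μ {q | q.1 = σ} := by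
  have := hμ.prob
  have hσ' : σ ∈ ({-1, 1} : Set ℝ) := hσ.symm
  rw [← lintegral_indicator_one (measurableSet_fst_eq σ),
    lintegral_adjointLaw (measurable_one.indicator (measurableSet_fst_eq σ))]
  have e1 : ∀ q : ℝ × ℝ, ENNReal.ofReal (|q.2| ^ α) *
      {q : ℝ × ℝ | q.1 = σ}.indicator 1 (Real.sign q.2, q.1 / |q.2|) = posPow α (σ * q.2) := by
    intro q
    rcases lt_trichotomy q.2 0 with h | h | h
    · rw [Real.sign_of_neg h, abs_of_neg h]
      rcases hσ with rfl | rfl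
      · have : posPow α q.2 = 0 := (posPow_eq_zero_iff hα).2 h.le
        norm_num [indicator, this]
      · rw [posPow, max_eq_left (by linarith)]; simp [indicator]
    · simp [h, posPow_zero hα, Real.zero_rpow hα.ne']
    · rw [Real.sign_of_pos h, abs_of_pos h]
      rcases hσ with rfl | rfl
      · rw [posPow, max_eq_left (by linarith)]; simp [indicator]
      · have : posPow α (-q.2) = 0 := (posPow_eq_zero_iff hα).2 (by linarith)
        norm_num [indicator, this]
  have e2 : adjointDefect α μ 1 * {q : ℝ × ℝ | q.1 = σ}.indicator 1 (1, 0) +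
      adjointDefect α μ (-1) * {q : ℝ × ℝ | q.1 = σ}.indicator 1 (-1, 0) =
      adjointDefect α μ σ := by
    rcases hσ with rfl | rfl <;> norm_num [indicator]
  rw [lintegral_congr e1, e2, adjointDefect, add_tsub_cancel_of_le (hμ.moment σ hσ')]

/-- Every element of `M_{p,α}` has an adjoint. -/
theorem IsTailPairLaw.areAdjointLaws_adjointLaw (hα : 0 < α) (hp : p ∈ Icc (0 : ℝ) 1)
    (hμ : IsTailPairLaw α p μ) : AreAdjointLaws α p μ (adjointLaw α μ) := by
  have := hμ.prob
  have hminm : ∀ x y : ℝ, Measurable fun q : ℝ × ℝ =>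
      min (posPow α (x * q.2)) (posPow α (y * q.1)) := fun x y =>
    ((measurable_posPow α).comp (measurable_snd.const_mul x)).min
      ((measurable_posPow α).comp (measurable_fst.const_mul y))
  refine ⟨hμ, ⟨⟨?_⟩, ?_, ?_, fun σ hσ => ?_⟩, fun x y => ?_⟩
  · have h1 : ∀ᵐ q ∂(adjointLaw α μ), q.1 = 1 ∨ q.1 = -1 := by
      have hm : MeasurableSet {q : ℝ × ℝ | q.1 = 1 ∨ q.1 = -1}ᶜ :=
        ((measurableSet_fst_eq 1).union (measurableSet_fst_eq (-1))).compl
      rw [ae_iff]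
      change adjointLaw α μ {q : ℝ × ℝ | q.1 = 1 ∨ q.1 = -1}ᶜ = 0
      rw [← lintegral_indicator_one hm, lintegral_adjointLaw (measurable_one.indicator hm)]
      have : ∀ q : ℝ × ℝ, ENNReal.ofReal (|q.2| ^ α) *
          {q : ℝ × ℝ | q.1 = 1 ∨ q.1 = -1}ᶜ.indicator 1 (Real.sign q.2, q.1 / |q.2|) = 0 := by
        intro q
        rcases eq_or_ne q.2 0 with h | h
        · simp [h, Real.zero_rpow hα.ne']
        · rw [indicator_of_notMem, mul_zero]
          exact fun h' => h' (Real.sign_eq_one_or_neg_one h)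
      rw [lintegral_congr this]
      simp
    have hd : Disjoint {q : ℝ × ℝ | q.1 = 1} {q | q.1 = -1} := by
      rw [Set.disjoint_left]; intro q h h'
      have h1 : q.1 = 1 := h
      have h2 : q.1 = -1 := h'
      linarith
    have hu : ({q : ℝ × ℝ | q.1 = 1} ∪ {q | q.1 = -1} : Set (ℝ × ℝ)) =ᵐ[adjointLaw α μ] univ :=
      ae_eq_univ.2 h1
    rw [← measure_congr hu, measure_union hd (measurableSet_fst_eq (-1)),
      hμ.adjointLaw_fst hα (Or.inl rfl), hμ.adjointLaw_fst hα (Or.inr rfl), hμ.plus, hμ.minus,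
      ← ENNReal.ofReal_add hp.1 (by linarith [hp.2]), add_sub_cancel, ENNReal.ofReal_one]
  · rw [hμ.adjointLaw_fst hα (Or.inl rfl), hμ.plus]
  · rw [hμ.adjointLaw_fst hα (Or.inr rfl), hμ.minus]
  · have hm : Measurable fun q : ℝ × ℝ => posPow α (σ * q.2) :=
      (measurable_posPow α).comp (measurable_snd.const_mul σ)
    rw [hμ.adjointLaw_fst hα hσ.symm, lintegral_adjointLaw hm,
      ← hμ.lintegral_posPow_fst hα hp hσ.symm]
    simp only [mul_zero, posPow_zero hα, add_zero]
    -- The weight `|M|^α` cancels the denominator of `I / |M|`, leaving `(σ I)_+^α` where `M ≠ 0`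
    -- and `0` elsewhere.
    refine lintegral_mono fun q => ?_
    simp only
    rw [ofReal_rpow_mul_posPow (abs_nonneg _)]
    rcases eq_or_ne q.2 0 with h | h
    · simp [h, posPow_zero hα]
    · rw [mul_left_comm, mul_div_cancel₀ _ (abs_ne_zero.2 h)]
  -- Moving `|M|^α` into the minimum turns `(x I / |M|, y sign M)` into `(x I, y M)`. The atoms at
  -- `(±1, 0)` contribute nothing, one argument of the minimum being `0`.
  · rw [lintegral_adjointLaw (hminm x y)]
    simp only [mul_zero, posPow_zero hα, zero_min, add_zero]
    refine lintegral_congr fun q => ?_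
    have hmono : Monotone fun a : ℝ≥0∞ => ENNReal.ofReal (|q.2| ^ α) * a :=
      fun a b h => mul_le_mul_right h _
    have := hmono.map_min (a := posPow α (x * (q.1 / |q.2|))) (b := posPow α (y * Real.sign q.2))
    beta_reduce at this
    rw [this, ofReal_rpow_mul_posPow (abs_nonneg _), ofReal_rpow_mul_posPow (abs_nonneg _)]
    rcases eq_or_ne q.2 0 with h | h
    · simp [h, posPow_zero hα]
    · have hs : |q.2| * Real.sign q.2 = q.2 := by
        rcases lt_or_gt_of_ne h with h | h
        · rw [abs_of_neg h, Real.sign_of_neg h]; ring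
        · rw [abs_of_pos h, Real.sign_of_pos h]; ring
      rw [mul_left_comm, mul_div_cancel₀ _ (abs_ne_zero.2 h), mul_left_comm, hs]

end AdjointLaw

/-! ### Conditional expectations of indicators -/

/-- Freezing: the pair `(1_A, W)` is measurable for the past, hence independent of `η`, and `η` can
be integrated out first. -/
theorem measure_inter_preimage_of_indep {Ω E : Type*} {m : MeasurableSpace Ω} [mΩ : MeasurableSpace Ω]
    [MeasurableSpace E] {P : Measure Ω} [IsProbabilityMeasure P] (hm : m ≤ mΩ) {W : Ω → ℝ}
    (hW : Measurable[m] W) {η : Ω → E} (hη : Measurable η)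
    (hind : Indep m (MeasurableSpace.comap η inferInstance) P) {G : ℝ → E → ℝ}
    (hG : Measurable (Function.uncurry G)) {A : Set Ω} (hA : MeasurableSet[m] A) {B : Set ℝ}
    (hB : MeasurableSet B) :
    P (A ∩ {ω | G (W ω) (η ω) ∈ B}) = ∫⁻ ω in A, (P.map η).map (G (W ω)) B ∂P := by
  have hAm : MeasurableSet A := hm _ hA
  have hWm : Measurable W := hW.mono hm le_rfl
  have hI : Measurable[m] (A.indicator (1 : Ω → ℝ≥0∞)) :=
    Measurable.indicator (measurable_const (a := (1 : ℝ≥0∞))) hA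
  have hUm : Measurable[m] fun ω => (A.indicator (1 : Ω → ℝ≥0∞) ω, W ω) := hI.prodMk hW
  have hU : IndepFun (fun ω => (A.indicator (1 : Ω → ℝ≥0∞) ω, W ω)) η P := by
    rw [IndepFun_iff_Indep]
    exact indep_of_indep_of_le_left hind hUm.comap_le
  have hGB : Measurable fun q : ℝ × E => B.indicator (1 : ℝ → ℝ≥0∞) (G q.1 q.2) :=
    (measurable_one.indicator hB).comp hG
  have hh : Measurable fun q : (ℝ≥0∞ × ℝ) × E => q.1.1 * B.indicator (1 : ℝ → ℝ≥0∞) (G q.1.2 q.2) :=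
    (measurable_fst.comp measurable_fst).mul
      (hGB.comp ((measurable_snd.comp measurable_fst).prodMk measurable_snd))
  have hGW : Measurable fun ω => G (W ω) (η ω) := hG.comp (hWm.prodMk hη)
  have hGWB : MeasurableSet {ω | G (W ω) (η ω) ∈ B} := hGW hB
  have key := lintegral_of_indepFun (hUm.mono hm le_rfl) hη hU hh
  have e1 : P (A ∩ {ω | G (W ω) (η ω) ∈ B}) =
      ∫⁻ ω, A.indicator (1 : Ω → ℝ≥0∞) ω * B.indicator 1 (G (W ω) (η ω)) ∂P := by
    rw [← lintegral_indicator_one (hAm.inter hGWB)]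
    refine lintegral_congr fun ω => ?_
    by_cases h1 : ω ∈ A <;> by_cases h2 : G (W ω) (η ω) ∈ B <;> simp [indicator, h1, h2]
  rw [e1]
  refine key.trans ?_
  rw [← lintegral_indicator hAm]
  refine lintegral_congr fun ω => ?_
  have hGx : Measurable (G (W ω)) := hG.comp (measurable_const.prodMk measurable_id)
  have hGB' : Measurable fun e : E => B.indicator (1 : ℝ → ℝ≥0∞) (G (W ω) e) :=
    (measurable_one.indicator hB).comp hGx
  have e2 : (P.map η).map (G (W ω)) B = ∫⁻ e, B.indicator 1 (G (W ω) e) ∂(P.map η) := by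
    rw [← lintegral_indicator_one hB, lintegral_map (measurable_one.indicator hB) hGx]
  simp only
  rw [lintegral_const_mul _ hGB', ← e2]
  by_cases h : ω ∈ A <;> simp [h]

theorem condExp_indicator_eq_of_setLIntegral {Ω : Type*} {m : MeasurableSpace Ω}
    [mΩ : MeasurableSpace Ω] {P : Measure Ω} [IsProbabilityMeasure P] (hm : m ≤ mΩ) {C : Set Ω}
    (hC : MeasurableSet C) {k : Ω → ℝ≥0∞} (hk : Measurable[m] k) (hk1 : ∀ ω, k ω ≤ 1)
    (h : ∀ A, MeasurableSet[m] A → P (A ∩ C) = ∫⁻ ω in A, k ω ∂P) :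
    P[C.indicator (fun _ => (1 : ℝ)) | m] =ᵐ[P] fun ω => (k ω).toReal := by
  have hkm : Measurable k := hk.mono hm le_rfl
  have hki : Integrable (fun ω => (k ω).toReal) P :=
    Integrable.of_bound hkm.ennreal_toReal.aestronglyMeasurable 1
      (Eventually.of_forall fun ω => by
        rw [Real.norm_of_nonneg ENNReal.toReal_nonneg]
        exact ENNReal.toReal_le_of_le_ofReal zero_le_one (by simpa using hk1 ω))
  refine (ae_eq_condExp_of_forall_setIntegral_eq hm ((integrable_const _).indicator hC)
    (fun s _ _ => hki.integrableOn) (fun A hA _ => ?_)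
    (Measurable.stronglyMeasurable hk.ennreal_toReal).aestronglyMeasurable).symm
  rw [integral_toReal hkm.aemeasurable
    (Eventually.of_forall fun ω => (hk1 ω).trans_lt ENNReal.one_lt_top), ← h A hA,
    setIntegral_indicator hC, setIntegral_const, smul_eq_mul, mul_one]
  rfl

/-! ### Realisation of the tail kernel by random maps -/

/-- Multiplication by a factor that depends on the sign of the state. -/
noncomputable def noiseMap (x : ℝ) (e : ℝ × ℝ) : ℝ := x * (if 0 < x then e.1 else e.2)

theorem measurable_noiseMap : Measurable (Function.uncurry noiseMap) :=
  measurable_fst.mul (Measurable.ite (measurable_fst measurableSet_Ioi)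
    (measurable_fst.comp measurable_snd) (measurable_snd.comp measurable_snd))

theorem noiseMap_zero (e : ℝ × ℝ) : noiseMap 0 e = 0 := by rw [noiseMap, zero_mul]

theorem noiseMap_mul {z : ℝ} (hz : 0 < z) (x : ℝ) (e : ℝ × ℝ) :
    noiseMap (z * x) e = z * noiseMap x e := by
  simp only [noiseMap, mul_pos_iff_of_pos_left hz, mul_assoc]

/-- The joint law of the factors for positive and negative states. -/
noncomputable def noiseLaw (μ : Measure (ℝ × ℝ)) : Measure (ℝ × ℝ) :=
  (tailNoise μ 1).prod (tailNoise μ (-1))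

instance (μ : Measure (ℝ × ℝ)) [IsFiniteMeasure μ] : IsProbabilityMeasure (noiseLaw μ) := by
  unfold noiseLaw; infer_instance

theorem measurable_noiseMap_right (x : ℝ) : Measurable (noiseMap x) :=
  measurable_noiseMap.comp (measurable_const.prodMk measurable_id)

theorem tailKernel_eq_map_noiseLaw (μ : Measure (ℝ × ℝ)) [IsFiniteMeasure μ] (x : ℝ) :
    tailKernel μ x = (noiseLaw μ).map (noiseMap x) := by
  rcases lt_trichotomy x 0 with h | rfl | h
  · have e : noiseMap x = (fun y => x * y) ∘ Prod.snd := by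
      funext q; simp [noiseMap, not_lt.2 h.le]
    rw [tailKernel, signKernel_apply, Real.sign_of_neg h, e,
      ← Measure.map_map (measurable_const_mul x) measurable_snd, noiseLaw, Measure.map_snd_prod,
      measure_univ, one_smul]
  · have e : noiseMap 0 = fun _ => 0 := funext noiseMap_zero
    rw [tailKernel_zero, e, Measure.map_const, measure_univ, one_smul]
  · have e : noiseMap x = (fun y => x * y) ∘ Prod.fst := by
      funext q; simp [noiseMap, h]
    rw [tailKernel, signKernel_apply, Real.sign_of_pos h, e,
      ← Measure.map_map (measurable_const_mul x) measurable_fst, noiseLaw, Measure.map_fst_prod,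
      measure_univ, one_smul]

theorem IsTailPairLaw.ae_hasGoodSign_fst {α p : ℝ} {μ : Measure (ℝ × ℝ)}
    (hp : p ∈ Icc (0 : ℝ) 1) (hμ : IsTailPairLaw α p μ) : ∀ᵐ q ∂μ, HasGoodSign p q.1 := by
  have h : ∀ σ : ℝ, σ = 1 ∨ σ = -1 → ∀ᵐ q ∂μ, q.1 = σ → 0 < signWeight p σ := by
    intro σ hσ
    by_cases h0 : 0 < signWeight p σ
    · exact Eventually.of_forall fun q _ => h0
    · have h0 := le_antisymm (not_lt.1 h0) (signWeight_nonneg hp σ)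
      have : μ {q | q.1 = σ} = 0 := by
        rcases hσ with rfl | rfl
        · rw [signWeight, if_pos rfl] at h0
          rw [hμ.plus, h0, ENNReal.ofReal_zero]
        · rw [signWeight, if_neg (by norm_num)] at h0
          rw [hμ.minus, h0, ENNReal.ofReal_zero]
      exact (measure_eq_zero_iff_ae_notMem.1 this).mono fun q hq h => absurd h hq
  filter_upwards [hμ.ae_fst hp, h 1 (Or.inl rfl), h (-1) (Or.inr rfl)] with q hq h1 h2
  right
  rcases hq with hq | hq
  · rw [hq, Real.sign_one]; exact h1 hq
  · rw [hq, Real.sign_of_neg (by norm_num)]; exact h2 hq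

theorem IsTailPairLaw.lintegral_fst {α p : ℝ} {μ ρ : Measure (ℝ × ℝ)} [IsProbabilityMeasure μ]
    [IsProbabilityMeasure ρ] (hp : p ∈ Icc (0 : ℝ) 1) (hμ : IsTailPairLaw α p μ)
    (hρ : IsTailPairLaw α p ρ) {F : ℝ × ℝ → ℝ≥0∞} (hF : Measurable F) :
    ∫⁻ q, ∫⁻ y, F (q.1, y) ∂(tailKernel ρ q.1) ∂μ = ∫⁻ q, F q ∂ρ := by
  have hm : Measurable fun x => ∫⁻ y, F (x, y) ∂(tailKernel ρ x) :=
    Measurable.lintegral_kernel_prod_right' hF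
  rw [hμ.lintegral_eq hp (F := fun q => ∫⁻ y, F (q.1, y) ∂(tailKernel ρ q.1))
    (hm.comp measurable_fst), hρ.lintegral_eq hp hF]
  simp

/-! ### The two-sided path -/

/-- The two-sided path driven by the noise `η`: the state at time `0` is the first component of
`η 0`, and the step from `d n` to `d (n + 1)`, where `d = ± 1`, is driven by `η (d (n + 1))`. -/
noncomputable def twoSidedPath (η : ℤ → ℝ × ℝ) (t : ℤ) : ℝ :=
  recFlow noiseMap t.natAbs (η 0).1 fun k => η (t.sign * (k + 1))

theorem twoSidedPath_mul {d : ℤ} (hd : d = 1 ∨ d = -1) (n : ℕ) (η : ℤ → ℝ × ℝ) :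
    twoSidedPath η (d * n) = recFlow noiseMap n (η 0).1 fun k => η (d * (k + 1)) := by
  have h1 : (d * n).natAbs = n := by rcases hd with rfl | rfl <;> simp
  rw [twoSidedPath, h1]
  refine recFlow_congr fun k hk => ?_
  have h2 : (d * n).sign = d := by
    have : (n : ℤ).sign = 1 := Int.sign_eq_one_of_pos (by omega)
    rw [Int.sign_mul, this, mul_one]
    rcases hd with rfl | rfl <;> rfl
  rw [h2]

theorem twoSidedPath_mul_succ {d : ℤ} (hd : d = 1 ∨ d = -1) (n : ℕ) (η : ℤ → ℝ × ℝ) :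
    twoSidedPath η (d * (n + 1)) = noiseMap (twoSidedPath η (d * n)) (η (d * (n + 1))) := by
  have := twoSidedPath_mul hd (n + 1) η
  push_cast at this
  rw [this, recFlow, ← twoSidedPath_mul hd]

theorem twoSidedPath_zero (η : ℤ → ℝ × ℝ) : twoSidedPath η 0 = (η 0).1 := rfl

theorem measurable_recFlow_of_lt {Ω S : Type*} {m : MeasurableSpace Ω} [MeasurableSpace S]
    {Ψ : ℝ → S → ℝ} (hΨ : Measurable (Function.uncurry Ψ)) {x : Ω → ℝ} (hx : Measurable x)
    {e : Ω → ℕ → S} {n : ℕ} (he : ∀ k < n, Measurable fun ω => e ω k) :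
    Measurable fun ω => recFlow Ψ n (x ω) (e ω) := by
  induction n with
  | zero => exact hx
  | succ n ih =>
    exact hΨ.comp ((ih fun k hk => he k (hk.trans n.lt_succ_self)).prodMk (he n n.lt_succ_self))

/-- The `σ`-algebra of the noise up to time `n` in direction `d`. -/
abbrev noisePast (d : ℤ) (n : ℕ) : MeasurableSpace (ℤ → ℝ × ℝ) :=
  ⨆ i ∈ {i : ℤ | d * i ≤ n}, MeasurableSpace.comap (fun η => η i) inferInstance

theorem noisePast_le (d : ℤ) (n : ℕ) : noisePast d n ≤ MeasurableSpace.pi :=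
  iSup₂_le fun i _ => (measurable_pi_apply i).comap_le

theorem measurable_noisePast {d : ℤ} {n : ℕ} {i : ℤ} (hi : d * i ≤ n) :
    Measurable[noisePast d n] fun η : ℤ → ℝ × ℝ => η i :=
  Measurable.mono (comap_measurable _)
    (le_iSup₂ (f := fun (i : ℤ) (_ : i ∈ {i : ℤ | d * i ≤ n}) =>
      MeasurableSpace.comap (fun η : ℤ → ℝ × ℝ => η i) inferInstance) i hi) le_rfl

/-- The state at time `s` uses only the noise between `0` and `s`. The past in direction `d`
contains the whole other half-line, as required by transitions conditioned on the full two-sided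
past. -/
theorem measurable_twoSidedPath_noisePast {d : ℤ} (hd : d = 1 ∨ d = -1) {n : ℕ} {s : ℤ}
    (hs : d * s ≤ n) : Measurable[noisePast d n] fun η => twoSidedPath η s := by
  refine measurable_recFlow_of_lt (m := noisePast d n) measurable_noiseMap
    (x := fun η => (η 0).1) (e := fun η k => η (s.sign * (k + 1))) ?_ fun k hk => ?_
  · exact measurable_fst.comp (measurable_noisePast (by simp))
  · refine measurable_noisePast ?_
    rcases lt_trichotomy s 0 with h | h | h
    · rw [Int.sign_eq_neg_one_of_neg h]
      rcases hd with rfl | rfl <;> omega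
    · subst h; simp at hk
    · rw [Int.sign_eq_one_of_pos h]
      rcases hd with rfl | rfl <;> omega

theorem measurable_twoSidedPath : Measurable twoSidedPath :=
  measurable_pi_iff.2 fun t => measurable_recFlow_of_lt measurable_noiseMap
    (x := fun η : ℤ → ℝ × ℝ => (η 0).1) (e := fun η k => η (t.sign * (k + 1)))
    (measurable_fst.comp (measurable_pi_apply 0)) fun _ _ => measurable_pi_apply _

/-- The `σ`-algebra on paths of the coordinates at the times in `pr`. -/
abbrev pathPast (pr : ℤ → Prop) : MeasurableSpace (ℤ → ℝ) :=
  ⨆ s : {s : ℤ // pr s}, MeasurableSpace.comap (fun w : ℤ → ℝ => w s) inferInstance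

theorem measurableSet_hasGoodSign (p : ℝ) : MeasurableSet {x : ℝ | HasGoodSign p x} := by
  have h : Measurable (signWeight p) := Measurable.ite (measurableSet_singleton 1)
    measurable_const measurable_const
  exact (measurableSet_singleton 0).union
    (measurableSet_lt measurable_const (h.comp measurable_real_sign))

theorem IsTailPairLaw.fst_ne_zero_of_hasGoodSign {α p : ℝ} {μ : Measure (ℝ × ℝ)}
    (hμ : IsTailPairLaw α p μ) {x : ℝ} (hx : HasGoodSign p x) :
    x = 0 ∨ μ {q | q.1 = Real.sign x} ≠ 0 := by
  refine or_iff_not_imp_left.2 fun h0 => ?_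
  have h := hx.resolve_left h0
  rcases Real.sign_eq_one_or_neg_one h0 with hs | hs
  · rw [hs, hμ.plus]
    rw [hs, signWeight, if_pos rfl] at h
    exact (ENNReal.ofReal_pos.2 h).ne'
  · rw [hs, hμ.minus]
    rw [hs, signWeight, if_neg (by norm_num)] at h
    exact (ENNReal.ofReal_pos.2 h).ne'

section TwoSided

variable {α p : ℝ} {m : ℤ → Measure (ℝ × ℝ)} [∀ i, IsProbabilityMeasure (m i)]

/-- The law of the two-sided path when the noise variables `η i` are independent with laws `m i`. -/
noncomputable def twoSidedLaw (m : ℤ → Measure (ℝ × ℝ)) [∀ i, IsProbabilityMeasure (m i)] :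
    Measure (ℤ → ℝ) := (Measure.infinitePi m).map twoSidedPath

instance : IsProbabilityMeasure (twoSidedLaw m) :=
  Measure.isProbabilityMeasure_map measurable_twoSidedPath.aemeasurable

theorem indep_noisePast {d : ℤ} (hd : d = 1 ∨ d = -1) (n : ℕ) :
    Indep (noisePast d n)
      (MeasurableSpace.comap (fun η : ℤ → ℝ × ℝ => η (d * (n + 1))) inferInstance)
      (Measure.infinitePi m) := by
  have h := indep_iSup_of_disjoint (m := fun i : ℤ =>
      MeasurableSpace.comap (fun η : ℤ → ℝ × ℝ => η i) inferInstance)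
    (μ := Measure.infinitePi m) (S := {i : ℤ | d * i ≤ n}) (T := {d * (n + 1)})
    (fun i => (measurable_pi_apply i).comap_le)
    (iIndepFun_infinitePi (P := m) (X := fun _ e => e) fun _ => measurable_id) ?_
  · simpa [noisePast] using h
  · rw [Set.disjoint_singleton_right]
    intro h
    have h : d * (d * (n + 1)) ≤ n := h
    rcases hd with rfl | rfl <;> omega

variable {d : ℤ} {ρ : Measure (ℝ × ℝ)} [IsProbabilityMeasure ρ]

/-- Guarantees that `tailKernel`, which drives the path, coincides with `tailTransition` at the
visited states. -/
theorem ae_hasGoodSign_twoSidedLaw (hα : 0 < α) (hp : p ∈ Icc (0 : ℝ) 1) (hd : d = 1 ∨ d = -1)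
    (h0 : IsTailPairLaw α p (m 0)) (hρ : IsTailPairLaw α p ρ)
    (hm : ∀ n : ℕ, m (d * (n + 1)) = noiseLaw ρ) (n : ℕ) :
    ∀ᵐ w ∂(twoSidedLaw m), HasGoodSign p (w (d * n)) := by
  have hw : Measurable fun w : ℤ → ℝ => w (d * (n : ℤ)) := measurable_pi_apply _
  have hms : MeasurableSet {w : ℤ → ℝ | HasGoodSign p (w (d * n))} :=
    hw (measurableSet_hasGoodSign p)
  rw [twoSidedLaw, ae_map_iff measurable_twoSidedPath.aemeasurable hms]
  have hev : ∀ (i : ℤ) {C : ℝ × ℝ → Prop}, (∀ᵐ e ∂(m i), C e) →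
      ∀ᵐ η ∂(Measure.infinitePi m), C (η i) := fun i C h => by
    rw [← Measure.infinitePi_map_eval m i] at h
    exact ae_of_ae_map (measurable_pi_apply i).aemeasurable h
  have hstep : ∀ k : ℕ, ∀ᵐ η ∂(Measure.infinitePi m), ∀ x, HasGoodSign p x →
      HasGoodSign p (noiseMap x (η (d * (k + 1)))) := fun k => by
    refine hev (d * (k + 1)) (C := fun e => ∀ x, HasGoodSign p x → HasGoodSign p (noiseMap x e)) ?_
    rw [hm k]
    exact hρ.ae_hasGoodSign hα hp measurable_noiseMap_right (tailKernel_eq_map_noiseLaw ρ)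
      noiseMap_zero fun z hz x e => noiseMap_mul hz x e
  filter_upwards [hev 0 (h0.ae_hasGoodSign_fst hp), ae_all_iff.2 hstep] with η h1 h2
  clear hms hw
  induction n with
  | zero => simpa [twoSidedPath_zero] using h1
  | succ n ih =>
    have := h2 n _ ih
    rw [← twoSidedPath_mul_succ hd] at this
    exact_mod_cast this

theorem twoSidedLaw_pair (hp : p ∈ Icc (0 : ℝ) 1) (hd : d = 1 ∨ d = -1)
    (h0 : IsTailPairLaw α p (m 0)) (hρ : IsTailPairLaw α p ρ) (hm : m d = noiseLaw ρ) :
    (twoSidedLaw m).map (fun w => (w 0, w d)) = ρ := by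
  have hpm : Measurable fun w : ℤ → ℝ => (w 0, w d) :=
    (measurable_pi_apply 0).prodMk (measurable_pi_apply d)
  have hind : IndepFun (fun η : ℤ → ℝ × ℝ => η 0) (fun η => η d) (Measure.infinitePi m) :=
    (iIndepFun_infinitePi (P := m) (X := fun _ e => e) fun _ => measurable_id).indepFun
      (by rcases hd with rfl | rfl <;> norm_num)
  have hpath : ∀ η, (twoSidedPath η 0, twoSidedPath η d) = ((η 0).1, noiseMap (η 0).1 (η d)) := by
    intro η
    have := twoSidedPath_mul_succ hd 0 η
    simp only [Nat.cast_zero, zero_add, mul_one, mul_zero, twoSidedPath_zero] at this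
    rw [this, twoSidedPath_zero]
  refine Measure.ext_of_lintegral _ fun F hF => ?_
  have h1 : Measurable fun q : (ℝ × ℝ) × (ℝ × ℝ) => (q.1.1, noiseMap q.1.1 q.2) :=
    (measurable_fst.comp measurable_fst).prodMk (measurable_noiseMap.comp
      ((measurable_fst.comp measurable_fst).prodMk measurable_snd))
  have hh : Measurable fun q : (ℝ × ℝ) × (ℝ × ℝ) => F (q.1.1, noiseMap q.1.1 q.2) := hF.comp h1
  have hFp : Measurable fun w : ℤ → ℝ => F (w 0, w d) := hF.comp hpm
  rw [lintegral_map hF hpm, twoSidedLaw, lintegral_map hFp measurable_twoSidedPath]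
  simp only [hpath]
  refine (lintegral_of_indepFun (measurable_pi_apply 0) (measurable_pi_apply d) hind hh).trans ?_
  rw [Measure.infinitePi_map_eval m d, hm]
  have h2 : ∀ x, ∫⁻ e, F (x, noiseMap x e) ∂(noiseLaw ρ) = ∫⁻ y, F (x, y) ∂(tailKernel ρ x) := by
    intro x
    have hFx : Measurable fun y => F (x, y) := hF.comp (measurable_const.prodMk measurable_id)
    rw [tailKernel_eq_map_noiseLaw, lintegral_map hFx (measurable_noiseMap_right x)]
  simp only [h2]
  have h3 : Measurable fun q : ℝ × ℝ => ∫⁻ y, F (q.1, y) ∂(tailKernel ρ q.1) :=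
    (Measurable.lintegral_kernel_prod_right' (κ := tailKernel ρ) hF).comp measurable_fst
  rw [← h0.lintegral_fst hp hρ hF, ← Measure.infinitePi_map_eval m 0,
    lintegral_map h3 (measurable_pi_apply 0)]

/-- Events of the path's past pull back to events of the noise's past, which is independent of the
next noise variable; freezing then identifies the conditional law. -/
theorem condExp_twoSidedLaw (hα : 0 < α) (hp : p ∈ Icc (0 : ℝ) 1) (hd : d = 1 ∨ d = -1)
    (h0 : IsTailPairLaw α p (m 0)) (hρ : IsTailPairLaw α p ρ)
    (hm : ∀ n : ℕ, m (d * (n + 1)) = noiseLaw ρ) {n : ℕ} {pr : ℤ → Prop}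
    (hpr : ∀ s, pr s ↔ d * s ≤ n) {t u : ℤ} (ht : t = d * (n + 1)) (hu : u = d * n) {B : Set ℝ}
    (hB : MeasurableSet B) :
    (twoSidedLaw m)[((fun w : ℤ → ℝ => w t) ⁻¹' B).indicator (fun _ => (1 : ℝ)) |
        pathPast pr] =ᵐ[twoSidedLaw m] fun w => (tailTransition ρ (w u)).real B := by
  have hFle : pathPast pr ≤ MeasurableSpace.pi := iSup_le fun s => (measurable_pi_apply s.1).comap_le
  have hwu : Measurable[pathPast pr] fun w : ℤ → ℝ => w u :=
    Measurable.mono (comap_measurable _)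
      (le_iSup (fun s : {s : ℤ // pr s} =>
        MeasurableSpace.comap (fun w : ℤ → ℝ => w s) inferInstance)
        ⟨u, (hpr u).2 (by rw [hu]; rcases hd with rfl | rfl <;> omega)⟩) le_rfl
  have hpast : ∀ A, MeasurableSet[pathPast pr] A → MeasurableSet[noisePast d n] (twoSidedPath ⁻¹' A) := by
    have : MeasurableSpace.comap twoSidedPath (pathPast pr) ≤ noisePast d n := by
      rw [pathPast, MeasurableSpace.comap_iSup]
      refine iSup_le fun s => ?_
      rw [MeasurableSpace.comap_comp]
      exact (measurable_twoSidedPath_noisePast hd ((hpr s).1 s.2)).comap_le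
    exact fun A hA => this _ ⟨A, hA, rfl⟩
  have hset := fun A (hA : MeasurableSet[pathPast pr] A) => measure_inter_preimage_of_indep
    (P := Measure.infinitePi m) (noisePast_le d n)
    (measurable_twoSidedPath_noisePast hd (s := d * n)
      (by rcases hd with rfl | rfl <;> omega))
    (measurable_pi_apply (d * (n + 1))) (indep_noisePast hd n) measurable_noiseMap (hpast A hA) hB
  have key := condExp_indicator_eq_of_setLIntegral (P := twoSidedLaw m) hFle
    (C := (fun w : ℤ → ℝ => w t) ⁻¹' B) (measurable_pi_apply t hB)
    (k := fun w => tailKernel ρ (w u) B) (((tailKernel ρ).measurable_coe hB).comp hwu)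
    (fun w => prob_le_one) fun A hA => ?_
  · refine key.trans ?_
    filter_upwards [ae_hasGoodSign_twoSidedLaw hα hp hd h0 hρ hm n] with w hw
    rw [← hu] at hw
    rw [tailTransition_eq ρ (hρ.fst_ne_zero_of_hasGoodSign hw)]
    rfl
  · have hkm : Measurable fun w : ℤ → ℝ => tailKernel ρ (w u) B :=
      ((tailKernel ρ).measurable_coe hB).comp (measurable_pi_apply u)
    rw [twoSidedLaw, Measure.map_apply measurable_twoSidedPath
      ((hFle _ hA).inter (measurable_pi_apply t hB)),
      setLIntegral_map (hFle _ hA) hkm measurable_twoSidedPath]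
    have h1 := hset A hA
    rw [Measure.infinitePi_map_eval m, hm] at h1
    simp only [← tailKernel_eq_map_noiseLaw, ← twoSidedPath_mul_succ hd] at h1
    rw [ht, hu]
    exact h1

end TwoSided

/-- A back-and-forth tail chain with a given forward transition law exists. -/
theorem IsTailPairLaw.exists_isBackForthTailChain {α p : ℝ} (hα : 0 < α) (hp : p ∈ Icc (0 : ℝ) 1)
    {μ : Measure (ℝ × ℝ)} (hμ : IsTailPairLaw α p μ) :
    ∃ Q : Measure (ℤ → ℝ), IsProbabilityMeasure Q ∧
      IsBackForthTailChain Q α p μ (fun t w => w t) := by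
  have hadj := hμ.areAdjointLaws_adjointLaw hα hp
  have := hμ.prob
  have := hadj.right_mem.prob
  -- At time `0` only the first component of the noise is used, as initial state. Positive times
  -- realise the kernel of `μ`, negative times that of its adjoint.
  set m : ℤ → Measure (ℝ × ℝ) := fun i =>
    if i = 0 then μ else if 0 < i then noiseLaw μ else noiseLaw (adjointLaw α μ) with hmdef
  have hprob : ∀ i, IsProbabilityMeasure (m i) := fun i => by
    simp only [hmdef]
    split_ifs <;> infer_instance
  have hm0 : m 0 = μ := if_pos rfl
  have hm1 : ∀ n : ℕ, m (1 * (n + 1)) = noiseLaw μ := fun n => by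
    simp only [hmdef]
    rw [if_neg (by omega), if_pos (by omega)]
  have hm2 : ∀ n : ℕ, m (-1 * (n + 1)) = noiseLaw (adjointLaw α μ) := fun n => by
    simp only [hmdef]
    rw [if_neg (by omega), if_neg (by omega)]
  have h0 : IsTailPairLaw α p (m 0) := by rwa [hm0]
  have hpair : (twoSidedLaw m).map (fun w => (w 0, w (-1))) = adjointLaw α μ :=
    twoSidedLaw_pair hp (Or.inr rfl) h0 hadj.right_mem (by simpa using hm2 0)
  refine ⟨twoSidedLaw m, inferInstance, fun t => measurable_pi_apply t,
    twoSidedLaw_pair hp (Or.inl rfl) h0 hμ (by simpa using hm1 0), by rwa [hpair], ?_, ?_⟩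
  · intro t ht B hB
    obtain ⟨n, hn⟩ := Int.eq_ofNat_of_zero_le (show 0 ≤ t - 1 by omega)
    exact condExp_twoSidedLaw hα hp (Or.inl rfl) h0 hμ hm1 (n := n) (fun s => by omega) (by omega)
      (by omega) hB
  · intro t ht B hB
    obtain ⟨n, hn⟩ := Int.eq_ofNat_of_zero_le (show 0 ≤ t - 1 by omega)
    rw [hpair]
    exact condExp_twoSidedLaw hα hp (Or.inr rfl) h0 hadj.right_mem hm2 (n := n)
      (fun s => by omega) (by omega) (by omega) hB

/-! ### The main theorem -/

theorem IsStationaryRecursion.exists_tailMeasure {Ω : Type*} [MeasurableSpace Ω] {P : Measure Ω}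
    [IsProbabilityMeasure P] {S : Type*} [MeasurableSpace S] {Ψ : ℝ → S → ℝ} {ε : ℕ → Ω → S}
    {X : ℕ → Ω → ℝ} {α p : ℝ} {φ : S → ℝ → ℝ} (hX : IsStationaryRecursion P Ψ ε X)
    (hRV : HasRegVaryingTails P (X 0) α p) (hφ : HasTailLimit (P.map (ε 0)) Ψ p φ)
    {Ω' : Type*} [MeasurableSpace Ω'] {P' : Measure Ω'} [IsProbabilityMeasure P']
    {M : ℤ → Ω' → ℝ} (hM : IsBackForthTailChain P' α p (forwardLaw (P.map (ε 0)) p φ) M) (t : ℕ) :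
    ∃ μ : Measure (PuncturedCube (t + 1)),
      IsFiniteMeasureOnCompacts μ ∧
      TendstoVaguely
        (fun x : ℝ => (P {ω | x < |X 0 ω|})⁻¹ •
          scaledLaw P (fun j : Fin (t + 1) => X j) x) atTop μ ∧
      (HasForwardFormulas P' α M t μ ∧
        ∀ μ' : Measure (PuncturedCube (t + 1)), HasForwardFormulas P' α M t μ' → μ' = μ) ∧
      (HasBackwardFormulas P' α M t μ ∧
        ∀ μ' : Measure (PuncturedCube (t + 1)), HasBackwardFormulas P' α M t μ' → μ' = μ) := by
  have hα := hRV.index_pos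
  have hp := hRV.weight_mem
  have := hM.adjoint_law.left_mem.prob
  have := hM.adjoint_law.right_mem.prob
  have hfwd := hM.hasForwardFormulas hp t
  have hbwd := hM.hasBackwardFormulas hα hp t
  exact ⟨_, isFiniteMeasureOnCompacts_cubeMeasure fun δ hδ =>
    hM.adjoint_law.limitMeasure_exceedSet hα hp t hδ, hX.tendstoVaguely hRV hφ hM.adjoint_law t,
    ⟨hfwd, fun μ' h => h.unique hfwd⟩, ⟨hbwd, fun μ' h => h.unique hbwd⟩⟩

theorem theoremT {Ω : Type*} [MeasurableSpace Ω] (P : Measure Ω)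
    [IsProbabilityMeasure P] {S : Type*} [MeasurableSpace S]
    (Ψ : ℝ → S → ℝ) (ε : ℕ → Ω → S) (X : ℕ → Ω → ℝ) (α p : ℝ) (φ : S → ℝ → ℝ)
    (hX : IsStationaryRecursion P Ψ ε X)
    (hRV : HasRegVaryingTails P (X 0) α p)
    (hφ : HasTailLimit (P.map (ε 0)) Ψ p φ) :
    (∃ Q : Measure (ℤ → ℝ), IsProbabilityMeasure Q ∧
      IsBackForthTailChain Q α p (forwardLaw (P.map (ε 0)) p φ) (fun t m => m t)) ∧
    (∀ (Ω' : Type*) [MeasurableSpace Ω'] (P' : Measure Ω') [IsProbabilityMeasure P']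
      (M : ℤ → Ω' → ℝ),
      IsBackForthTailChain P' α p (forwardLaw (P.map (ε 0)) p φ) M →
      ∀ t : ℕ, ∃ μ : Measure (PuncturedCube (t + 1)),
        IsFiniteMeasureOnCompacts μ ∧
        TendstoVaguely
          (fun x : ℝ => (P {ω | x < |X 0 ω|})⁻¹ •
            scaledLaw P (fun j : Fin (t + 1) => X j) x) atTop μ ∧
        (HasForwardFormulas P' α M t μ ∧
          ∀ μ' : Measure (PuncturedCube (t + 1)), HasForwardFormulas P' α M t μ' → μ' = μ) ∧
        (HasBackwardFormulas P' α M t μ ∧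
          ∀ μ' : Measure (PuncturedCube (t + 1)), HasBackwardFormulas P' α M t μ' → μ' = μ)) ∧
    (∀ t : ℕ, IsMultivariateRegVarying P (fun j : Fin (t + 1) => X j)) := by
  have hμ := hX.isTailPairLaw_of_hasTailLimit hRV hφ
  have hex := hμ.exists_isBackForthTailChain hRV.index_pos hRV.weight_mem
  refine ⟨hex, fun Ω' _ P' _ M hM t => hX.exists_tailMeasure hRV hφ hM t, fun t => ?_⟩
  -- The last claim mentions no tail chain; the chain just constructed provides the limit measure,
  -- and its forward formula shows that this measure is not zero.
  obtain ⟨Q, hQ, hM⟩ := hex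
  obtain ⟨m, hm, hvague, ⟨hfwd, -⟩, -⟩ := hX.exists_tailMeasure hRV hφ hM t
  exact hRV.isMultivariateRegVarying (hfwd.ne_zero hRV.index_pos) hvague
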